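/- Let $M$ be a smooth (finite-dimensional, Hausdorff, second countable) manifold and let $A\to M$ be a smooth affine bundle of positive finite rank, modelled on the vector bundle $V=\mathbb V(A)$. Let $A^\dagger\to M$ be the vector bundle whose fibre at $x$ is the space of affine functions $A_x\to\mathbb R$, let $1_A$ be its section of constant functions $1$, and let $\rho:A^\dagger\to A^\dagger/\langle 1_A\rangle\simeq V^*$ map an affine function to its linear part. Then $\rho$ is a one-dimensional affine bundle over the manifold $V^*$; its smooth sections form an affine space $\mathrm{Sec}(\rho)$ modelled on $C^\infty(V^*)$ by $(\sigma+f)(\lambda)=\sigma(\lambda)+f(\lambda)1_A$. Let $\mathrm{LinSec}(\rho)\subset\mathrm{Sec}(\rho)$ be the set of sections $V^*\to A^\dagger$ of $\rho$ that are vector bundle morphisms. Definitions. An affine Lie bracket on an affine space $\mathcal S$ modelled on a vector space $\mathcal W$ is a bi-affine skew-symmetric map $[\cdot,\cdot]:\mathcal S\times\mathcal S\to\mathcal W$ with $[s,[t,u]]^{v}+[t,[u,s]]^{v}+[u,[s,t]]^{v}=0$ for all $s,t,u\in\mathcal S$, where $[s,\cdot]^{v}:\mathcal W\to\mathcal W$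 is the linear part of the affine map $[s,\cdot]$. A Lie affgebroid bracket on $A$ is an affine Lie bracket on $\mathrm{Sec}(A)$ for which there is a morphism of affine bundles $\gamma:A\to TM$ over $\mathrm{id}_M$ such that $[a,fX]^{v}=f[a,X]^{v}+\gamma(a)(f)X$ for all $a\in\mathrm{Sec}(A)$, $X\in\mathrm{Sec}(V)$, $f\in C^\infty(M)$. An aff-Poisson bracket on $\rho$ is an affine Lie bracket $\{\cdot,\cdot\}$ on $\mathrm{Sec}(\rho)$, with values in $C^\infty(V^*)$, such that $\{\sigma,\cdot\}^{v}$ is a derivation of the algebra $C^\infty(V^*)$ for every $\sigma\in\mathrm{Sec}(\rho)$; it is called linear if $\{\sigma_1,\sigma_2\}$ is linear on the fibres of $V^*$ for all $\sigma_1,\sigma_2\in\mathrm{LinSec}(\rho)$. For $X\in\mathrm{Sec}(V)$ let $\iota_X\in C^\infty(V^*)$, $\iota_X(\lambda)=\lambda(X)$. Theorem. There is a bijection $\mathrm{LinSec}(\rho)\to\mathrm{Sec}(A)$, $\sigma\mapsto a_\sigma$, determined by $$\varphi(a_\sigma(x))\,1_A(x)=\varphi-\sigma(\rho(\varphi))\qquad(x\in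 M,\ \varphi\in A^\dagger_x),$$ and the condition $$\{\sigma_1,\sigma_2\}=\iota_{[a_{\sigma_1},a_{\sigma_2}]}\qquad\text{for all }\sigma_1,\sigma_2\in\mathrm{LinSec}(\rho)$$ defines a one-to-one correspondence between Lie affgebroid brackets $[\cdot,\cdot]$ on $A$ and linear aff-Poisson brackets $\{\cdot,\cdot\}$ on $\rho$: for every Lie affgebroid bracket $[\cdot,\cdot]$ on $A$ there is exactly one linear aff-Poisson bracket $\{\cdot,\cdot\}$ on $\rho$ satisfying it, and for every linear aff-Poisson bracket on $\rho$ there is exactly one Lie affgebroid bracket on $A$ satisfying it. -/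

import Mathlib

open Bundle Set
open scoped Manifold ContDiff Bundle Topology

noncomputable section

namespace AffBundle

/-! ### Affine bundles -/

section AffineBundle

variable {M : Type*} [TopologicalSpace M]
  (F : Type*) [NormedAddCommGroup F] [NormedSpace ℝ F]
  (V : M → Type*) [∀ x, AddCommGroup (V x)] [∀ x, Module ℝ (V x)]
  (A : M → Type*) [∀ x, AddTorsor (V x) (A x)]
  [TopologicalSpace (TotalSpace F A)] [∀ x, TopologicalSpace (A x)] [FiberBundle F A]

/-- The fibre bundle `A`, whose fibres `A x` are affine spaces modelled on the vector spaces `V x`,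
is an affine bundle: the trivializations of its atlas are affine on the fibres. -/
class AffineBundle : Prop where
  affine : ∀ (e : Trivialization F (π F A)) [MemTrivializationAtlas e], ∀ x ∈ e.baseSet,
    ∃ L : V x →ₗ[ℝ] F, ∀ (v : V x) (a : A x), (e ⟨x, v +ᵥ a⟩).2 = L v + (e ⟨x, a⟩).2

/-- The affine bundle `A` is smooth and modelled on the smooth vector bundle `V`: the transition maps
of `A` are smooth, and the linear parts of the trivializations of `A`, expressed in trivializations
of `V`, depend smoothly on the base point. -/
class SmoothAffineBundle {E H : Type*} [NormedAddCommGroup E] [NormedSpace ℝ E] [TopologicalSpace H]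
    (I : ModelWithCorners ℝ E H) [ChartedSpace H M]
    [TopologicalSpace (TotalSpace F V)] [∀ x, TopologicalSpace (V x)] [FiberBundle F V] : Prop where
  smooth_transition : ∀ (e e' : Trivialization F (π F A))
    [MemTrivializationAtlas e] [MemTrivializationAtlas e'],
    ContMDiffOn (I.prod 𝓘(ℝ, F)) 𝓘(ℝ, F) ∞ (fun q : M × F => (e ⟨q.1, e'.symm q.1 q.2⟩).2)
      ((e.baseSet ∩ e'.baseSet) ×ˢ univ)
  smooth_linear : ∀ (e : Trivialization F (π F A)) (e' : Trivialization F (π F V))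
    [MemTrivializationAtlas e] [MemTrivializationAtlas e'],
    ∃ g : M → F →L[ℝ] F, ContMDiffOn I 𝓘(ℝ, F →L[ℝ] F) ∞ g (e.baseSet ∩ e'.baseSet) ∧
      ∀ x ∈ e.baseSet ∩ e'.baseSet, ∀ (v : V x) (a : A x),
        (e ⟨x, v +ᵥ a⟩).2 = g x (e' ⟨x, v⟩).2 + (e ⟨x, a⟩).2

end AffineBundle

/-! ### The vector bundle `A†` of affine functions on the fibres of `A` -/

section AffDual

variable {M : Type*} (F : Type*) {V : M → Type*} [∀ x, AddCommGroup (V x)] [∀ x, Module ℝ (V x)]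
  (A : M → Type*) [∀ x, AddTorsor (V x) (A x)]

/-- The fibre of `A†` at `x`: affine functions on `A x`. (The model fibre `F` of `A` is recorded only
because the topology below is built from the trivializations of `A`.) -/
def AffDual (_F : Type*) (A : M → Type*) [∀ x, AddTorsor (V x) (A x)] (x : M) : Type _ :=
  A x →ᵃ[ℝ] ℝ

instance (x : M) : AddCommGroup (AffDual F A x) := inferInstanceAs (AddCommGroup (A x →ᵃ[ℝ] ℝ))
instance (x : M) : Module ℝ (AffDual F A x) := inferInstanceAs (Module ℝ (A x →ᵃ[ℝ] ℝ))
instance (x : M) : FunLike (AffDual F A x) (A x) ℝ :=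
  inferInstanceAs (FunLike (A x →ᵃ[ℝ] ℝ) (A x) ℝ)

/-- The distinguished section `1_A` of `A†`. -/
def oneA (x : M) : AffDual F A x := AffineMap.const ℝ (A x) (1 : ℝ)

end AffDual

section Coordinates

variable {F : Type*} [NormedAddCommGroup F] [NormedSpace ℝ F] [FiniteDimensional ℝ F]
  {W P : Type*} [AddCommGroup W] [Module ℝ W] [AddTorsor W P]

/-- Affine coordinates `c` on `P` identify an affine function `φ` on `P` with the pair `(α, b)` such
that `φ p = α (c p) + b`. -/
def dualCoord (c : P ≃ᵃ[ℝ] F) : (P →ᵃ[ℝ] ℝ) ≃ₗ[ℝ] (F →L[ℝ] ℝ) × ℝ where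
  toFun φ := (LinearMap.toContinuousLinearMap (φ.comp c.symm.toAffineMap).linear, φ (c.symm 0))
  map_add' φ ψ := by
    refine Prod.ext ?_ rfl
    ext u
    simp
  map_smul' r φ := by
    refine Prod.ext ?_ rfl
    ext u
    simp
  invFun q := ((q.1 : F →ₗ[ℝ] ℝ).toAffineMap + AffineMap.const ℝ F q.2).comp c.toAffineMap
  left_inv φ := by
    ext p
    have h := (φ.comp c.symm.toAffineMap).map_vadd 0 (c p)
    simp only [vadd_eq_add, add_zero, AffineMap.comp_apply, AffineEquiv.coe_toAffineMap,
      AffineEquiv.symm_apply_apply] at h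
    simp only [AffineMap.comp_apply, AffineMap.const_apply, Pi.add_apply,
      AffineMap.coe_add, AffineEquiv.coe_toAffineMap, LinearMap.coe_toAffineMap]
    exact h.symm
  right_inv q := by
    refine Prod.ext ?_ ?_
    · ext u
      simp
    · simp

theorem dualCoord_symm_apply (c : P ≃ᵃ[ℝ] F) (q : (F →L[ℝ] ℝ) × ℝ) (p : P) :
    (dualCoord c).symm q p = q.1 (c p) + q.2 := rfl

end Coordinates

section AffDualBundle

set_option synthInstance.maxHeartbeats 200000
set_option linter.unusedSectionVars false

variable {M : Type*} [TopologicalSpace M]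
  {F : Type*} [NormedAddCommGroup F] [NormedSpace ℝ F]
  {V : M → Type*} [∀ x, AddCommGroup (V x)] [∀ x, Module ℝ (V x)]
  {A : M → Type*} [∀ x, AddTorsor (V x) (A x)]
  [TopologicalSpace (TotalSpace F A)] [∀ x, TopologicalSpace (A x)] [FiberBundle F A]
  [AffineBundle F V A]

/-- A trivialization of `A` in its atlas, restricted to a fibre. -/
def fibreMap (e : Trivialization F (π F A)) [MemTrivializationAtlas e] {x : M}
    (hx : x ∈ e.baseSet) : A x →ᵃ[ℝ] F where
  toFun a := (e ⟨x, a⟩).2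
  linear := (AffineBundle.affine (V := V) e x hx).choose
  map_vadd' a v := (AffineBundle.affine (V := V) e x hx).choose_spec v a

theorem fibreMap_bijective (e : Trivialization F (π F A)) [MemTrivializationAtlas e] {x : M}
    (hx : x ∈ e.baseSet) : Function.Bijective (fibreMap e hx) := by
  refine ⟨fun a b h => ?_, fun u => ⟨e.symm x u, ?_⟩⟩
  · rw [← e.symm_apply_apply_mk hx a, ← e.symm_apply_apply_mk hx b]
    exact congrArg _ h
  · exact congrArg Prod.snd (e.apply_mk_symm hx u)

/-- A trivialization of `A` in its atlas, restricted to a fibre, as an affine isomorphism. -/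
def fibreEquiv (e : Trivialization F (π F A)) [MemTrivializationAtlas e] {x : M}
    (hx : x ∈ e.baseSet) : A x ≃ᵃ[ℝ] F :=
  AffineEquiv.ofBijective (fibreMap_bijective e hx)

theorem fibreEquiv_apply (e : Trivialization F (π F A)) [MemTrivializationAtlas e] {x : M}
    (hx : x ∈ e.baseSet) (a : A x) : fibreEquiv e hx a = (e ⟨x, a⟩).2 := rfl

theorem fibreEquiv_symm_apply (e : Trivialization F (π F A)) [MemTrivializationAtlas e] {x : M}
    (hx : x ∈ e.baseSet) (u : F) : (fibreEquiv e hx).symm u = e.symm x u := by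
  apply (fibreEquiv e hx).injective
  rw [AffineEquiv.apply_symm_apply, fibreEquiv_apply, e.apply_mk_symm hx]

variable [FiniteDimensional ℝ F]

/-- Coordinates on a fibre of `A†` induced by a trivialization of `A`: they map an affine function
`φ` on `A x` to the pair `(α, b)` such that `φ a = α u + b`, where `u ∈ F` is the coordinate
of `a`. -/
def dualFibre (e : Trivialization F (π F A)) [MemTrivializationAtlas e] {x : M}
    (hx : x ∈ e.baseSet) : AffDual F A x ≃ₗ[ℝ] (F →L[ℝ] ℝ) × ℝ :=
  dualCoord (fibreEquiv e hx)

theorem dualFibre_fst (e : Trivialization F (π F A)) [MemTrivializationAtlas e] {x : M}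
    (hx : x ∈ e.baseSet) (φ : AffDual F A x) (u : F) :
    (dualFibre e hx φ).1 u = φ (e.symm x u) - φ (e.symm x 0) := by
  have h := (AffineMap.comp (P1 := F) (P2 := A x) (P3 := ℝ) φ
    (fibreEquiv e hx).symm.toAffineMap).linearMap_vsub u 0
  simp only [vsub_eq_sub, sub_zero] at h
  rw [← fibreEquiv_symm_apply e hx, ← fibreEquiv_symm_apply e hx]
  exact h

theorem dualFibre_snd (e : Trivialization F (π F A)) [MemTrivializationAtlas e] {x : M}
    (hx : x ∈ e.baseSet) (φ : AffDual F A x) : (dualFibre e hx φ).2 = φ (e.symm x 0) := by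
  rw [← fibreEquiv_symm_apply e hx]
  rfl

theorem dualFibre_symm_apply (e : Trivialization F (π F A)) [MemTrivializationAtlas e] {x : M}
    (hx : x ∈ e.baseSet) (q : (F →L[ℝ] ℝ) × ℝ) (a : A x) :
    (dualFibre e hx).symm q a = q.1 (e ⟨x, a⟩).2 + q.2 := rfl

open Classical in
/-- The pretrivialization of `A†` induced by a trivialization of `A`. -/
def dualPretriv (e : Trivialization F (π F A)) [MemTrivializationAtlas e] :
    Pretrivialization ((F →L[ℝ] ℝ) × ℝ) (π ((F →L[ℝ] ℝ) × ℝ) (AffDual F A)) where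
  toFun p := (p.1, if h : p.1 ∈ e.baseSet then dualFibre e h p.2 else 0)
  invFun q := ⟨q.1, if h : q.1 ∈ e.baseSet then (dualFibre e h).symm q.2 else 0⟩
  source := TotalSpace.proj ⁻¹' e.baseSet
  target := e.baseSet ×ˢ univ
  map_source' := fun ⟨_, _⟩ h => ⟨h, mem_univ _⟩
  map_target' := fun ⟨_, _⟩ h => h.1
  left_inv' := fun ⟨x, φ⟩ h => by
    have h' : x ∈ e.baseSet := h
    simp [h']
  right_inv' := fun ⟨x, q⟩ h => by
    have h' : x ∈ e.baseSet := h.1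
    simp [h']
  open_target := e.open_baseSet.prod isOpen_univ
  baseSet := e.baseSet
  open_baseSet := e.open_baseSet
  source_eq := rfl
  target_eq := rfl
  proj_toFun _ _ := rfl

theorem dualPretriv_apply (e : Trivialization F (π F A)) [MemTrivializationAtlas e] {x : M}
    (hx : x ∈ e.baseSet) (φ : AffDual F A x) :
    dualPretriv e ⟨x, φ⟩ = (x, dualFibre e hx φ) := by
  change (x, _) = _
  rw [dif_pos hx]

theorem dualPretriv_symm_apply (e : Trivialization F (π F A)) [MemTrivializationAtlas e] {x : M}
    (hx : x ∈ e.baseSet) (q : (F →L[ℝ] ℝ) × ℝ) :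
    (dualPretriv e).symm x q = (dualFibre e hx).symm q := by
  have h := (dualPretriv e).mk_symm (b := x) hx q
  have h2 : (dualPretriv e).toPartialEquiv.symm (x, q) =
      ⟨x, (dualFibre e hx).symm q⟩ := by
    change TotalSpace.mk x _ = _
    rw [dif_pos hx]
  rw [h2] at h
  exact TotalSpace.mk_inj.1 h

instance dualPretriv.isLinear (e : Trivialization F (π F A)) [MemTrivializationAtlas e] :
    (dualPretriv e).IsLinear ℝ where
  linear x hx :=
    { map_add φ ψ := by
        simp only [dualPretriv_apply e (show x ∈ e.baseSet from hx), map_add]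
      map_smul r φ := by
        simp only [dualPretriv_apply e (show x ∈ e.baseSet from hx), map_smul] }

open Classical in
/-- The linear part of the transition map from `e'` to `e`. -/
def transLinear (e e' : Trivialization F (π F A)) [MemTrivializationAtlas e]
    [MemTrivializationAtlas e'] (x : M) : F →L[ℝ] F :=
  if h : x ∈ e.baseSet ∩ e'.baseSet then
    LinearMap.toContinuousLinearMap
      ((fibreEquiv e h.1).toAffineMap.comp (fibreEquiv e' h.2).symm.toAffineMap).linear
  else 0

theorem transLinear_apply (e e' : Trivialization F (π F A)) [MemTrivializationAtlas e]
    [MemTrivializationAtlas e'] {x : M} (h : x ∈ e.baseSet ∩ e'.baseSet) (u : F) :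
    transLinear e e' x u = (e ⟨x, e'.symm x u⟩).2 - (e ⟨x, e'.symm x 0⟩).2 := by
  have h2 := ((fibreEquiv e h.1).toAffineMap.comp
    (fibreEquiv e' h.2).symm.toAffineMap).linearMap_vsub u 0
  simp only [vsub_eq_sub, sub_zero, AffineMap.comp_apply, AffineEquiv.coe_toAffineMap,
    fibreEquiv_symm_apply, fibreEquiv_apply] at h2
  rw [transLinear, dif_pos h]
  exact h2

theorem continuousOn_trans (e e' : Trivialization F (π F A)) (u : F) :
    ContinuousOn (fun x => (e ⟨x, e'.symm x u⟩).2) (e.baseSet ∩ e'.baseSet) := by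
  have h1 : ContinuousOn (fun x => e'.toOpenPartialHomeomorph.symm (x, u))
      (e.baseSet ∩ e'.baseSet) := e'.continuousOn_symm_prodMk_left.mono inter_subset_right
  have h2 : ContinuousOn (fun x => e (e'.toOpenPartialHomeomorph.symm (x, u)))
      (e.baseSet ∩ e'.baseSet) := by
    refine e.continuousOn.comp h1 fun x hx => ?_
    rw [e.mem_source, e'.proj_symm_apply' hx.2]
    exact hx.1
  refine h2.snd.congr fun x hx => ?_
  simp only
  rw [e'.mk_symm hx.2]

theorem continuousOn_transLinear (e e' : Trivialization F (π F A)) [MemTrivializationAtlas e]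
    [MemTrivializationAtlas e'] : ContinuousOn (transLinear e e') (e.baseSet ∩ e'.baseSet) := by
  rw [continuousOn_clm_apply]
  intro u
  exact ((continuousOn_trans e e' u).sub (continuousOn_trans e e' 0)).congr
    fun x hx => transLinear_apply e e' hx u

/-- The coordinate change `(α, b) ↦ (α ∘ g, α c + b)` of `A†` induced by the coordinate change
`u ↦ g u + c` of `A`. -/
def dualChange (g : F →L[ℝ] F) (c : F) : (F →L[ℝ] ℝ) × ℝ →L[ℝ] (F →L[ℝ] ℝ) × ℝ :=
  ((ContinuousLinearMap.compL ℝ F F ℝ).flip g ∘L ContinuousLinearMap.fst ℝ (F →L[ℝ] ℝ) ℝ).prod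
    (ContinuousLinearMap.apply ℝ ℝ c ∘L ContinuousLinearMap.fst ℝ (F →L[ℝ] ℝ) ℝ +
      ContinuousLinearMap.snd ℝ (F →L[ℝ] ℝ) ℝ)

theorem dualChange_apply (g : F →L[ℝ] F) (c : F) (q : (F →L[ℝ] ℝ) × ℝ) :
    dualChange g c q = (q.1 ∘L g, q.1 c + q.2) := rfl

theorem dualChange_eq (e e' : Trivialization F (π F A)) [MemTrivializationAtlas e]
    [MemTrivializationAtlas e'] {x : M} (hx : x ∈ e.baseSet ∩ e'.baseSet)
    (q : (F →L[ℝ] ℝ) × ℝ) :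
    dualChange (transLinear e e' x) (e ⟨x, e'.symm x 0⟩).2 q =
      (dualPretriv e' ⟨x, (dualPretriv e).symm x q⟩).2 := by
  rw [dualPretriv_symm_apply e hx.1, dualPretriv_apply e' hx.2, dualChange_apply]
  refine Prod.ext ?_ ?_
  · ext u
    rw [dualFibre_fst, dualFibre_symm_apply, dualFibre_symm_apply, ContinuousLinearMap.comp_apply,
      transLinear_apply e e' hx, map_sub]
    ring
  · rw [dualFibre_snd, dualFibre_symm_apply]

instance (x : M) : TopologicalSpace (AffDual F A x) :=
  TopologicalSpace.induced (dualFibre (trivializationAt F A x) (mem_baseSet_trivializationAt F A x))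
    inferInstance

variable (F A)

/-- The vector bundle atlas of `A†` induced by the atlas of `A`. -/
def dualPrebundle : VectorPrebundle ℝ ((F →L[ℝ] ℝ) × ℝ) (AffDual F A) where
  pretrivializationAtlas :=
    {p | ∃ (e : Trivialization F (π F A)) (_ : MemTrivializationAtlas e), p = dualPretriv e}
  pretrivialization_linear' := by
    rintro _ ⟨e, he, rfl⟩
    infer_instance
  pretrivializationAt x := dualPretriv (trivializationAt F A x)
  mem_base_pretrivializationAt x := mem_baseSet_trivializationAt F A x
  pretrivialization_mem_atlas x := ⟨trivializationAt F A x, inferInstance, rfl⟩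
  exists_coordChange := by
    rintro _ ⟨e, he, rfl⟩ _ ⟨e', he', rfl⟩
    refine ⟨fun x => dualChange (transLinear e e' x) (e ⟨x, e'.symm x 0⟩).2, ?_,
      fun x hx q => dualChange_eq e e' hx q⟩
    rw [continuousOn_clm_apply]
    intro q
    simp only [dualChange_apply]
    exact (continuousOn_const.clm_comp (continuousOn_transLinear e e')).prodMk
      ((q.1.continuous.comp_continuousOn (continuousOn_trans e e' 0)).add continuousOn_const)
  totalSpaceMk_isInducing x := by
    have h : Topology.IsInducing (dualFibre (trivializationAt F A x)
      (mem_baseSet_trivializationAt F A x)) := ⟨rfl⟩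
    convert! (Topology.isInducing_const_prod (x := x)).mpr h using 1
    ext1 φ
    exact dualPretriv_apply _ _ φ

instance : TopologicalSpace (TotalSpace ((F →L[ℝ] ℝ) × ℝ) (AffDual F A)) :=
  (dualPrebundle F A).totalSpaceTopology

instance : FiberBundle ((F →L[ℝ] ℝ) × ℝ) (AffDual F A) := (dualPrebundle F A).toFiberBundle

instance : VectorBundle ℝ ((F →L[ℝ] ℝ) × ℝ) (AffDual F A) := (dualPrebundle F A).toVectorBundle

end AffDualBundle

section AffDualSmooth

set_option linter.unusedSectionVars false
set_option synthInstance.maxHeartbeats 200000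

variable {E H M : Type*} [NormedAddCommGroup E] [NormedSpace ℝ E] [TopologicalSpace H]
  {I : ModelWithCorners ℝ E H} [TopologicalSpace M] [ChartedSpace H M]

theorem contMDiffOn_clm_of_apply {G G' : Type*} [NormedAddCommGroup G] [NormedSpace ℝ G]
    [FiniteDimensional ℝ G] [NormedAddCommGroup G'] [NormedSpace ℝ G'] {T : M → G →L[ℝ] G'}
    {s : Set M} (h : ∀ u, ContMDiffOn I 𝓘(ℝ, G') ∞ (fun x => T x u) s) :
    ContMDiffOn I 𝓘(ℝ, G →L[ℝ] G') ∞ T s := by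
  let b := Module.finBasis ℝ G
  let c : Fin (Module.finrank ℝ G) → G →L[ℝ] ℝ := fun i =>
    LinearMap.toContinuousLinearMap (b.coord i)
  have hT : T = fun x => ∑ i, ContinuousLinearMap.smulRightL ℝ G G' (c i) (T x (b i)) := by
    funext x
    ext u
    have h1 := congrArg (T x) (b.sum_repr u)
    simp only [map_sum, map_smul] at h1
    simpa [c] using h1.symm
  rw [hT]
  exact contMDiffOn_finsetSum fun i _ =>
    (ContinuousLinearMap.smulRightL ℝ G G' (c i)).contMDiff.comp_contMDiffOn (h (b i))

variable {F : Type*} [NormedAddCommGroup F] [NormedSpace ℝ F] [FiniteDimensional ℝ F]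
  {V : M → Type*} [∀ x, AddCommGroup (V x)] [∀ x, Module ℝ (V x)]
  [TopologicalSpace (TotalSpace F V)] [∀ x, TopologicalSpace (V x)] [FiberBundle F V]
  {A : M → Type*} [∀ x, AddTorsor (V x) (A x)]
  [TopologicalSpace (TotalSpace F A)] [∀ x, TopologicalSpace (A x)] [FiberBundle F A]
  [AffineBundle F V A] [SmoothAffineBundle F V A I]

theorem contMDiffOn_trans (e e' : Trivialization F (π F A)) [MemTrivializationAtlas e]
    [MemTrivializationAtlas e'] (u : F) :
    ContMDiffOn I 𝓘(ℝ, F) ∞ (fun x => (e ⟨x, e'.symm x u⟩).2) (e.baseSet ∩ e'.baseSet) :=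
  (SmoothAffineBundle.smooth_transition (V := V) (I := I) e e').comp
    (contMDiffOn_id.prodMk contMDiffOn_const) fun _ hx => ⟨hx, mem_univ u⟩

instance : (dualPrebundle F A).IsContMDiff I ∞ where
  exists_contMDiffCoordChange := by
    rintro _ ⟨e, he, rfl⟩ _ ⟨e', he', rfl⟩
    refine ⟨fun x => dualChange (transLinear e e' x) (e ⟨x, e'.symm x 0⟩).2, ?_,
      fun x hx q => dualChange_eq e e' hx q⟩
    refine contMDiffOn_clm_of_apply fun q => ?_
    simp only [dualChange_apply]
    have h1 : ContMDiffOn I 𝓘(ℝ, F →L[ℝ] F) ∞ (transLinear e e') (e.baseSet ∩ e'.baseSet) :=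
      contMDiffOn_clm_of_apply fun u => ((contMDiffOn_trans e e' u).sub
        (contMDiffOn_trans e e' 0)).congr fun x hx => transLinear_apply e e' hx u
    exact (contMDiffOn_const.clm_comp h1).prodMk_space
      ((q.1.contMDiff.comp_contMDiffOn (contMDiffOn_trans e e' 0)).add contMDiffOn_const)

/-- `A†` is a smooth vector bundle. -/
instance : ContMDiffVectorBundle ∞ ((F →L[ℝ] ℝ) × ℝ) (AffDual F A) I :=
  (dualPrebundle F A).contMDiffVectorBundle I

end AffDualSmooth

/-! ### The projection `ρ : A† → V*` -/

section Projection

variable {M : Type*} [TopologicalSpace M] {F : Type*} [NormedAddCommGroup F] [NormedSpace ℝ F]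
  {V : M → Type*} [∀ x, AddCommGroup (V x)] [∀ x, Module ℝ (V x)] [∀ x, TopologicalSpace (V x)]

/-- The fibre at `x` of the dual bundle `V*`. -/
abbrev VDual (V : M → Type*) [∀ x, AddCommGroup (V x)] [∀ x, Module ℝ (V x)]
    [∀ x, TopologicalSpace (V x)] (x : M) : Type _ :=
  V x →L[ℝ] Bundle.Trivial M ℝ x

/-- The total space of the dual bundle `V*`. -/
abbrev VDualTotal (F : Type*) [NormedAddCommGroup F] [NormedSpace ℝ F] (V : M → Type*)
    [∀ x, AddCommGroup (V x)] [∀ x, Module ℝ (V x)] [∀ x, TopologicalSpace (V x)] : Type _ :=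
  TotalSpace (F →L[ℝ] ℝ) (fun x : M => V x →L[ℝ] Bundle.Trivial M ℝ x)

variable [FiniteDimensional ℝ F] [TopologicalSpace (TotalSpace F V)] [FiberBundle F V]
  [VectorBundle ℝ F V]
  {A : M → Type*} [∀ x, AddTorsor (V x) (A x)]

theorem continuous_fibre_linear {x : M} (l : V x →ₗ[ℝ] ℝ) (F : Type*) [NormedAddCommGroup F]
    [NormedSpace ℝ F] [FiniteDimensional ℝ F] [TopologicalSpace (TotalSpace F V)] [FiberBundle F V]
    [VectorBundle ℝ F V] : Continuous l := by
  let c := (trivializationAt F V x).continuousLinearEquivAt ℝ x (mem_baseSet_trivializationAt F V x)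
  have h : Continuous (l ∘ₗ (c.symm : F →ₗ[ℝ] V x)) := LinearMap.continuous_of_finiteDimensional _
  have h2 := h.comp c.continuous
  convert h2 using 1
  ext v
  simp

/-- The projection `ρ : A† → V*` maps an affine function to its linear part. -/
def rho {x : M} : AffDual F A x →ₗ[ℝ] VDual V x where
  toFun φ := ⟨AffineMap.linear (k := ℝ) (P1 := A x) (P2 := ℝ) φ, continuous_fibre_linear _ F⟩
  map_add' _ _ := rfl
  map_smul' _ _ := rfl

/-- `ρ` is onto, so that it identifies `A† / ⟨1_A⟩` with `V*`, see `ker_rho`. -/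
theorem rho_surjective {x : M} : Function.Surjective (rho : AffDual F A x →ₗ[ℝ] VDual V x) := by
  intro l
  obtain ⟨a⟩ : Nonempty (A x) := inferInstance
  refine ⟨((l : V x →ₗ[ℝ] ℝ).toAffineMap.comp (AffineEquiv.vaddConst ℝ a).symm.toAffineMap : _), ?_⟩
  ext v
  change (l : V x →ₗ[ℝ] ℝ) ((AffineEquiv.vaddConst ℝ a).symm.linear v) = l v
  simp

theorem ker_rho {x : M} :
    LinearMap.ker (rho : AffDual F A x →ₗ[ℝ] VDual V x) = Submodule.span ℝ {oneA F A x} := by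
  ext φ
  rw [LinearMap.mem_ker, Submodule.mem_span_singleton]
  constructor
  · intro h
    obtain ⟨a⟩ : Nonempty (A x) := inferInstance
    refine ⟨φ a, ?_⟩
    refine AffineMap.ext (k := ℝ) (P1 := A x) (P2 := ℝ) fun b => ?_
    have h1 := AffineMap.linearMap_vsub (k := ℝ) (P1 := A x) (P2 := ℝ) φ b a
    have h2 : AffineMap.linear (k := ℝ) (P1 := A x) (P2 := ℝ) φ (b -ᵥ a) = 0 :=
      DFunLike.congr_fun h (b -ᵥ a)
    rw [h2, vsub_eq_sub] at h1
    change φ a * 1 = φ b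
    have h3 : (0 : ℝ) = φ b - φ a := h1
    linarith
  · rintro ⟨r, rfl⟩
    rw [map_smul]
    refine smul_eq_zero_of_right r ?_
    ext v
    rfl

end Projection

/-! ### Affine Lie brackets -/

section Brackets

variable {W S U : Type*} [AddCommGroup W] [Module ℝ W] [AddAction W S] [AddCommGroup U] [Module ℝ U]

/-- `D : S → U` is an affine map, where `S` is an affine space modelled on `W`. -/
def IsAffine (W : Type*) [AddCommGroup W] [Module ℝ W] [AddAction W S] (D : S → U) : Prop :=
  ∃ L : W →ₗ[ℝ] U, ∀ w s, D (w +ᵥ s) = L w + D s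

/-- The affine-linear part `[s, ·]ᵛ` of a bi-affine bracket. (The linear part of the affine map
`[s, ·]` can be computed at any base point, here at `s`.) -/
def vpart (B : S → S → U) (s : S) (w : W) : U := B s (w +ᵥ s) - B s s

/-- Affine Lie brackets on an affine space `S` modelled on `W`. -/
structure IsAffineLieBracket (B : S → S → W) : Prop where
  affine_left : ∀ t, IsAffine W fun s => B s t
  affine_right : ∀ s, IsAffine W (B s)
  skew : ∀ s t, B s t = -B t s
  jacobi : ∀ s t u, vpart B s (B t u) + vpart B t (B u s) + vpart B u (B s t) = 0

end Brackets

/-! ### Lie affgebroid brackets -/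

section Affgebroid

set_option linter.unusedSectionVars false

variable {E H M : Type*} [NormedAddCommGroup E] [NormedSpace ℝ E] [TopologicalSpace H]
  (I : ModelWithCorners ℝ E H) [TopologicalSpace M] [ChartedSpace H M]
  (F : Type*) [NormedAddCommGroup F] [NormedSpace ℝ F]
  (V : M → Type*) [∀ x, AddCommGroup (V x)] [∀ x, Module ℝ (V x)]
  [TopologicalSpace (TotalSpace F V)] [∀ x, TopologicalSpace (V x)] [FiberBundle F V]
  (A : M → Type*) [∀ x, AddTorsor (V x) (A x)]
  [TopologicalSpace (TotalSpace F A)] [∀ x, TopologicalSpace (A x)] [FiberBundle F A]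

variable {I F V A} in
theorem contMDiff_vadd [SmoothAffineBundle F V A I] (X : Cₛ^∞⟮I; F, V⟯) (a : Cₛ^∞⟮I; F, A⟯) :
    ContMDiff I (I.prod 𝓘(ℝ, F)) ∞ (fun x => TotalSpace.mk' F x (X x +ᵥ a x)) := by
  intro x₀
  have hX := X.contMDiff x₀
  have ha := a.contMDiff x₀
  rw [contMDiffAt_section] at hX ha ⊢
  obtain ⟨g, hg, h⟩ := SmoothAffineBundle.smooth_linear (I := I) (trivializationAt F A x₀)
    (trivializationAt F V x₀)
  have hU : (trivializationAt F A x₀).baseSet ∩ (trivializationAt F V x₀).baseSet ∈ 𝓝 x₀ :=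
    ((trivializationAt F A x₀).open_baseSet.inter (trivializationAt F V x₀).open_baseSet).mem_nhds
      ⟨mem_baseSet_trivializationAt F A x₀, mem_baseSet_trivializationAt F V x₀⟩
  refine (((hg.contMDiffAt hU).clm_apply hX).add ha).congr_of_eventuallyEq ?_
  filter_upwards [hU] with x hx using h x hx _ _

variable [VectorBundle ℝ F V]

/-- Sections of `A` form an affine space modelled on sections of `V`. -/
instance [SmoothAffineBundle F V A I] : AddAction Cₛ^∞⟮I; F, V⟯ Cₛ^∞⟮I; F, A⟯ where
  vadd X a := ⟨fun x => X x +ᵥ a x, contMDiff_vadd X a⟩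
  zero_vadd a := ContMDiffSection.ext fun x => zero_vadd (V x) (a x)
  add_vadd X Y a := ContMDiffSection.ext fun x => add_vadd (X x) (Y x) (a x)

/-- The product of a smooth function and a smooth section. -/
def smulSec {I : ModelWithCorners ℝ E H} {F : Type*} [NormedAddCommGroup F] [NormedSpace ℝ F]
    {V : M → Type*} [∀ x, AddCommGroup (V x)] [∀ x, Module ℝ (V x)]
    [TopologicalSpace (TotalSpace F V)] [∀ x, TopologicalSpace (V x)] [FiberBundle F V]
    [VectorBundle ℝ F V] (f : C^∞⟮I, M; 𝓘(ℝ, ℝ), ℝ⟯) (X : Cₛ^∞⟮I; F, V⟯) : Cₛ^∞⟮I; F, V⟯ :=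
  ⟨fun x => f x • X x, f.contMDiff.smul_section X.contMDiff⟩

/-- The derivative of the smooth function `f` in the direction of the tangent vector `v`. -/
def dirDeriv {I : ModelWithCorners ℝ E H} (f : C^∞⟮I, M; 𝓘(ℝ, ℝ), ℝ⟯) (x : M)
    (v : TangentSpace I x) : ℝ :=
  mfderiv I 𝓘(ℝ, ℝ) f x v

/-- Morphisms `A → TM` of affine bundles over the identity of `M`. -/
structure AnchorMap [IsManifold I 1 M] where
  toFun : ∀ x, A x →ᵃ[ℝ] TangentSpace I x
  smooth : ContMDiff (I.prod 𝓘(ℝ, F)) I.tangent ∞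
    (fun p : TotalSpace F A => (⟨p.1, toFun p.1 p.2⟩ : TangentBundle I M))

variable {I F V A}

/-- Lie affgebroid brackets on the affine bundle `A`. -/
structure IsLieAffgebroidBracket [IsManifold I 1 M] [SmoothAffineBundle F V A I]
    (B : Cₛ^∞⟮I; F, A⟯ → Cₛ^∞⟮I; F, A⟯ → Cₛ^∞⟮I; F, V⟯) : Prop where
  isAffineLieBracket : IsAffineLieBracket B
  exists_anchor : ∃ γ : AnchorMap I F V A, ∀ (a : Cₛ^∞⟮I; F, A⟯) (f : C^∞⟮I, M; 𝓘(ℝ, ℝ), ℝ⟯)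
    (X : Cₛ^∞⟮I; F, V⟯) (x : M),
    vpart B a (smulSec f X) x =
      f x • vpart B a X x + dirDeriv f x (γ.toFun x (a x)) • X x

end Affgebroid

/-! ### Linear aff-Poisson brackets -/

section AffPoisson

variable {E H M : Type*} [NormedAddCommGroup E] [NormedSpace ℝ E] [TopologicalSpace H]
  (I : ModelWithCorners ℝ E H) [TopologicalSpace M] [ChartedSpace H M]
  (F : Type*) [NormedAddCommGroup F] [NormedSpace ℝ F] [FiniteDimensional ℝ F]
  (V : M → Type*) [∀ x, AddCommGroup (V x)] [∀ x, Module ℝ (V x)]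
  [TopologicalSpace (TotalSpace F V)] [∀ x, TopologicalSpace (V x)] [FiberBundle F V]
  [VectorBundle ℝ F V]
  (A : M → Type*) [∀ x, AddTorsor (V x) (A x)]
  [TopologicalSpace (TotalSpace F A)] [∀ x, TopologicalSpace (A x)] [FiberBundle F A]
  [AffineBundle F V A]

/-- The algebra `C^∞(V*)` of smooth functions on the total space of the dual bundle of `V`. -/
abbrev DualFun : Type _ :=
  C^∞⟮I.prod 𝓘(ℝ, F →L[ℝ] ℝ), VDualTotal F V; 𝓘(ℝ, ℝ), ℝ⟯

/-- Smooth sections of `ρ : A† → V*`. -/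
@[ext]
structure RhoSection where
  toFun : ∀ p : VDualTotal F V, AffDual F A p.1
  smooth : ContMDiff (I.prod 𝓘(ℝ, F →L[ℝ] ℝ)) (I.prod 𝓘(ℝ, (F →L[ℝ] ℝ) × ℝ)) ∞
    (fun p => TotalSpace.mk' ((F →L[ℝ] ℝ) × ℝ) p.1 (toFun p))
  rho_toFun : ∀ p, rho (toFun p) = p.2

variable {I F V A}

theorem RhoSection.smooth_vadd (f : DualFun I F V) (σ : RhoSection I F V A) :
    ContMDiff (I.prod 𝓘(ℝ, F →L[ℝ] ℝ)) (I.prod 𝓘(ℝ, (F →L[ℝ] ℝ) × ℝ)) ∞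
      (fun p : VDualTotal F V =>
        TotalSpace.mk' ((F →L[ℝ] ℝ) × ℝ) p.1 (σ.toFun p + f p • oneA F A p.1)) := by
  intro p₀
  have h := σ.smooth p₀
  rw [contMDiffAt_totalSpace] at h ⊢
  refine ⟨h.1, ?_⟩
  have h2 : ContMDiffAt (I.prod 𝓘(ℝ, F →L[ℝ] ℝ)) 𝓘(ℝ, (F →L[ℝ] ℝ) × ℝ) ∞
      (fun p : VDualTotal F V => f p • ((0, 1) : (F →L[ℝ] ℝ) × ℝ)) p₀ :=
    (f.contMDiff p₀).smul contMDiffAt_const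
  refine (h.2.add h2).congr_of_eventuallyEq ?_
  have hU : (fun p : VDualTotal F V => p.1) ⁻¹' (trivializationAt F A p₀.1).baseSet ∈ 𝓝 p₀ :=
    h.1.continuousAt.preimage_mem_nhds
      ((trivializationAt F A p₀.1).open_baseSet.mem_nhds (mem_baseSet_trivializationAt F A p₀.1))
  filter_upwards [hU] with p hp
  have hp' : p.1 ∈ (trivializationAt F A p₀.1).baseSet := hp
  have key : ∀ φ : AffDual F A p.1,
      ((trivializationAt ((F →L[ℝ] ℝ) × ℝ) (AffDual F A) p₀.1) ⟨p.1, φ⟩).2 =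
        dualFibre (trivializationAt F A p₀.1) hp' φ := fun φ =>
    congrArg Prod.snd (dualPretriv_apply (trivializationAt F A p₀.1) hp' φ)
  have h1 : dualFibre (trivializationAt F A p₀.1) hp' (oneA F A p.1) = (0, 1) := by
    refine Prod.ext ?_ ?_
    · ext u
      rw [dualFibre_fst]
      exact sub_self (1 : ℝ)
    · rw [dualFibre_snd]
      rfl
  change ((trivializationAt ((F →L[ℝ] ℝ) × ℝ) (AffDual F A) p₀.1)
      ⟨p.1, σ.toFun p + f p • oneA F A p.1⟩).2 =
    ((trivializationAt ((F →L[ℝ] ℝ) × ℝ) (AffDual F A) p₀.1) ⟨p.1, σ.toFun p⟩).2 + _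
  rw [key, key, map_add, map_smul, h1]

/-- Sections of `ρ` form an affine space modelled on `C^∞(V*)`: the difference of two sections is a
multiple of `1_A`. -/
instance : AddAction (DualFun I F V) (RhoSection I F V A) where
  vadd f σ :=
    { toFun := fun p => σ.toFun p + f p • oneA F A p.1
      smooth := RhoSection.smooth_vadd f σ
      rho_toFun := fun p => by
        have h : rho (oneA F A p.1) = 0 := by
          rw [← LinearMap.mem_ker, ker_rho]
          exact Submodule.mem_span_singleton_self _
        rw [map_add, map_smul, h, smul_zero, add_zero, σ.rho_toFun] }
  zero_vadd σ := RhoSection.ext (funext fun p => by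
    change σ.toFun p + (0 : ℝ) • oneA F A p.1 = _
    rw [zero_smul, add_zero])
  add_vadd f g σ := RhoSection.ext (funext fun p => by
    change σ.toFun p + (f p + g p) • oneA F A p.1 =
      (σ.toFun p + g p • oneA F A p.1) + f p • oneA F A p.1
    rw [add_smul]
    abel)

/-- Aff-Poisson brackets on the one-dimensional affine bundle `ρ : A† → V*`: affine Lie brackets on
its sections such that each `{σ, ·}` is an affine derivation. -/
structure IsAffPoisson (P : RhoSection I F V A → RhoSection I F V A → DualFun I F V) : Prop where
  isAffineLieBracket : IsAffineLieBracket P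
  leibniz : ∀ (σ : RhoSection I F V A) (f g : DualFun I F V),
    vpart P σ (f * g) = f * vpart P σ g + vpart P σ f * g

/-- Linear sections of `ρ`: those that are morphisms of vector bundles `V* → A†`. -/
def RhoSection.IsLinear (σ : RhoSection I F V A) : Prop :=
  ∀ x, IsLinearMap ℝ (fun l : VDual V x => σ.toFun ⟨x, l⟩)

/-- The smooth function `f` on `V*` is linear on the fibres. -/
def IsLinearFun (f : DualFun I F V) : Prop :=
  ∀ x, IsLinearMap ℝ (fun l : VDual V x => f ⟨x, l⟩)

/-- Linear aff-Poisson brackets: the bracket of linear sections is a linear function. -/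
structure IsLinearAffPoisson (P : RhoSection I F V A → RhoSection I F V A → DualFun I F V) :
    Prop where
  isAffPoisson : IsAffPoisson P
  linear : ∀ σ₁ σ₂ : RhoSection I F V A, σ₁.IsLinear → σ₂.IsLinear → IsLinearFun (P σ₁ σ₂)

variable (I F V A)

/-- The space `LinSec(ρ)` of linear sections of `ρ`. -/
abbrev LinSec : Type _ := {σ : RhoSection I F V A // σ.IsLinear}

end AffPoisson

end AffBundle

end

/-! A section `a` of A gives the linear section of ρ that sends λ to the affine function with linear
part λ vanishing along `a` (`vanishingSection`). Replacing `a` by X + a adds -ι_X, so this embeds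
Sec(A) anti-affinely in Sec(ρ). The image is exactly LinSec(ρ): two sections of ρ differ by a
function on V*, which is fibrewise linear when both sections are, and fibrewise linear functions are
the ι_X (`IsLinearFun.exists_iota`). Hence the condition of the theorem says that {·,·} extends
[·,·] along this embedding.

After the choice of a base point, an affine Lie bracket is a Lie bracket b on the model vector space
together with a derivation D of it: [X + a₀, Y + a₀] = DY - DX + b(X, Y). The anti-affine embedding
changes the sign of D and preserves b. What remains is the correspondence between Lie algebroids and
linear Poisson structures, with a compatible derivation on each side.

Uniqueness of {·,·}: a derivation of C^∞(V*) is determined by its values on the ι_X (`IsDer.ext`).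
Applied to ι_{fX} = f ι_X, the Leibniz rule determines D(f) ι_X for every X, hence D(f) off the zero
section and, the rank being positive, everywhere by continuity. At each point every covector is the
differential of some ι_X + h, and by Hadamard's lemma a point derivation sees only the differential.

Existence of {·,·}: the derivation and the bracket are prescribed on the functions ι_X + h by the
anchor and the given bracket. Their values at a point depend only on the differentials there
(`derivative_add_dirDeriv_eq_zero`), so they extend to C^∞(V*) (`exists_derivation`,
`exists_biderivation`). The Jacobi identity and the compatibility of the two compare derivations in
each argument, so it is enough to check them on the ι_X.

Conversely, a linear aff-Poisson bracket restricts to a bracket on Sec(A) since its values on linear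
sections are functions ι_X. The derivation -{σ_a, ·}ᵛ preserves the fibrewise linear functions,
hence also the basic ones (`IsDer.exists_basic`), and its action on C^∞(M) is the symbol of [a, ·]ᵛ.
The bilinear part vanishes on pairs of basic functions, so the symbol is C^∞(M)-affine in `a`; it
therefore comes from a bundle map A → TM, the anchor (`exists_anchorMap`). -/

noncomputable section

namespace AffBundle

/-! ### Hadamard's lemma on a normed space -/

section Hadamard

variable {E : Type*} [NormedAddCommGroup E] [NormedSpace ℝ E]
  {G : Type*} [NormedAddCommGroup G] [NormedSpace ℝ G] 

open MeasureTheory in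
/-- Integrals over `[0, 1]` depend smoothly on parameters. -/
theorem contDiff_integral_unitInterval {g : E × ℝ → G} (hg : ContDiff ℝ ∞ g) :
    ContDiff ℝ ∞ (fun z => ∫ t in (0 : ℝ)..1, g (z, t)) := by
  -- The integral is the convolution at 0 of the indicator of (0, 1] with s ↦ g(z, -s). The bump
  -- supplies the compact support needed for smoothness and equals 1 on [-2, 2], so it does not
  -- change the integral.
  let χ : ContDiffBump (0 : ℝ) := ⟨2, 3, by norm_num, by norm_num⟩
  let k : E → ℝ → G := fun z s => χ s • g (z, -s)
  let f : ℝ → ℝ := (Ioc (0 : ℝ) 1).indicator 1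
  have hk : ContDiffOn ℝ ∞ ↿k (univ ×ˢ univ) := by
    refine ContDiff.contDiffOn ?_
    change ContDiff ℝ ∞ fun q : E × ℝ => χ q.2 • g (q.1, -q.2)
    exact (χ.contDiff.comp contDiff_snd).smul (hg.comp (contDiff_fst.prodMk contDiff_snd.neg))
  have hf : LocallyIntegrable f volume := by
    refine Integrable.locallyIntegrable ?_
    rw [integrable_indicator_iff measurableSet_Ioc]
    exact integrableOn_const (by simp) (by simp)
  have h := contDiffOn_convolution_right_with_param_comp (μ := volume) (n := ⊤)
    (ContinuousLinearMap.lsmul ℝ ℝ : ℝ →L[ℝ] G →L[ℝ] G) (s := (univ : Set E))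
    (v := fun _ => (0 : ℝ)) contDiffOn_const (k := Metric.closedBall 0 3) isOpen_univ
    (isCompact_closedBall _ _) (g := k) (fun z s _ hs => ?_) hf hk
  · rw [contDiffOn_univ] at h
    convert h using 2 with z
    rw [intervalIntegral.integral_of_le zero_le_one, convolution_def,
      ← integral_indicator measurableSet_Ioc]
    congr 1
    ext t
    by_cases ht : t ∈ Ioc (0 : ℝ) 1
    · have h1 : χ (-t) = 1 := χ.one_of_mem_closedBall (by
        rw [mem_closedBall_zero_iff, norm_neg, Real.norm_eq_abs, abs_of_pos ht.1]
        exact ht.2.trans (by norm_num))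
      simp [f, k, ht, h1]
    · simp [f, ht]
  · have h1 : χ s = 0 := χ.zero_of_le_dist (by
      rw [Metric.mem_closedBall, not_le] at hs
      exact hs.le)
    simp [k, h1]

/-- **Hadamard's lemma**. -/
theorem exists_hadamard {f : E → ℝ} (hf : ContDiff ℝ ∞ f) (z₀ : E) :
    ∃ g : E → E →L[ℝ] ℝ, ContDiff ℝ ∞ g ∧ (∀ z, f z = f z₀ + g z (z - z₀)) ∧
      g z₀ = fderiv ℝ f z₀ := by
  have hf' : ContDiff ℝ ∞ (fderiv ℝ f) := hf.fderiv_right (by simp)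
  have hline : ContDiff ℝ ∞ (fun q : E × ℝ => fderiv ℝ f (z₀ + q.2 • (q.1 - z₀))) :=
    hf'.comp (contDiff_const.add (contDiff_snd.smul (contDiff_fst.sub contDiff_const)))
  -- The factor is the average of the differential of f over the segment from z₀ to z; the
  -- fundamental theorem of calculus gives the formula.
  refine ⟨fun z => ∫ t in (0 : ℝ)..1, fderiv ℝ f (z₀ + t • (z - z₀)),
    contDiff_integral_unitInterval hline, fun z => ?_, by simp⟩
  have hcont : Continuous fun t : ℝ => fderiv ℝ f (z₀ + t • (z - z₀)) :=
    hline.continuous.comp (continuous_const.prodMk continuous_id)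
  have hderiv : ∀ t ∈ uIcc (0 : ℝ) 1, HasDerivAt (fun t : ℝ => f (z₀ + t • (z - z₀)))
      (fderiv ℝ f (z₀ + t • (z - z₀)) (z - z₀)) t := fun t _ => by
    have h1 : HasDerivAt (fun t : ℝ => z₀ + t • (z - z₀)) (z - z₀) t := by
      simpa using ((hasDerivAt_id t).smul_const (z - z₀)).const_add z₀
    exact ((hf.differentiable (by simp)).differentiableAt.hasFDerivAt).comp_hasDerivAt t h1
  have h := intervalIntegral.integral_eq_sub_of_hasDerivAt hderiv
    ((hcont.clm_apply continuous_const).intervalIntegrable _ _)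
  rw [← ContinuousLinearMap.intervalIntegral_apply (hcont.intervalIntegrable _ _)] at h
  rw [h]
  simp

end Hadamard

theorem clm_comp_eq_sum {E : Type*} [NormedAddCommGroup E] [NormedSpace ℝ E]
    [FiniteDimensional ℝ E] {ι : Type*} [Fintype ι] (b : Module.Basis ι ℝ E)
    (T : E →L[ℝ] ℝ) (L : E →L[ℝ] E) :
    T.comp L = ∑ i, T (b i) • (LinearMap.toContinuousLinearMap (b.coord i)).comp L := by
  ext v
  have h := congrArg T (b.sum_repr (L v))
  rw [map_sum] at h
  rw [ContinuousLinearMap.comp_apply, ← h, sum_apply]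
  refine Finset.sum_congr rfl fun i _ => ?_
  rw [map_smul, smul_eq_mul, mul_comm]
  rfl

/-! ### Point derivations and differentials on manifolds -/

section Manifold

set_option linter.unusedSectionVars false

variable {E H N : Type*} [NormedAddCommGroup E] [NormedSpace ℝ E] [FiniteDimensional ℝ E]
  [TopologicalSpace H] {I : ModelWithCorners ℝ E H} [TopologicalSpace N] [ChartedSpace H N]
  [IsManifold I ∞ N] [T2Space N]

/-- There are smooth functions with value `1` near `p` that are supported in a given
neighbourhood of `p`. -/
theorem exists_cutoff {p : N} {U : Set N} (hU : U ∈ 𝓝 p) :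
    ∃ χ : C^∞⟮I, N; 𝓘(ℝ, ℝ), ℝ⟯, (∀ᶠ q in 𝓝 p, χ q = 1) ∧ tsupport χ ⊆ U := by
  obtain ⟨χ, -, hχ⟩ := (SmoothBumpFunction.nhds_basis_tsupport (I := I) p).mem_iff.1 hU
  exact ⟨⟨χ, χ.contMDiff⟩, χ.eventuallyEq_one, hχ⟩

/-- Germs of smooth functions extend to the whole manifold. -/
theorem exists_contMDiffMap_eventuallyEq {G : Type*} [NormedAddCommGroup G] [NormedSpace ℝ G]
    {p : N} {U : Set N} (hU : U ∈ 𝓝 p) {g : N → G} (hg : ContMDiffOn I 𝓘(ℝ, G) ∞ g U) :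
    ∃ g' : C^∞⟮I, N; 𝓘(ℝ, G), G⟯, ∀ᶠ q in 𝓝 p, g' q = g q := by
  obtain ⟨χ, h1, hχ⟩ := exists_cutoff (I := I) (interior_mem_nhds.2 hU)
  refine ⟨⟨fun q => χ q • g q, contMDiff_of_tsupport fun q hq => ?_⟩, ?_⟩
  · have hq' : q ∈ interior U := hχ (tsupport_smul_subset_left _ _ hq)
    exact (χ.contMDiff q).smul (hg.contMDiffAt (mem_interior_iff_mem_nhds.1 hq'))
  · filter_upwards [h1] with q hq
    change χ q • g q = g q
    rw [hq, one_smul]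

/-- A point derivation only depends on germs. -/
theorem pointDerivation_congr {p : N} {D : C^∞⟮I, N; 𝓘(ℝ, ℝ), ℝ⟯ →ₗ[ℝ] ℝ}
    (hD : ∀ f g, D (f * g) = f p * D g + g p * D f) {f g : C^∞⟮I, N; 𝓘(ℝ, ℝ), ℝ⟯}
    (h : ∀ᶠ q in 𝓝 p, f q = g q) : D f = D g := by
  obtain ⟨χ, h1, hχ⟩ := exists_cutoff (I := I) h
  -- χ is supported where f = g, so the factor 1 - χ changes nothing. Both factors vanish at p, and
  -- the Leibniz rule gives D(f - g) = 0.
  have h2 : f - g = (1 - χ) * (f - g) := by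
    ext q
    change f q - g q = (1 - χ q) * (f q - g q)
    by_cases hq : q ∈ tsupport χ
    · rw [hχ hq]
      ring
    · rw [image_eq_zero_of_notMem_tsupport hq]
      ring
  have h3 := hD (1 - χ) (f - g)
  rw [← h2] at h3
  have h4 : (1 - χ) p = 0 := by
    change 1 - χ p = 0
    rw [h1.self_of_nhds, sub_self]
  have h5 : (f - g) p = 0 := by
    change f p - g p = 0
    rw [h.self_of_nhds, sub_self]
  rw [h4, h5, zero_mul, zero_mul, add_zero, map_sub] at h3
  exact sub_eq_zero.1 h3

theorem pointDerivation_one {p : N} {D : C^∞⟮I, N; 𝓘(ℝ, ℝ), ℝ⟯ →ₗ[ℝ] ℝ}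
    (hD : ∀ f g, D (f * g) = f p * D g + g p * D f) : D 1 = 0 := by
  have h := hD 1 1
  rw [mul_one] at h
  change D 1 = 1 * D 1 + 1 * D 1 at h
  linarith

variable [I.Boundaryless]

/-- A point derivation vanishes on functions with vanishing differential. -/
theorem pointDerivation_eq_zero {p : N} {D : C^∞⟮I, N; 𝓘(ℝ, ℝ), ℝ⟯ →ₗ[ℝ] ℝ}
    (hD : ∀ f g, D (f * g) = f p * D g + g p * D f) {f : C^∞⟮I, N; 𝓘(ℝ, ℝ), ℝ⟯}
    (hf : mfderiv I 𝓘(ℝ, ℝ) f p = 0) : D f = 0 := by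
  set ψ := extChartAt I p with hψ
  have hsrc : ψ.source ∈ 𝓝 p := extChartAt_source_mem_nhds p
  have htgt : ψ.target ∈ 𝓝 (ψ p) := extChartAt_target_mem_nhds p
  have hψs : ContMDiffOn I 𝓘(ℝ, E) ∞ ψ ψ.source := by
    rw [hψ, extChartAt_source]
    exact contMDiffOn_extChartAt
  have hloc : ContMDiffOn 𝓘(ℝ, E) 𝓘(ℝ, ℝ) ∞ (f ∘ ψ.symm) ψ.target :=
    f.contMDiff.comp_contMDiffOn (contMDiffOn_extChartAt_symm p)
  -- Hadamard's lemma needs a function on the whole model space, so the local representative of f is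
  -- replaced by a global function with the same germ.
  obtain ⟨k, hk⟩ := exists_contMDiffMap_eventuallyEq htgt hloc
  have hfd : fderiv ℝ k (ψ p) = 0 := by
    rw [Filter.EventuallyEq.fderiv_eq (f₁ := k) hk]
    have h := hf
    rw [(f.contMDiff.mdifferentiable (by simp) p).mfderiv, I.range_eq_univ,
      fderivWithin_univ, writtenInExtChartAt, extChartAt_model_space_eq_id] at h
    exact h
  obtain ⟨g, hg, hgk, hg0⟩ := exists_hadamard k.contMDiff.contDiff (ψ p)
  let b := Module.finBasis ℝ E
  have hz : ∀ i, ContMDiffOn I 𝓘(ℝ, ℝ) ∞ (fun q => b.coord i (ψ q - ψ p)) ψ.source := fun i =>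
    (LinearMap.toContinuousLinearMap (b.coord i)).contMDiff.comp_contMDiffOn
      (hψs.sub contMDiffOn_const)
  have hgi : ∀ i, ContMDiffOn I 𝓘(ℝ, ℝ) ∞ (fun q => g (ψ q) (b i)) ψ.source := fun i =>
    (hg.contMDiff.comp_contMDiffOn hψs).clm_apply contMDiffOn_const
  choose Z hZ using fun i => exists_contMDiffMap_eventuallyEq hsrc (hz i)
  choose W hW using fun i => exists_contMDiffMap_eventuallyEq hsrc (hgi i)
  -- Hadamard's formula in coordinates: Z i are the coordinates centred at p, and W i takes at p the
  -- value of the i-th partial derivative of f, which is zero. Both factors of each product vanish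
  -- at p.
  have key : D f = D (f p • 1 + ∑ i, Z i * W i) := by
    refine pointDerivation_congr hD ?_
    have h1 : ∀ᶠ q in 𝓝 p, k (ψ q) = (f ∘ ψ.symm) (ψ q) :=
      (continuousAt_extChartAt p).eventually hk
    filter_upwards [hsrc, h1, Filter.eventually_all.2 hZ, Filter.eventually_all.2 hW]
      with q hq h1 hZ hW
    have h2 : (f p • (1 : C^∞⟮I, N; 𝓘(ℝ, ℝ), ℝ⟯) + ∑ i, Z i * W i) q
        = f p + ∑ i, Z i q * W i q := by
      rw [ContMDiffMap.coe_add, Pi.add_apply, ← ContMDiffMap.coeFnAddMonoidHom_apply (∑ i, _),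
        map_sum, Finset.sum_apply, ContMDiffMap.coe_smul]
      simp
    rw [h2]
    have h3 := hgk (ψ q)
    have h4 : k (ψ p) = f p := by
      rw [hk.self_of_nhds, Function.comp_apply, extChartAt_to_inv]
    rw [h1, h4, Function.comp_apply, ψ.left_inv hq] at h3
    rw [h3]
    congr 1
    conv_lhs => rw [← b.sum_repr (ψ q - ψ p)]
    rw [map_sum]
    refine Finset.sum_congr rfl fun i _ => ?_
    rw [map_smul, hZ, hW, smul_eq_mul]
    rfl
  rw [key, map_add, map_smul, pointDerivation_one hD, smul_zero, zero_add, map_sum]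
  refine Finset.sum_eq_zero fun i _ => ?_
  rw [hD, (hZ i).self_of_nhds, (hW i).self_of_nhds, hg0, hfd]
  simp

/-- Near `p`, the differential of a smooth function is a combination, with smooth coefficients, of
the differentials of the coordinates of the chart at `p`. -/
theorem exists_mfderiv_eq_sum {ι : Type*} [Fintype ι] (b : Module.Basis ι ℝ E) (p : N)
    (f : C^∞⟮I, N; 𝓘(ℝ, ℝ), ℝ⟯) :
    ∃ c : ι → N → ℝ, (∀ i, ContMDiffAt I 𝓘(ℝ, ℝ) ∞ (c i) p) ∧
      ∀ᶠ q in 𝓝 p, mfderiv I 𝓘(ℝ, ℝ) f q =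
        ∑ i, c i q • mfderiv I 𝓘(ℝ, ℝ) (fun q => b.coord i (extChartAt I p q)) q := by
  set ψ := extChartAt I p with hψ
  have hsrc : ψ.source ∈ 𝓝 p := extChartAt_source_mem_nhds p
  have hopen : IsOpen ψ.target := isOpen_extChartAt_target p
  have hψs : ContMDiffOn I 𝓘(ℝ, E) ∞ ψ ψ.source := by
    rw [hψ, extChartAt_source]
    exact contMDiffOn_extChartAt
  have hloc : ContDiffOn ℝ ∞ (f ∘ ψ.symm) ψ.target :=
    (f.contMDiff.comp_contMDiffOn (contMDiffOn_extChartAt_symm p)).contDiffOn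
  have hfd : ContDiffOn ℝ ∞ (fderiv ℝ (f ∘ ψ.symm)) ψ.target :=
    hloc.fderiv_of_isOpen hopen (by simp)
  -- The coefficients are the partial derivatives in the chart.
  refine ⟨fun i q => fderiv ℝ (f ∘ ψ.symm) (ψ q) (b i), fun i => ?_, ?_⟩
  · have h : ContMDiffOn I 𝓘(ℝ, E →L[ℝ] ℝ) ∞ (fun q => fderiv ℝ (f ∘ ψ.symm) (ψ q)) ψ.source :=
      hfd.contMDiffOn.comp hψs fun q hq => ψ.map_source hq
    exact (h.contMDiffAt hsrc).clm_apply contMDiffAt_const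
  · filter_upwards [eventually_mem_nhds_iff.2 hsrc] with q hq
    have hqs : q ∈ ψ.source := mem_of_mem_nhds hq
    have hψq : MDifferentiableAt I 𝓘(ℝ, E) ψ q := (hψs.contMDiffAt hq).mdifferentiableAt (by simp)
    have hfq : MDifferentiableAt 𝓘(ℝ, E) 𝓘(ℝ, ℝ) (f ∘ ψ.symm) (ψ q) :=
      (((hloc.contDiffAt (hopen.mem_nhds (ψ.map_source hqs))).differentiableAt
        (by simp))).mdifferentiableAt
    have h1 : mfderiv I 𝓘(ℝ, ℝ) f q =
        (fderiv ℝ (f ∘ ψ.symm) (ψ q)).comp (mfderiv I 𝓘(ℝ, E) ψ q : E →L[ℝ] E) := by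
      have h2 : f =ᶠ[𝓝 q] (f ∘ ψ.symm) ∘ ψ := by
        filter_upwards [hq] with y hy
        rw [Function.comp_apply, Function.comp_apply, ψ.left_inv hy]
      rw [h2.mfderiv_eq, mfderiv_comp q hfq hψq, mfderiv_eq_fderiv]
      rfl
    have h3 : ∀ i, mfderiv I 𝓘(ℝ, ℝ) (fun q => b.coord i (ψ q)) q =
        (LinearMap.toContinuousLinearMap (b.coord i)).comp (mfderiv I 𝓘(ℝ, E) ψ q : E →L[ℝ] E) := by
      intro i
      have := mfderiv_comp q
        (LinearMap.toContinuousLinearMap (b.coord i)).mdifferentiableAt hψq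
      rw [ContinuousLinearMap.mfderiv_eq] at this
      exact this
    rw [h1]
    simp only [h3]
    exact clm_comp_eq_sum b _ _

end Manifold

/-! ### The dual bundle V* and the functions ι_X -/

section DualBundle

set_option linter.unusedSectionVars false
set_option synthInstance.maxHeartbeats 200000

variable {E : Type*} [NormedAddCommGroup E] [NormedSpace ℝ E] [FiniteDimensional ℝ E]
  {M : Type*} [TopologicalSpace M] [ChartedSpace E M] [IsManifold 𝓘(ℝ, E) ∞ M] [T2Space M]
  {F : Type*} [NormedAddCommGroup F] [NormedSpace ℝ F] [FiniteDimensional ℝ F]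
  {V : M → Type*} [∀ x, AddCommGroup (V x)] [∀ x, Module ℝ (V x)]
  [TopologicalSpace (TotalSpace F V)] [∀ x, TopologicalSpace (V x)] [FiberBundle F V]
  [VectorBundle ℝ F V]

variable (F V) in
/-- The trivialization of `V*` induced by the preferred trivialization of `V` at `x₀`. -/
abbrev dualTriv (x₀ : M) : Trivialization (F →L[ℝ] ℝ)
    (π (F →L[ℝ] ℝ) (fun x : M => V x →L[ℝ] Bundle.Trivial M ℝ x)) :=
  trivializationAt (F →L[ℝ] ℝ) (fun x : M => V x →L[ℝ] Bundle.Trivial M ℝ x) x₀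

theorem mem_baseSet_dualTriv {x₀ y : M} (hy : y ∈ (trivializationAt F V x₀).baseSet) :
    y ∈ (dualTriv F V x₀).baseSet :=
  ⟨hy, mem_univ _⟩

theorem dualTriv_apply {x₀ y : M} (hy : y ∈ (trivializationAt F V x₀).baseSet) (l : VDual V y)
    (u : F) : (dualTriv F V x₀ ⟨y, l⟩).2 u = l ((trivializationAt F V x₀).symm y u) := by
  have h : dualTriv F V x₀ ⟨y, l⟩ = _ := hom_trivializationAt_apply (RingHom.id ℝ) x₀ ⟨y, l⟩
  rw [h]
  simp [ContinuousLinearMap.inCoordinates, hy]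

theorem apply_eq_dualTriv {x₀ y : M} (hy : y ∈ (trivializationAt F V x₀).baseSet) (l : VDual V y)
    (v : V y) : l v = (dualTriv F V x₀ ⟨y, l⟩).2 (trivializationAt F V x₀ ⟨y, v⟩).2 := by
  rw [dualTriv_apply hy, Trivialization.symm_apply_apply_mk _ hy]

theorem dualTriv_symm_apply {x₀ y : M} (hy : y ∈ (trivializationAt F V x₀).baseSet)
    (β : F →L[ℝ] ℝ) (v : V y) :
    ((dualTriv F V x₀).symm y β : VDual V y) v = β (trivializationAt F V x₀ ⟨y, v⟩).2 := by
  rw [apply_eq_dualTriv hy, (dualTriv F V x₀).apply_mk_symm (mem_baseSet_dualTriv hy)]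

/-- The topology of the fibre is controlled only through the bundle, so separating functionals are
carried over from F by a trivialization. -/
theorem fibre_ext (F : Type*) [NormedAddCommGroup F] [NormedSpace ℝ F]
    [FiniteDimensional ℝ F] [TopologicalSpace (TotalSpace F V)] [FiberBundle F V]
    [VectorBundle ℝ F V] {x : M} {v w : V x} (h : ∀ l : VDual V x, l v = l w) : v = w := by
  have hx := mem_baseSet_trivializationAt F V x
  have h1 : (trivializationAt F V x ⟨x, v⟩).2 = (trivializationAt F V x ⟨x, w⟩).2 := by
    by_contra hne
    obtain ⟨β, hβ⟩ := SeparatingDual.exists_separating_of_ne (R := ℝ) hne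
    have h2 := h ((dualTriv F V x).symm x β)
    rw [dualTriv_symm_apply hx, dualTriv_symm_apply hx] at h2
    exact hβ h2
  rw [← Trivialization.symm_apply_apply_mk _ hx v, ← Trivialization.symm_apply_apply_mk _ hx w, h1]

/-- Finite-dimensional spaces are reflexive. -/
theorem exists_apply_eq {F : Type*} [NormedAddCommGroup F] [NormedSpace ℝ F]
    [FiniteDimensional ℝ F] (T : (F →L[ℝ] ℝ) →ₗ[ℝ] ℝ) : ∃ u : F, ∀ β : F →L[ℝ] ℝ, T β = β u := by
  let T' : Module.Dual ℝ (Module.Dual ℝ F) :=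
    T ∘ₗ (LinearMap.toContinuousLinearMap : (F →ₗ[ℝ] ℝ) ≃ₗ[ℝ] F →L[ℝ] ℝ).toLinearMap
  refine ⟨(Module.evalEquiv ℝ F).symm T', fun β => ?_⟩
  have h := Module.apply_evalEquiv_symm_apply ℝ F (β : F →ₗ[ℝ] ℝ) T'
  exact h.symm

/-- Linear functions on a fibre of `V*` are evaluations. -/
theorem exists_fibre_apply_eq (F : Type*) [NormedAddCommGroup F] [NormedSpace ℝ F]
    [FiniteDimensional ℝ F] [TopologicalSpace (TotalSpace F V)] [FiberBundle F V]
    [VectorBundle ℝ F V] {x : M} (T : VDual V x →ₗ[ℝ] ℝ) :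
    ∃ v : V x, ∀ l : VDual V x, T l = l v := by
  let c := (trivializationAt F V x).continuousLinearEquivAt ℝ x (mem_baseSet_trivializationAt F V x)
  let T' : (F →L[ℝ] ℝ) →ₗ[ℝ] ℝ :=
    { toFun := fun β => T (β.comp (c : V x →L[ℝ] F))
      map_add' := fun β β' => by rw [← map_add]; rfl
      map_smul' := fun r β => by rw [RingHom.id_apply, ← map_smul]; rfl }
  obtain ⟨u, hu⟩ := exists_apply_eq T'
  refine ⟨c.symm u, fun l => ?_⟩
  have h := hu ((l : V x →L[ℝ] ℝ).comp (c.symm : F →L[ℝ] V x))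
  rw [show l (c.symm u) = ((l : V x →L[ℝ] ℝ).comp (c.symm : F →L[ℝ] V x)) u from rfl, ← h]
  change T l = T _
  congr 1
  ext v
  change l v = l (c.symm (c v))
  rw [c.symm_apply_apply]

/-- Smooth cutoff functions on V* require the Hausdorff property. Points over the same base point
are separated in a trivialization, other points by their base points. -/
instance : T2Space (VDualTotal F V) := by
  refine ⟨fun p q hpq => ?_⟩
  by_cases h : p.1 = q.1
  · have hq : q ∈ (dualTriv F V q.1).source := by
      rw [Trivialization.mem_source]
      exact mem_baseSet_dualTriv (mem_baseSet_trivializationAt F V q.1)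
    have hp : p ∈ (dualTriv F V q.1).source := by
      rw [Trivialization.mem_source, h]
      exact mem_baseSet_dualTriv (mem_baseSet_trivializationAt F V q.1)
    have hne : dualTriv F V q.1 p ≠ dualTriv F V q.1 q := fun h2 =>
      hpq ((dualTriv F V q.1).injOn hp hq h2)
    obtain ⟨U, W, hU, hW, hpU, hqW, hUW⟩ := t2_separation hne
    refine ⟨_, _, (dualTriv F V q.1).toOpenPartialHomeomorph.isOpen_inter_preimage hU,
      (dualTriv F V q.1).toOpenPartialHomeomorph.isOpen_inter_preimage hW, ⟨hp, hpU⟩, ⟨hq, hqW⟩, ?_⟩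
    exact (hUW.preimage _).mono inter_subset_right inter_subset_right
  · obtain ⟨U, W, hU, hW, hpU, hqW, hUW⟩ := t2_separation h
    have hc : Continuous (π (F →L[ℝ] ℝ) (fun x : M => V x →L[ℝ] Bundle.Trivial M ℝ x)) :=
      FiberBundle.continuous_proj _ _
    exact ⟨_, _, hU.preimage hc, hW.preimage hc, hpU, hqW, hUW.preimage _⟩

/-- The function `ι_X` on `V*`. -/
def iota (X : Cₛ^∞⟮𝓘(ℝ, E); F, V⟯) : DualFun 𝓘(ℝ, E) F V where
  val p := p.2 (X p.1)
  property := by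
    have h1 : ContMDiff (𝓘(ℝ, E).prod 𝓘(ℝ, F →L[ℝ] ℝ)) (𝓘(ℝ, E).prod 𝓘(ℝ, F →L[ℝ] ℝ)) ∞
      (fun p : VDualTotal F V => TotalSpace.mk' (F →L[ℝ] ℝ)
        (E := fun x : M => V x →L[ℝ] Bundle.Trivial M ℝ x) p.1 p.2) := contMDiff_id
    have h2 : ContMDiff (𝓘(ℝ, E).prod 𝓘(ℝ, F →L[ℝ] ℝ)) (𝓘(ℝ, E).prod 𝓘(ℝ, F)) ∞
      (fun p : VDualTotal F V => TotalSpace.mk' F p.1 (X p.1)) :=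
      X.contMDiff.comp (contMDiff_proj _)
    have h3 := ContMDiff.clm_bundle_apply h1 h2
    intro p
    have h4 := h3 p
    rw [contMDiffAt_totalSpace] at h4
    exact h4.2

theorem iota_apply (X : Cₛ^∞⟮𝓘(ℝ, E); F, V⟯) (p : VDualTotal F V) : iota X p = p.2 (X p.1) := rfl

variable (F V) in
/-- The pullback to `V*` of a function on `M`. -/
def basic (f : C^∞⟮𝓘(ℝ, E), M; 𝓘(ℝ, ℝ), ℝ⟯) : DualFun 𝓘(ℝ, E) F V where
  val p := f p.1
  property := f.contMDiff.comp (contMDiff_proj _)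

theorem basic_apply (f : C^∞⟮𝓘(ℝ, E), M; 𝓘(ℝ, ℝ), ℝ⟯) (p : VDualTotal F V) :
    basic F V f p = f p.1 := rfl

/-- This identity ties basic functions to the functions ι_X: through it, a derivation known on all
ι_X is controlled on basic functions, and a Leibniz rule for brackets of sections becomes one for
functions. -/
theorem iota_smulSec (f : C^∞⟮𝓘(ℝ, E), M; 𝓘(ℝ, ℝ), ℝ⟯) (X : Cₛ^∞⟮𝓘(ℝ, E); F, V⟯) :
    iota (smulSec f X) = basic F V f * iota X := by
  ext p
  change p.2 (f p.1 • X p.1) = f p.1 * p.2 (X p.1)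
  rw [map_smul]
  rfl

/-- The functions `ι_X` depend linearly on `X`. -/
def iotaₗ : Cₛ^∞⟮𝓘(ℝ, E); F, V⟯ →ₗ[ℝ] DualFun 𝓘(ℝ, E) F V where
  toFun := iota
  map_add' X Y := by
    ext p
    exact map_add p.2 (X p.1) (Y p.1)
  map_smul' r X := by
    ext p
    exact map_smul p.2 r (X p.1)

theorem iota_add (X Y : Cₛ^∞⟮𝓘(ℝ, E); F, V⟯) : iota (X + Y) = iota X + iota Y := map_add iotaₗ X Y

theorem iota_sub (X Y : Cₛ^∞⟮𝓘(ℝ, E); F, V⟯) : iota (X - Y) = iota X - iota Y := map_sub iotaₗ X Y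

theorem iota_neg (X : Cₛ^∞⟮𝓘(ℝ, E); F, V⟯) : iota (-X) = -iota X := map_neg iotaₗ X

theorem iota_smul (r : ℝ) (X : Cₛ^∞⟮𝓘(ℝ, E); F, V⟯) : iota (r • X) = r • iota X :=
  map_smul iotaₗ r X

theorem iota_injective :
    Function.Injective (iota : Cₛ^∞⟮𝓘(ℝ, E); F, V⟯ → DualFun 𝓘(ℝ, E) F V) := fun _ _ h =>
  ContMDiffSection.ext fun x => fibre_ext F fun l =>
    congrArg (fun f => f (⟨x, l⟩ : VDualTotal F V)) h

theorem isLinearFun_iota (X : Cₛ^∞⟮𝓘(ℝ, E); F, V⟯) : IsLinearFun (iota X) :=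
  fun _ => ⟨fun _ _ => rfl, fun _ _ => rfl⟩

variable [ContMDiffVectorBundle ∞ F V 𝓘(ℝ, E)]

/-- Germs of smooth sections extend to the whole manifold. -/
theorem exists_section_eventuallyEq {x : M} {U : Set M} (hU : U ∈ 𝓝 x) {s : ∀ y, V y}
    (hs : ContMDiffOn 𝓘(ℝ, E) (𝓘(ℝ, E).prod 𝓘(ℝ, F)) ∞ (fun y => TotalSpace.mk' F y (s y)) U) :
    ∃ X : Cₛ^∞⟮𝓘(ℝ, E); F, V⟯, ∀ᶠ y in 𝓝 x, X y = s y := by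
  obtain ⟨χ, h1, hχ⟩ := exists_cutoff (I := 𝓘(ℝ, E)) (interior_mem_nhds.2 hU)
  refine ⟨⟨fun y => χ y • s y, ContMDiffOn.smul_section_of_tsupport χ.contMDiff.contMDiffOn
    isOpen_interior hχ (hs.mono interior_subset)⟩, ?_⟩
  filter_upwards [h1] with y hy
  change χ y • s y = s y
  rw [hy, one_smul]

theorem contMDiffOn_symm_const (x₀ : M) (u : F) :
    ContMDiffOn 𝓘(ℝ, E) (𝓘(ℝ, E).prod 𝓘(ℝ, F)) ∞
      (fun y => TotalSpace.mk' F y ((trivializationAt F V x₀).symm y u))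
      (trivializationAt F V x₀).baseSet := by
  rw [Trivialization.contMDiffOn_section_baseSet_iff]
  refine (contMDiffOn_const (c := u)).congr fun y hy => ?_
  rw [Trivialization.apply_mk_symm _ hy]

theorem contMDiffOn_dualTriv_symm_const (x₀ : M) (β : F →L[ℝ] ℝ) :
    ContMDiffOn 𝓘(ℝ, E) (𝓘(ℝ, E).prod 𝓘(ℝ, F →L[ℝ] ℝ)) ∞
      (fun y => TotalSpace.mk' (F →L[ℝ] ℝ)
        (E := fun x : M => V x →L[ℝ] Bundle.Trivial M ℝ x) y ((dualTriv F V x₀).symm y β))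
      (dualTriv F V x₀).baseSet := by
  rw [Trivialization.contMDiffOn_section_baseSet_iff]
  refine (contMDiffOn_const (c := β)).congr fun y hy => ?_
  rw [Trivialization.apply_mk_symm _ hy]

/-- Sections that are constant, with value `u`, near `x₀` in the preferred trivialization. -/
theorem exists_section_const (x₀ : M) (u : F) :
    ∃ X : Cₛ^∞⟮𝓘(ℝ, E); F, V⟯, ∀ᶠ y in 𝓝 x₀, X y = (trivializationAt F V x₀).symm y u :=
  exists_section_eventuallyEq ((trivializationAt F V x₀).open_baseSet.mem_nhds
    (mem_baseSet_trivializationAt F V x₀)) (contMDiffOn_symm_const x₀ u)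

theorem exists_section_apply_eq {x : M} (v : V x) : ∃ X : Cₛ^∞⟮𝓘(ℝ, E); F, V⟯, X x = v := by
  obtain ⟨X, hX⟩ := exists_section_const (E := E) (V := V) x (trivializationAt F V x ⟨x, v⟩).2
  refine ⟨X, ?_⟩
  rw [hX.self_of_nhds, Trivialization.symm_apply_apply_mk _ (mem_baseSet_trivializationAt F V x)]

/-- Smooth functions on `V*` that are linear on the fibres are of the form `ι_X`. -/
theorem IsLinearFun.exists_iota {f : DualFun 𝓘(ℝ, E) F V} (hf : IsLinearFun f) :
    ∃ X : Cₛ^∞⟮𝓘(ℝ, E); F, V⟯, f = iota X := by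
  choose v hv using fun x => exists_fibre_apply_eq F (hf x).mk'
  refine ⟨⟨v, fun x₀ => ?_⟩, ?_⟩
  · set e := trivializationAt F V x₀
    have hx₀ : x₀ ∈ e.baseSet := mem_baseSet_trivializationAt F V x₀
    rw [contMDiffAt_section]
    refine ContMDiffOn.contMDiffAt (s := e.baseSet) ?_ (e.open_baseSet.mem_nhds hx₀)
    let b := Module.finBasis ℝ F
    -- The components of v are the values of f along the local sections of V* that form the dual
    -- frame.
    have h1 : ∀ i, ContMDiffOn 𝓘(ℝ, E) 𝓘(ℝ, ℝ) ∞ (fun y => b.coord i (e ⟨y, v y⟩).2) e.baseSet := by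
      intro i
      have h2 := f.contMDiff.comp_contMDiffOn ((contMDiffOn_dualTriv_symm_const (V := V) x₀
        (LinearMap.toContinuousLinearMap (b.coord i))).mono fun y hy => mem_baseSet_dualTriv hy)
      refine h2.congr fun y hy => ?_
      have h3 := hv y ((dualTriv F V x₀).symm y (LinearMap.toContinuousLinearMap (b.coord i)))
      rw [dualTriv_symm_apply hy] at h3
      exact h3.symm
    have h2 : (fun y => (e ⟨y, v y⟩).2) = fun y => ∑ i, b.coord i (e ⟨y, v y⟩).2 • b i := by
      funext y
      exact (b.sum_repr _).symm
    rw [h2]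
    exact contMDiffOn_finsetSum fun i _ => (h1 i).smul contMDiffOn_const
  · ext ⟨x, l⟩
    exact hv x l

/-- Lines in the fibres of `V*` are smooth curves. -/
theorem contMDiff_fibre_line (x : M) (l m : VDual V x) :
    ContMDiff 𝓘(ℝ, ℝ) (𝓘(ℝ, E).prod 𝓘(ℝ, F →L[ℝ] ℝ)) ∞
      (fun t : ℝ => (⟨x, l + t • m⟩ : VDualTotal F V)) := by
  have hx := mem_baseSet_dualTriv (mem_baseSet_trivializationAt F V x)
  rw [(dualTriv F V x).contMDiff_iff fun t => by rw [Trivialization.mem_source]; exact hx]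
  refine ⟨contMDiff_const, ?_⟩
  have h : (fun t : ℝ => (dualTriv F V x ⟨x, l + t • m⟩).2) =
      fun t : ℝ => (dualTriv F V x ⟨x, l⟩).2 + t • (dualTriv F V x ⟨x, m⟩).2 := by
    funext t
    have hl := (dualTriv F V x).linear ℝ hx
    rw [hl.map_add, hl.map_smul]
  rw [h]
  exact contMDiff_const.add (contMDiff_id.smul contMDiff_const)

theorem exists_dual_ne_zero [Nontrivial F] (x : M) : ∃ l : VDual V x, l ≠ 0 := by
  have hx := mem_baseSet_trivializationAt F V x
  obtain ⟨u, hu⟩ := exists_ne (0 : F)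
  obtain ⟨β, hβ⟩ := SeparatingDual.exists_ne_zero (R := ℝ) hu
  refine ⟨(dualTriv F V x).symm x β, fun h => hβ ?_⟩
  have h2 := dualTriv_symm_apply hx β ((trivializationAt F V x).symm x u)
  rw [h, Trivialization.apply_mk_symm _ hx] at h2
  exact h2.symm

/-- Two functions on `V*` that agree off the zero section are equal. -/
theorem dualFun_ext [Nontrivial F] {f g : DualFun 𝓘(ℝ, E) F V}
    (h : ∀ x (l : VDual V x), l ≠ 0 → f ⟨x, l⟩ = g ⟨x, l⟩) : f = g := by
  ext ⟨x, l⟩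
  by_cases hl : l = 0
  -- Positive rank enters here: the zero covector is the limit of t m, for some m ≠ 0, as t tends to
  -- 0.
  · obtain ⟨m, hm⟩ := exists_dual_ne_zero (F := F) (V := V) x
    have hc := (contMDiff_fibre_line (E := E) (F := F) x 0 m).continuous
    have h1 : (fun t : ℝ => f ⟨x, 0 + t • m⟩) = fun t : ℝ => g ⟨x, 0 + t • m⟩ := by
      refine Continuous.ext_on (dense_compl_singleton (0 : ℝ)) (f.contMDiff.continuous.comp hc)
        (g.contMDiff.continuous.comp hc) fun t ht => h x _ ?_
      rw [zero_add]
      exact smul_ne_zero ht hm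
    have h2 := congrFun h1 0
    simp only [zero_smul, add_zero] at h2
    rw [hl]
    exact h2
  · exact h x l hl

theorem exists_section_apply_ne_zero {x : M} {l : VDual V x} (hl : l ≠ 0) :
    ∃ X : Cₛ^∞⟮𝓘(ℝ, E); F, V⟯, l (X x) ≠ 0 := by
  obtain ⟨v, hv⟩ : ∃ v, l v ≠ 0 := by
    by_contra hc
    push Not at hc
    exact hl (ContinuousLinearMap.ext hc)
  obtain ⟨X, hX⟩ := exists_section_apply_eq (E := E) (F := F) v
  exact ⟨X, hX ▸ hv⟩

/-- At each point off the zero section some ι_X is nonzero, so f vanishes there; `dualFun_ext` takes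
care of the zero section. -/
theorem eq_zero_of_mul_iota [Nontrivial F] {f : DualFun 𝓘(ℝ, E) F V}
    (h : ∀ X : Cₛ^∞⟮𝓘(ℝ, E); F, V⟯, f * iota X = 0) : f = 0 := by
  refine dualFun_ext fun x l hl => ?_
  obtain ⟨X, hX⟩ := exists_section_apply_ne_zero (E := E) (F := F) hl
  have h1 : f ⟨x, l⟩ * l (X x) = 0 := congrArg (fun f => f ⟨x, l⟩) (h X)
  exact (mul_eq_zero.1 h1).resolve_right hX

/-- The function `ι_X + h` on `V*`. -/
def gen : Cₛ^∞⟮𝓘(ℝ, E); F, V⟯ × C^∞⟮𝓘(ℝ, E), M; 𝓘(ℝ, ℝ), ℝ⟯ →ₗ[ℝ] DualFun 𝓘(ℝ, E) F V where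
  toFun c := iota c.1 + basic F V c.2
  map_add' c d := by
    rw [Prod.fst_add, iota_add, Prod.snd_add,
      show basic F V (c.2 + d.2) = basic F V c.2 + basic F V d.2 from rfl]
    abel
  map_smul' r c := by
    rw [Prod.smul_fst, iota_smul, Prod.smul_snd,
      show basic F V (r • c.2) = r • basic F V c.2 from rfl, RingHom.id_apply, smul_add]

theorem gen_apply (c : Cₛ^∞⟮𝓘(ℝ, E); F, V⟯ × C^∞⟮𝓘(ℝ, E), M; 𝓘(ℝ, ℝ), ℝ⟯) (p : VDualTotal F V) :
    gen c p = p.2 (c.1 p.1) + c.2 p.1 := rfl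

theorem gen_iota (X : Cₛ^∞⟮𝓘(ℝ, E); F, V⟯) : gen (X, 0) = iota X := by
  ext p
  rw [gen_apply, iota_apply]
  exact add_zero _

/-- Near `p`, linear functions of the coordinates of `V*` have the form `ι_X + h`. -/
theorem exists_gen_eventuallyEq (p : VDualTotal F V) (T : E × (F →L[ℝ] ℝ) →ₗ[ℝ] ℝ) :
    ∃ c : Cₛ^∞⟮𝓘(ℝ, E); F, V⟯ × C^∞⟮𝓘(ℝ, E), M; 𝓘(ℝ, ℝ), ℝ⟯,
      ∀ᶠ q in 𝓝 p, gen c q = T (extChartAt (𝓘(ℝ, E).prod 𝓘(ℝ, F →L[ℝ] ℝ)) p q) := by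
  -- The fibre part of T is a functional on the dual of F, hence evaluation at some u, which yields
  -- X. The base part of T yields h.
  obtain ⟨u, hu⟩ := exists_apply_eq (T ∘ₗ LinearMap.inr ℝ E (F →L[ℝ] ℝ))
  obtain ⟨X, hX⟩ := exists_section_const (E := E) (V := V) p.1 u
  have hsrc : (extChartAt 𝓘(ℝ, E) p.1).source ∈ 𝓝 p.1 := extChartAt_source_mem_nhds p.1
  have hc : ContMDiffOn 𝓘(ℝ, E) 𝓘(ℝ, ℝ) ∞ (fun y => T (extChartAt 𝓘(ℝ, E) p.1 y, 0))
      (extChartAt 𝓘(ℝ, E) p.1).source := by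
    refine (LinearMap.toContinuousLinearMap (T ∘ₗ LinearMap.inl ℝ E (F →L[ℝ] ℝ))).contMDiff
      |>.comp_contMDiffOn ?_
    rw [extChartAt_source]
    exact contMDiffOn_extChartAt
  obtain ⟨h, hh⟩ := exists_contMDiffMap_eventuallyEq hsrc hc
  refine ⟨(X, h), ?_⟩
  have hp : Filter.Tendsto (fun q : VDualTotal F V => q.1) (𝓝 p) (𝓝 p.1) :=
    (FiberBundle.continuous_proj (F →L[ℝ] ℝ)
      (fun x : M => V x →L[ℝ] Bundle.Trivial M ℝ x)).continuousAt
  filter_upwards [hp.eventually hX, hp.eventually hh, hp.eventually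
    ((trivializationAt F V p.1).open_baseSet.mem_nhds (mem_baseSet_trivializationAt F V p.1))]
    with q hXq hhq hq
  have h1 : extChartAt (𝓘(ℝ, E).prod 𝓘(ℝ, F →L[ℝ] ℝ)) p q =
      (extChartAt 𝓘(ℝ, E) p.1 q.1, (dualTriv F V p.1 q).2) := by
    rw [FiberBundle.extChartAt]
    rfl
  rw [gen_apply, h1, hXq, hhq, ← dualTriv_apply hq,
    show (extChartAt 𝓘(ℝ, E) p.1 q.1, (dualTriv F V p.1 q).2) =
      (extChartAt 𝓘(ℝ, E) p.1 q.1, 0) + (0, (dualTriv F V p.1 q).2) by simp, map_add, add_comm]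
  exact congrArg _ (hu _).symm

/-! ### Differentials and derivations on V* -/

/-- The differential of a function on `V*`. -/
def diff (f : DualFun 𝓘(ℝ, E) F V) (p : VDualTotal F V) : E × (F →L[ℝ] ℝ) →L[ℝ] ℝ :=
  mfderiv (𝓘(ℝ, E).prod 𝓘(ℝ, F →L[ℝ] ℝ)) 𝓘(ℝ, ℝ) f p

theorem mdifferentiableAt_dualFun (f : DualFun 𝓘(ℝ, E) F V) (p : VDualTotal F V) :
    MDifferentiableAt (𝓘(ℝ, E).prod 𝓘(ℝ, F →L[ℝ] ℝ)) 𝓘(ℝ, ℝ) f p :=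
  f.contMDiff.mdifferentiable (by simp) p

theorem diff_add (f g : DualFun 𝓘(ℝ, E) F V) (p : VDualTotal F V) :
    diff (f + g) p = diff f p + diff g p :=
  mfderiv_add (mdifferentiableAt_dualFun f p) (mdifferentiableAt_dualFun g p)

theorem diff_sub (f g : DualFun 𝓘(ℝ, E) F V) (p : VDualTotal F V) :
    diff (f - g) p = diff f p - diff g p :=
  ((mdifferentiableAt_dualFun f p).hasMFDerivAt.sub
    (mdifferentiableAt_dualFun g p).hasMFDerivAt).mfderiv

theorem diff_smul (r : ℝ) (f : DualFun 𝓘(ℝ, E) F V) (p : VDualTotal F V) :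
    diff (r • f) p = r • diff f p :=
  const_smul_mfderiv (mdifferentiableAt_dualFun f p) r

theorem diff_mul (f g : DualFun 𝓘(ℝ, E) F V) (p : VDualTotal F V) :
    diff (f * g) p = f p • diff g p + g p • diff f p :=
  ((mdifferentiableAt_dualFun f p).hasMFDerivAt.mul
    (mdifferentiableAt_dualFun g p).hasMFDerivAt).mfderiv

/-- The differential at a point, as a linear map. -/
def diffₗ (p : VDualTotal F V) : DualFun 𝓘(ℝ, E) F V →ₗ[ℝ] (E × (F →L[ℝ] ℝ) →L[ℝ] ℝ) where
  toFun f := diff f p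
  map_add' f g := diff_add f g p
  map_smul' r f := diff_smul r f p

/-- Near `p`, differentials of functions are combinations, with smooth coefficients, of
differentials of finitely many functions `ι_X + h`. -/
theorem exists_diff_eq_sum (p : VDualTotal F V) :
    ∃ (n : ℕ) (c : Fin n → Cₛ^∞⟮𝓘(ℝ, E); F, V⟯ × C^∞⟮𝓘(ℝ, E), M; 𝓘(ℝ, ℝ), ℝ⟯),
      ∀ f : DualFun 𝓘(ℝ, E) F V, ∃ k : Fin n → VDualTotal F V → ℝ,
        (∀ i, ContMDiffAt (𝓘(ℝ, E).prod 𝓘(ℝ, F →L[ℝ] ℝ)) 𝓘(ℝ, ℝ) ∞ (k i) p) ∧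
        ∀ᶠ q in 𝓝 p, diff f q = ∑ i, k i q • diff (gen (c i)) q := by
  let b := Module.finBasis ℝ (E × (F →L[ℝ] ℝ))
  choose c hc using fun i => exists_gen_eventuallyEq p (b.coord i)
  refine ⟨_, c, fun f => ?_⟩
  obtain ⟨k, hk, h⟩ := exists_mfderiv_eq_sum b p f
  refine ⟨k, hk, ?_⟩
  filter_upwards [h, eventually_eventually_nhds.2 (Filter.eventually_all.2 hc)] with q hq hcq
  refine hq.trans (Finset.sum_congr rfl fun i _ => ?_)
  congr 1
  exact (Filter.EventuallyEq.mfderiv_eq (hcq.mono fun y hy => hy i)).symm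

/-- At a fixed point the smooth coefficients of `exists_diff_eq_sum` become real numbers, and a real
combination of functions ι_X + h has the same form. -/
theorem exists_diff_gen_eq (f : DualFun 𝓘(ℝ, E) F V) (p : VDualTotal F V) :
    ∃ c : Cₛ^∞⟮𝓘(ℝ, E); F, V⟯ × C^∞⟮𝓘(ℝ, E), M; 𝓘(ℝ, ℝ), ℝ⟯, diff (gen c) p = diff f p := by
  obtain ⟨n, c, h⟩ := exists_diff_eq_sum (E := E) p
  obtain ⟨k, -, hk⟩ := h f
  refine ⟨∑ i, k i p • c i, ?_⟩
  rw [hk.self_of_nhds]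
  change (diffₗ p ∘ₗ gen) _ = _
  rw [map_sum]
  exact Finset.sum_congr rfl fun i _ => map_smul _ _ _

/-- Derivations of `C^∞(V*)`. -/
def IsDer (D : DualFun 𝓘(ℝ, E) F V →ₗ[ℝ] DualFun 𝓘(ℝ, E) F V) : Prop :=
  ∀ f g, D (f * g) = f * D g + D f * g

theorem IsDer.sub {D D' : DualFun 𝓘(ℝ, E) F V →ₗ[ℝ] DualFun 𝓘(ℝ, E) F V} (h : IsDer D)
    (h' : IsDer D') : IsDer (D - D') := fun f g => by
  rw [LinearMap.sub_apply, LinearMap.sub_apply, LinearMap.sub_apply, h, h']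
  ring

/-- A derivation of `C^∞(V*)` that vanishes on the functions `ι_X` vanishes. -/
theorem IsDer.eq_zero [Nontrivial F] {D : DualFun 𝓘(ℝ, E) F V →ₗ[ℝ] DualFun 𝓘(ℝ, E) F V}
    (hD : IsDer D) (h : ∀ X : Cₛ^∞⟮𝓘(ℝ, E); F, V⟯, D (iota X) = 0) : D = 0 := by
  -- By the Leibniz rule, D(ι_{fX}) = 0 and D(ι_X) = 0 leave D(f) ι_X = 0.
  have h1 : ∀ f, D (basic F V f) = 0 := fun f => eq_zero_of_mul_iota fun X => by
    have h2 := h (smulSec f X)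
    rwa [iota_smulSec, hD, h, mul_zero, zero_add] at h2
  have h2 : ∀ c, D (gen c) = 0 := fun c => by
    change D (iota c.1 + basic F V c.2) = 0
    rw [map_add, h, h1, add_zero]
  refine LinearMap.ext fun f => ContMDiffMap.ext fun p => ?_
  -- At p, f is replaced by a function ι_X + h with the same differential; the point derivation f ↦
  -- (D f)(p) does not see the difference.
  obtain ⟨c, hc⟩ := exists_diff_gen_eq f p
  let ev : DualFun 𝓘(ℝ, E) F V →ₗ[ℝ] ℝ :=
    { toFun := fun f => D f p
      map_add' := fun f g => by rw [map_add]; rfl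
      map_smul' := fun r f => by rw [map_smul]; rfl }
  have hev : ∀ f g, ev (f * g) = f p * ev g + g p * ev f := fun f g => by
    change D (f * g) p = f p * D g p + g p * D f p
    rw [hD, mul_comm (D f)]
    rfl
  have h3 : ev (f - gen c) = 0 := by
    refine pointDerivation_eq_zero (I := 𝓘(ℝ, E).prod 𝓘(ℝ, F →L[ℝ] ℝ)) hev ?_
    exact (diff_sub f (gen c) p).trans (sub_eq_zero.2 hc.symm)
  rw [map_sub] at h3
  change D f p - D (gen c) p = 0 at h3
  rw [h2] at h3
  exact (sub_eq_zero.1 h3).trans rfl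

theorem IsDer.ext [Nontrivial F] {D D' : DualFun 𝓘(ℝ, E) F V →ₗ[ℝ] DualFun 𝓘(ℝ, E) F V}
    (hD : IsDer D) (hD' : IsDer D')
    (h : ∀ X : Cₛ^∞⟮𝓘(ℝ, E); F, V⟯, D (iota X) = D' (iota X)) : D = D' :=
  sub_eq_zero.1 ((hD.sub hD').eq_zero fun X => by rw [LinearMap.sub_apply, h, sub_self])

end DualBundle

/-! ### Sections of A, sections of ρ, and the bijection for linear sections -/

section AffineSections

set_option linter.unusedSectionVars false
set_option synthInstance.maxHeartbeats 200000

variable {E : Type*} [NormedAddCommGroup E] [NormedSpace ℝ E] [FiniteDimensional ℝ E]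
  {M : Type*} [TopologicalSpace M] [ChartedSpace E M] [IsManifold 𝓘(ℝ, E) ∞ M] [T2Space M]
  {F : Type*} [NormedAddCommGroup F] [NormedSpace ℝ F] [FiniteDimensional ℝ F]
  {V : M → Type*} [∀ x, AddCommGroup (V x)] [∀ x, Module ℝ (V x)]
  [TopologicalSpace (TotalSpace F V)] [∀ x, TopologicalSpace (V x)] [FiberBundle F V]
  [VectorBundle ℝ F V] [ContMDiffVectorBundle ∞ F V 𝓘(ℝ, E)]
  {A : M → Type*} [∀ x, AddTorsor (V x) (A x)]
  [TopologicalSpace (TotalSpace F A)] [∀ x, TopologicalSpace (A x)] [FiberBundle F A]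
  [AffineBundle F V A] [SmoothAffineBundle F V A 𝓘(ℝ, E)]

variable (E F V A) in
/-- In coordinates, the difference of points of `A` is given by a smooth family of linear maps. -/
theorem exists_vsub_coord (x₀ : M) :
    ∃ h : M → F →L[ℝ] F,
      ContMDiffOn 𝓘(ℝ, E) 𝓘(ℝ, F →L[ℝ] F) ∞ h
        ((trivializationAt F A x₀).baseSet ∩ (trivializationAt F V x₀).baseSet) ∧
      ∀ x ∈ (trivializationAt F A x₀).baseSet ∩ (trivializationAt F V x₀).baseSet, ∀ a b : A x,
        (trivializationAt F V x₀ ⟨x, (a -ᵥ b : V x)⟩).2 =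
          h x ((trivializationAt F A x₀ ⟨x, a⟩).2 - (trivializationAt F A x₀ ⟨x, b⟩).2) := by
  obtain ⟨g, hg, hgv⟩ := SmoothAffineBundle.smooth_linear (I := 𝓘(ℝ, E))
    (trivializationAt F A x₀) (trivializationAt F V x₀)
  set eA := trivializationAt F A x₀
  set eV := trivializationAt F V x₀
  -- V x acts freely on A x and the trivializations are injective on fibres, so the linear part is
  -- injective. By finite dimension it is invertible, and inversion of operators is smooth.
  have hinj : ∀ x ∈ eA.baseSet ∩ eV.baseSet, Function.Injective (g x) := by
    intro x hx
    rw [injective_iff_map_eq_zero]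
    intro u hu
    obtain ⟨a⟩ : Nonempty (A x) := inferInstance
    have h1 := hgv x hx (eV.symm x u) a
    rw [eV.apply_mk_symm hx.2, hu, zero_add] at h1
    have h2 : eV.symm x u +ᵥ a = a := by
      rw [← eA.symm_apply_apply_mk hx.1 (eV.symm x u +ᵥ a), h1, eA.symm_apply_apply_mk hx.1]
    have h3 : eV.symm x u = 0 := vadd_right_cancel a (h2.trans (zero_vadd _ a).symm)
    have h4 := eV.apply_mk_symm hx.2 u
    rw [h3] at h4
    have h5 : (eV ⟨x, 0⟩).2 = 0 := (eV.linear ℝ hx.2).map_zero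
    rw [h4] at h5
    exact h5
  choose! L hL using fun (x : M) (hx : x ∈ eA.baseSet ∩ eV.baseSet) =>
    show ∃ L : F ≃L[ℝ] F, (L : F →L[ℝ] F) = g x from
      ⟨(LinearEquiv.ofInjectiveEndo (g x : F →ₗ[ℝ] F) (hinj x hx)).toContinuousLinearEquiv, by
        ext u; rfl⟩
  refine ⟨fun x => ContinuousLinearMap.inverse (g x), fun x hx => ?_, fun x hx a b => ?_⟩
  · have h1 : ContDiffAt ℝ ∞ (ContinuousLinearMap.inverse : (F →L[ℝ] F) → _) (g x) := by
      rw [← hL x hx]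
      exact contDiffAt_map_inverse (L x)
    exact h1.contMDiffAt.comp_contMDiffWithinAt x (hg x hx)
  · have h1 := hgv x hx (a -ᵥ b) b
    rw [vsub_vadd] at h1
    beta_reduce
    rw [h1, add_sub_cancel_right, ← hL x hx, ContinuousLinearMap.inverse_equiv]
    exact ((L x).symm_apply_apply _).symm

/-- Any two sections of `A` differ by a section of `V`. -/
theorem exists_vadd_section (a b : Cₛ^∞⟮𝓘(ℝ, E); F, A⟯) :
    ∃ X : Cₛ^∞⟮𝓘(ℝ, E); F, V⟯, a = X +ᵥ b := by
  refine ⟨⟨fun x => a x -ᵥ b x, fun x₀ => ?_⟩, ContMDiffSection.ext fun x => ?_⟩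
  · obtain ⟨h, hh, hv⟩ := exists_vsub_coord E F V A x₀
    have ha := a.contMDiff x₀
    have hb := b.contMDiff x₀
    rw [contMDiffAt_section] at ha hb ⊢
    have hU : (trivializationAt F A x₀).baseSet ∩ (trivializationAt F V x₀).baseSet ∈ 𝓝 x₀ :=
      ((trivializationAt F A x₀).open_baseSet.inter (trivializationAt F V x₀).open_baseSet).mem_nhds
        ⟨mem_baseSet_trivializationAt F A x₀, mem_baseSet_trivializationAt F V x₀⟩
    refine ((hh.contMDiffAt hU).clm_apply (ha.sub hb)).congr_of_eventuallyEq ?_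
    filter_upwards [hU] with x hx using hv x hx _ _
  · exact (vsub_vadd (a x) (b x)).symm

variable (E F A) in
/-- Affine bundles have global sections. -/
theorem nonempty_section [SecondCountableTopology M]
    (V : M → Type*) [∀ x, AddCommGroup (V x)] [∀ x, Module ℝ (V x)]
    [TopologicalSpace (TotalSpace F V)] [∀ x, TopologicalSpace (V x)] [FiberBundle F V]
    [∀ x, AddTorsor (V x) (A x)] [AffineBundle F V A] [SmoothAffineBundle F V A 𝓘(ℝ, E)] :
    Nonempty Cₛ^∞⟮𝓘(ℝ, E); F, A⟯ := by
  have : LocallyCompactSpace M := ChartedSpace.locallyCompactSpace E M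
  have : SigmaCompactSpace M := sigmaCompactSpace_of_locallyCompact_secondCountable
  obtain ⟨ρ, hρ⟩ := SmoothPartitionOfUnity.exists_isSubordinate 𝓘(ℝ, E) isClosed_univ
    (fun i : M => (trivializationAt F A i).baseSet)
    (fun i => (trivializationAt F A i).open_baseSet)
    fun x _ => mem_iUnion.2 ⟨x, mem_baseSet_trivializationAt F A x⟩
  have : ∀ x, Nonempty (A x) := fun x => AddTorsor.nonempty (G := V x)
  let a : ∀ i x : M, A x := fun i x => (trivializationAt F A i).symm x 0
  -- The barycentre of the local sections `a i` with the weights of a partition of unity. The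
  -- weights sum to 1, so the reference point `a x x`, which need not vary smoothly with x, cancels
  -- in coordinates.
  let s : ∀ x : M, A x := fun x => (∑ i ∈ ρ.finsupport x, ρ i x • (a i x -ᵥ a x x : V x)) +ᵥ a x x
  refine ⟨⟨s, fun x₀ => ?_⟩⟩
  rw [contMDiffAt_section]
  set e := trivializationAt F A x₀
  have hx₀ : x₀ ∈ e.baseSet := mem_baseSet_trivializationAt F A x₀
  have h1 : ContMDiffAt 𝓘(ℝ, E) 𝓘(ℝ, F) ∞ (fun x => ∑ᶠ i, ρ i x • (e ⟨x, a i x⟩).2) x₀ := by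
    refine ρ.contMDiffAt_finsum fun i hi => ?_
    exact (contMDiffOn_trans (V := V) e (trivializationAt F A i) 0).contMDiffAt
      ((e.open_baseSet.inter (trivializationAt F A i).open_baseSet).mem_nhds ⟨hx₀, hρ i hi⟩)
  refine h1.congr_of_eventuallyEq ?_
  filter_upwards [e.open_baseSet.mem_nhds hx₀] with x hx
  rw [← ρ.sum_finsupport_smul_eq_finsum x (fun i x => (e ⟨x, a i x⟩).2)]
  have h2 : ∀ b : A x, (e ⟨x, b⟩).2 = fibreMap (V := V) e hx b := fun _ => rfl
  rw [h2, (fibreMap (V := V) e hx).map_vadd, map_sum, vadd_eq_add]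
  simp_rw [map_smul, AffineMap.linearMap_vsub, vsub_eq_sub, smul_sub, Finset.sum_sub_distrib,
    ← Finset.sum_smul, ρ.sum_finsupport x (mem_univ x), one_smul, sub_add_cancel, h2]

theorem contMDiffAt_dualTriv_snd (p₀ : VDualTotal F V) :
    ContMDiffAt (𝓘(ℝ, E).prod 𝓘(ℝ, F →L[ℝ] ℝ)) 𝓘(ℝ, F →L[ℝ] ℝ) ∞
      (fun p : VDualTotal F V => (dualTriv F V p₀.1 p).2) p₀ :=
  (contMDiffAt_totalSpace.1 contMDiffAt_id).2

theorem affDual_triv_apply {x₀ y : M} (hy : y ∈ (trivializationAt F A x₀).baseSet)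
    (φ : AffDual F A y) :
    (trivializationAt ((F →L[ℝ] ℝ) × ℝ) (AffDual F A) x₀ ⟨y, φ⟩).2 =
      dualFibre (trivializationAt F A x₀) hy φ :=
  congrArg Prod.snd (dualPretriv_apply (trivializationAt F A x₀) hy φ)

theorem eventually_proj_mem {p₀ : VDualTotal F V} {U : Set M} (hU : U ∈ 𝓝 p₀.1) :
    ∀ᶠ p : VDualTotal F V in 𝓝 p₀, p.1 ∈ U :=
  (FiberBundle.continuous_proj (F →L[ℝ] ℝ)
    (fun x : M => V x →L[ℝ] Bundle.Trivial M ℝ x)).continuousAt.preimage_mem_nhds hU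

/-- The affine function with linear part `l` that vanishes at `a`. -/
def affFun {x : M} (a : A x) (l : VDual V x) : AffDual F A x :=
  ((l : V x →ₗ[ℝ] ℝ).toAffineMap.comp (AffineEquiv.vaddConst ℝ a).symm.toAffineMap : _)

theorem affFun_apply {x : M} (a : A x) (l : VDual V x) (b : A x) :
    (affFun a l : AffDual F A x) b = l (b -ᵥ a) := rfl

theorem affDual_ext {x : M} {φ ψ : AffDual F A x} (h : ∀ b : A x, φ b = ψ b) : φ = ψ :=
  AffineMap.ext (k := ℝ) (P1 := A x) (P2 := ℝ) h

theorem rho_apply_vsub {x : M} (φ : AffDual F A x) (b a : A x) :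
    rho φ (b -ᵥ a) = φ b - φ a :=
  AffineMap.linearMap_vsub (k := ℝ) (P1 := A x) (P2 := ℝ) φ b a

/-- The section of `ρ` that maps a linear function to the affine function with this linear part
that vanishes on `a`. -/
def vanishingSection (a : Cₛ^∞⟮𝓘(ℝ, E); F, A⟯) : RhoSection 𝓘(ℝ, E) F V A where
  toFun p := affFun (a p.1) p.2
  rho_toFun p := by
    ext v
    change (p.2 : V p.1 →ₗ[ℝ] ℝ) ((AffineEquiv.vaddConst ℝ (a p.1)).symm.linear v) = p.2 v
    simp
  smooth := by
    intro p₀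
    obtain ⟨h, hh, hv⟩ := exists_vsub_coord E F V A p₀.1
    rw [contMDiffAt_totalSpace]
    have hproj : ContMDiffAt (𝓘(ℝ, E).prod 𝓘(ℝ, F →L[ℝ] ℝ)) 𝓘(ℝ, E) ∞
        (fun p : VDualTotal F V => p.1) p₀ := contMDiff_proj _ p₀
    refine ⟨hproj, ?_⟩
    have hU : (trivializationAt F A p₀.1).baseSet ∩ (trivializationAt F V p₀.1).baseSet ∈
        𝓝 p₀.1 :=
      ((trivializationAt F A p₀.1).open_baseSet.inter
        (trivializationAt F V p₀.1).open_baseSet).mem_nhds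
        ⟨mem_baseSet_trivializationAt F A p₀.1, mem_baseSet_trivializationAt F V p₀.1⟩
    have ha := a.contMDiff p₀.1
    rw [contMDiffAt_section] at ha
    have hα := contMDiffAt_dualTriv_snd (E := E) p₀
    have hh' := (hh.contMDiffAt hU).comp p₀ hproj
    have ha' := ha.comp p₀ hproj
    -- In coordinates the affine function is u ↦ α(h(u - a)), so its linear part is α ∘ h and its
    -- constant term is -α(h a).
    refine ((hα.clm_comp hh').prodMk_space
      (hα.clm_apply (hh'.clm_apply ha')).neg).congr_of_eventuallyEq ?_
    filter_upwards [eventually_proj_mem hU] with p hp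
    refine (affDual_triv_apply hp.1 _).trans ?_
    have key : ∀ b : A p.1, (affFun (a p.1) p.2 : AffDual F A p.1) b =
        (dualTriv F V p₀.1 p).2 (h p.1 ((trivializationAt F A p₀.1 ⟨p.1, b⟩).2 -
          (trivializationAt F A p₀.1 ⟨p.1, a p.1⟩).2)) := fun b => by
      rw [affFun_apply, apply_eq_dualTriv hp.2, hv p.1 hp]
    refine Prod.ext (ContinuousLinearMap.ext fun u => ?_) ?_
    · rw [dualFibre_fst, key, key, Trivialization.apply_mk_symm _ hp.1,
        Trivialization.apply_mk_symm _ hp.1, map_sub, map_sub, map_sub, map_sub]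
      simp
    · rw [dualFibre_snd, key, Trivialization.apply_mk_symm _ hp.1, zero_sub, map_neg, map_neg]
      rfl

theorem vanishingSection_apply (a : Cₛ^∞⟮𝓘(ℝ, E); F, A⟯) (p : VDualTotal F V) (b : A p.1) :
    (vanishingSection a : RhoSection 𝓘(ℝ, E) F V A).toFun p b = p.2 (b -ᵥ a p.1) := rfl

theorem vadd_rhoSection_apply (f : DualFun 𝓘(ℝ, E) F V) (σ : RhoSection 𝓘(ℝ, E) F V A)
    (p : VDualTotal F V) (b : A p.1) : (f +ᵥ σ).toFun p b = σ.toFun p b + f p :=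
  congrArg (σ.toFun p b + ·) (mul_one (f p))

theorem rhoSection_ext {σ τ : RhoSection 𝓘(ℝ, E) F V A}
    (h : ∀ p (b : A p.1), σ.toFun p b = τ.toFun p b) : σ = τ :=
  RhoSection.ext (funext fun p => affDual_ext (h p))

/-- Moving the zero of an affine function by X lowers its values by λ(X). This is the source of the
signs in the correspondence of brackets. -/
theorem vanishingSection_vadd (X : Cₛ^∞⟮𝓘(ℝ, E); F, V⟯) (a : Cₛ^∞⟮𝓘(ℝ, E); F, A⟯) :
    (vanishingSection (X +ᵥ a) : RhoSection 𝓘(ℝ, E) F V A) = -iota X +ᵥ vanishingSection a := by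
  refine rhoSection_ext fun p b => ?_
  rw [vadd_rhoSection_apply, vanishingSection_apply, vanishingSection_apply]
  change p.2 (b -ᵥ (X p.1 +ᵥ a p.1)) = p.2 (b -ᵥ a p.1) + -p.2 (X p.1)
  rw [vsub_vadd_eq_vsub_sub, map_sub, sub_eq_add_neg]

theorem isLinear_vanishingSection (a : Cₛ^∞⟮𝓘(ℝ, E); F, A⟯) :
    (vanishingSection a : RhoSection 𝓘(ℝ, E) F V A).IsLinear := fun _ =>
  ⟨fun _ _ => affDual_ext fun _ => rfl, fun _ _ => affDual_ext fun _ => rfl⟩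

/-- Any two sections of `ρ` differ by a smooth function on `V*`. -/
theorem exists_vadd_rhoSection (σ τ : RhoSection 𝓘(ℝ, E) F V A) :
    ∃ f : DualFun 𝓘(ℝ, E) F V, σ = f +ᵥ τ := by
  -- The two affine functions have the same linear part, so their difference is constant on the
  -- fibre. It may be evaluated at the point with coordinate 0, where smoothness is visible in the
  -- trivialization of A†.
  have key : ∀ p (b b' : A p.1), σ.toFun p b - τ.toFun p b = σ.toFun p b' - τ.toFun p b' := by
    intro p b b'
    have h1 := rho_apply_vsub (σ.toFun p) b b'
    have h2 := rho_apply_vsub (τ.toFun p) b b'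
    rw [σ.rho_toFun] at h1
    rw [τ.rho_toFun] at h2
    have h3 : σ.toFun p b - σ.toFun p b' = τ.toFun p b - τ.toFun p b' := h1.symm.trans h2
    linarith
  have hsmooth : ContMDiff (𝓘(ℝ, E).prod 𝓘(ℝ, F →L[ℝ] ℝ)) 𝓘(ℝ, ℝ) ∞ fun p : VDualTotal F V =>
      σ.toFun p (Classical.arbitrary _) - τ.toFun p (Classical.arbitrary _) := fun p₀ => by
    have hσ := σ.smooth p₀
    have hτ := τ.smooth p₀
    rw [contMDiffAt_totalSpace] at hσ hτ
    have hsnd : ContMDiff 𝓘(ℝ, (F →L[ℝ] ℝ) × ℝ) 𝓘(ℝ, ℝ) ∞ (Prod.snd : (F →L[ℝ] ℝ) × ℝ → ℝ) :=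
      contDiff_snd.contMDiff
    refine (((hsnd _).comp p₀ hσ.2).sub ((hsnd _).comp p₀ hτ.2)).congr_of_eventuallyEq ?_
    filter_upwards [eventually_proj_mem ((trivializationAt F A p₀.1).open_baseSet.mem_nhds
      (mem_baseSet_trivializationAt F A p₀.1))] with p hp
    refine (key p _ ((trivializationAt F A p₀.1).symm p.1 0)).trans ?_
    rw [← dualFibre_snd _ hp, ← dualFibre_snd _ hp, ← affDual_triv_apply hp,
      ← affDual_triv_apply hp]
    rfl
  refine ⟨⟨_, hsmooth⟩, rhoSection_ext fun p b => ?_⟩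
  refine Eq.trans ?_ (vadd_rhoSection_apply ⟨_, hsmooth⟩ τ p b).symm
  refine Eq.trans ?_ (congrArg (τ.toFun p b + ·) (key p b _))
  ring

theorem vanishingSection_injective : Function.Injective
    (vanishingSection : Cₛ^∞⟮𝓘(ℝ, E); F, A⟯ → RhoSection 𝓘(ℝ, E) F V A) := by
  intro a b h
  refine ContMDiffSection.ext fun x => ?_
  rw [← vsub_eq_zero_iff_eq (G := V x)]
  refine fibre_ext F fun l => ?_
  have h1 : ∀ c : A x, l (c -ᵥ a x) = l (c -ᵥ b x) := fun c =>
    congrArg (fun σ : RhoSection 𝓘(ℝ, E) F V A => σ.toFun ⟨x, l⟩ c) h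
  have h2 := h1 (a x)
  rw [vsub_self] at h2
  exact h2.symm

/-- The difference between σ and the section vanishing on `a₀` is λ ↦ σ(λ)(a₀). It is linear when σ
is, hence some ι_X, and translating `a₀` by -X absorbs it. -/
theorem exists_eq_vanishingSection [SecondCountableTopology M] {σ : RhoSection 𝓘(ℝ, E) F V A}
    (hσ : σ.IsLinear) : ∃ a : Cₛ^∞⟮𝓘(ℝ, E); F, A⟯, vanishingSection a = σ := by
  obtain ⟨a₀⟩ := nonempty_section E F A V
  obtain ⟨f, rfl⟩ := exists_vadd_rhoSection σ (vanishingSection a₀)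
  have hf : ∀ x (l : VDual V x),
      (f +ᵥ vanishingSection a₀ : RhoSection 𝓘(ℝ, E) F V A).toFun ⟨x, l⟩ (a₀ x) = f ⟨x, l⟩ := by
    intro x l
    rw [vadd_rhoSection_apply, vanishingSection_apply, vsub_self, map_zero]
    exact zero_add _
  obtain ⟨X, rfl⟩ := IsLinearFun.exists_iota (f := f) fun x =>
    ⟨fun l m => by
      rw [← hf, ← hf, ← hf, (hσ x).map_add]
      rfl, fun r l => by
      rw [← hf, ← hf, (hσ x).map_smul]
      rfl⟩
  exact ⟨-X +ᵥ a₀, by rw [vanishingSection_vadd, iota_neg, neg_neg]⟩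

variable (E F V A) in
/-- Linear sections of `ρ` correspond to sections of `A`. -/
def linSecEquiv [SecondCountableTopology M] : LinSec 𝓘(ℝ, E) F V A ≃ Cₛ^∞⟮𝓘(ℝ, E); F, A⟯ :=
  (Equiv.ofBijective (fun a : Cₛ^∞⟮𝓘(ℝ, E); F, A⟯ =>
    (⟨vanishingSection a, isLinear_vanishingSection a⟩ : LinSec 𝓘(ℝ, E) F V A))
    ⟨fun _ _ h => vanishingSection_injective (congrArg Subtype.val h), fun σ => by
      obtain ⟨a, ha⟩ := exists_eq_vanishingSection σ.2
      exact ⟨a, Subtype.ext ha⟩⟩).symm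

theorem linSecEquiv_symm_apply [SecondCountableTopology M] (a : Cₛ^∞⟮𝓘(ℝ, E); F, A⟯) :
    ((linSecEquiv E F V A).symm a).1 = vanishingSection a := rfl

theorem vanishingSection_linSecEquiv [SecondCountableTopology M] (σ : LinSec 𝓘(ℝ, E) F V A) :
    vanishingSection (linSecEquiv E F V A σ) = σ.1 := by
  rw [← linSecEquiv_symm_apply, Equiv.symm_apply_apply]

/-- Subtracting from φ the function with the same linear part that vanishes at a point leaves the
constant value of φ at this point. -/
theorem linSecEquiv_spec [SecondCountableTopology M] (σ : LinSec 𝓘(ℝ, E) F V A) (x : M)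
    (φ : AffDual F A x) :
    φ (linSecEquiv E F V A σ x) • oneA F A x = φ - σ.1.toFun ⟨x, rho φ⟩ := by
  rw [← vanishingSection_linSecEquiv σ]
  refine affDual_ext fun b => ?_
  change φ (linSecEquiv E F V A σ x) * 1 = φ b - rho φ (b -ᵥ linSecEquiv E F V A σ x)
  rw [rho_apply_vsub]
  ring

end AffineSections

/-! ### Affine Lie brackets split at a base point -/

section SplitBrackets

set_option linter.unusedSectionVars false

variable {W S : Type*} [AddCommGroup W] [Module ℝ W] [AddAction W S]

/-- The bilinear part of a bi-affine bracket. -/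
def linBr (B : S → S → W) (s : S) (w w' : W) : W := vpart B (w +ᵥ s) w' - vpart B s w'

theorem vpart_vadd (B : S → S → W) (s : S) (w w' : W) :
    vpart B (w +ᵥ s) w' = vpart B s w' + linBr B s w w' := by
  rw [linBr]
  abel

namespace IsAffineLieBracket

variable {B : S → S → W}

theorem apply_self (hB : IsAffineLieBracket B) (s : S) : B s s = 0 := by
  have h : (2 : ℝ) • B s s = 0 := by
    rw [two_smul]
    exact add_eq_zero_iff_eq_neg.2 (hB.skew s s)
  exact (smul_eq_zero.1 h).resolve_left two_ne_zero

theorem exists_vpart_eq (hB : IsAffineLieBracket B) (s : S) :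
    ∃ L : W →ₗ[ℝ] W, ∀ w, vpart B s w = L w := by
  obtain ⟨L, hL⟩ := hB.affine_right s
  exact ⟨L, fun w => by rw [vpart, hL, add_sub_cancel_right]⟩

theorem apply_vadd (hB : IsAffineLieBracket B) (s t : S) (w : W) :
    B s (w +ᵥ t) = vpart B s w + B s t := by
  obtain ⟨L, hL⟩ := hB.affine_right s
  rw [vpart, hL, hL, add_sub_cancel_right]

/-- The linear part of `B s`, as a linear map. -/
def vpartₗ (hB : IsAffineLieBracket B) (s : S) : W →ₗ[ℝ] W where
  toFun := vpart B s
  map_add' w w' := by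
    obtain ⟨L, hL⟩ := hB.exists_vpart_eq s
    simp only [hL, map_add]
  map_smul' r w := by
    obtain ⟨L, hL⟩ := hB.exists_vpart_eq s
    simp only [hL, map_smul, RingHom.id_apply]

theorem vpartₗ_apply (hB : IsAffineLieBracket B) (s : S) (w : W) :
    hB.vpartₗ s w = vpart B s w := rfl

theorem vpart_add (hB : IsAffineLieBracket B) (s : S) (w w' : W) :
    vpart B s (w + w') = vpart B s w + vpart B s w' :=
  map_add (hB.vpartₗ s) w w'

theorem vpart_neg (hB : IsAffineLieBracket B) (s : S) (w : W) : vpart B s (-w) = -vpart B s w :=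
  map_neg (hB.vpartₗ s) w

theorem vpart_sub (hB : IsAffineLieBracket B) (s : S) (w w' : W) :
    vpart B s (w - w') = vpart B s w - vpart B s w' :=
  map_sub (hB.vpartₗ s) w w'

theorem vpart_smul (hB : IsAffineLieBracket B) (s : S) (r : ℝ) (w : W) :
    vpart B s (r • w) = r • vpart B s w :=
  map_smul (hB.vpartₗ s) r w

/-- Since [s, s] = 0, no constant term appears: the bracket is encoded by its linear part at s and
its bilinear part. `affBr` reverses this. -/
theorem apply_vadd_vadd (hB : IsAffineLieBracket B) (s : S) (w w' : W) :
    B (w +ᵥ s) (w' +ᵥ s) = vpart B s w' - vpart B s w + linBr B s w w' := by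
  rw [hB.apply_vadd, hB.skew (w +ᵥ s) s, hB.apply_vadd, hB.apply_self, linBr]
  abel

theorem linBr_skew (hB : IsAffineLieBracket B) (s : S) (w w' : W) :
    linBr B s w w' = -linBr B s w' w := by
  have h := hB.skew (w +ᵥ s) (w' +ᵥ s)
  rw [hB.apply_vadd_vadd, hB.apply_vadd_vadd] at h
  have h2 : linBr B s w w' = (vpart B s w' - vpart B s w + linBr B s w w') -
    (vpart B s w' - vpart B s w) := by abel
  rw [h2, h]
  abel

/-- The bilinear part of a bi-affine bracket, as a bilinear map. -/
def linBrₗ (hB : IsAffineLieBracket B) (s : S) : W →ₗ[ℝ] W →ₗ[ℝ] W :=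
  LinearMap.mk₂ ℝ (linBr B s)
    (fun w₁ w₂ w => by
      rw [hB.linBr_skew, hB.linBr_skew s w₁, hB.linBr_skew s w₂]
      simp only [linBr, hB.vpart_add]
      abel)
    (fun r w₁ w => by
      rw [hB.linBr_skew, hB.linBr_skew s w₁]
      simp only [linBr, hB.vpart_smul, ← smul_sub, smul_neg])
    (fun w w₁ w₂ => by
      simp only [linBr, hB.vpart_add]
      abel)
    (fun r w w₁ => by simp only [linBr, hB.vpart_smul, ← smul_sub])

theorem linBrₗ_apply (hB : IsAffineLieBracket B) (s : S) (w w' : W) :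
    hB.linBrₗ s w w' = linBr B s w w' := rfl

/-- The linear part of the bracket with `s` is a derivation of the bilinear part. -/
theorem vpart_linBr (hB : IsAffineLieBracket B) (s : S) (w w' : W) :
    vpart B s (linBr B s w w') = linBr B s (vpart B s w) w' + linBr B s w (vpart B s w') := by
  -- With the base point as third argument, the terms containing `vpart B s` twice cancel and the
  -- derivation property remains.
  have h := hB.jacobi (w +ᵥ s) (w' +ᵥ s) s
  rw [hB.apply_vadd_vadd, hB.skew (w' +ᵥ s) s, hB.apply_vadd, hB.apply_vadd, hB.apply_self,
    add_zero, add_zero, hB.vpart_neg, vpart_vadd, vpart_vadd, hB.vpart_add, hB.vpart_sub,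
    hB.linBr_skew s w' (vpart B s w)] at h
  rw [← sub_eq_zero, ← h]
  abel

/-- In the expanded Jacobi identity of three translates of s, the derivation property `vpart_linBr`
cancels all terms that contain `vpart B s`; the trilinear part is left. -/
theorem linBr_jacobi (hB : IsAffineLieBracket B) (s : S) (w₁ w₂ w₃ : W) :
    linBr B s w₁ (linBr B s w₂ w₃) + linBr B s w₂ (linBr B s w₃ w₁) +
      linBr B s w₃ (linBr B s w₁ w₂) = 0 := by
  have h := hB.jacobi (w₁ +ᵥ s) (w₂ +ᵥ s) (w₃ +ᵥ s)
  simp only [hB.apply_vadd_vadd, vpart_vadd, hB.vpart_add, hB.vpart_sub, hB.vpart_linBr] at h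
  rw [hB.linBr_skew s (vpart B s w₂) w₃, hB.linBr_skew s (vpart B s w₃) w₁,
    hB.linBr_skew s (vpart B s w₁) w₂] at h
  rw [← h]
  abel

end IsAffineLieBracket

/-- The affine Lie bracket with given linear and bilinear parts. -/
def affBr (κ : S → W) (D : W →ₗ[ℝ] W) (b : W →ₗ[ℝ] W →ₗ[ℝ] W) (s t : S) : W :=
  D (κ t) - D (κ s) + b (κ s) (κ t)

variable {κ : S → W} {D : W →ₗ[ℝ] W} {b : W →ₗ[ℝ] W →ₗ[ℝ] W}

theorem vpart_affBr (hκ : ∀ w s, κ (w +ᵥ s) = w + κ s) (s : S) (w : W) :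
    vpart (affBr κ D b) s w = D w + b (κ s) w := by
  simp only [vpart, affBr, hκ, map_add]
  abel

/-- Converse of the splitting, with κ the displacement from a base point. In the Jacobi sum the D²
terms cancel cyclically, the terms with one D cancel because D is a derivation of b, and the rest is
the Jacobi identity of b. -/
theorem isAffineLieBracket_affBr (hκ : ∀ w s, κ (w +ᵥ s) = w + κ s)
    (hskew : ∀ w w', b w w' = -b w' w) (hD : ∀ w w', D (b w w') = b (D w) w' + b w (D w'))
    (hjac : ∀ w₁ w₂ w₃, b w₁ (b w₂ w₃) + b w₂ (b w₃ w₁) + b w₃ (b w₁ w₂) = 0) :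
    IsAffineLieBracket (affBr κ D b) where
  affine_left t := ⟨b.flip (κ t) - D, fun w s => by
    simp only [affBr, hκ, map_add, LinearMap.sub_apply, LinearMap.flip_apply, LinearMap.add_apply]
    abel⟩
  affine_right s := ⟨b (κ s) + D, fun w t => by
    simp only [affBr, hκ, map_add, LinearMap.add_apply]
    abel⟩
  skew s t := by
    simp only [affBr]
    rw [hskew (κ s)]
    abel
  jacobi s t u := by
    simp only [vpart_affBr hκ]
    simp only [affBr, map_add, map_sub, hD]
    rw [hskew (D (κ s)) (κ t), hskew (D (κ t)) (κ u), hskew (D (κ u)) (κ s),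
      ← hjac (κ s) (κ t) (κ u)]
    abel

end SplitBrackets

/-! ### Extension of operators from the functions ι_X + h to C^∞(V*) -/

section Hat

set_option linter.unusedSectionVars false
set_option synthInstance.maxHeartbeats 200000

variable {E : Type*} [NormedAddCommGroup E] [NormedSpace ℝ E] [FiniteDimensional ℝ E]
  {M : Type*} [TopologicalSpace M] [ChartedSpace E M] [IsManifold 𝓘(ℝ, E) ∞ M] [T2Space M]
  {F : Type*} [NormedAddCommGroup F] [NormedSpace ℝ F] [FiniteDimensional ℝ F]
  {V : M → Type*} [∀ x, AddCommGroup (V x)] [∀ x, Module ℝ (V x)]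
  [TopologicalSpace (TotalSpace F V)] [∀ x, TopologicalSpace (V x)] [FiberBundle F V]
  [VectorBundle ℝ F V] [ContMDiffVectorBundle ∞ F V 𝓘(ℝ, E)]

variable (E F V) in
/-- Pairs `(X, h)`, which represent the functions `ι_X + h` on `V*`. -/
abbrev GenPair : Type _ := Cₛ^∞⟮𝓘(ℝ, E); F, V⟯ × C^∞⟮𝓘(ℝ, E), M; 𝓘(ℝ, ℝ), ℝ⟯

/-- A map on the functions `ι_X + h` whose value at each point only depends on the differential
there extends to a derivation of `C^∞(V*)`. -/
theorem exists_derivation (T : GenPair E F V →ₗ[ℝ] DualFun 𝓘(ℝ, E) F V)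
    (hT : ∀ p c, diff (gen c) p = 0 → T c p = 0) :
    ∃ δ : DualFun 𝓘(ℝ, E) F V →ₗ[ℝ] DualFun 𝓘(ℝ, E) F V, IsDer δ ∧
      ∀ f p c, diff (gen c) p = diff f p → δ f p = T c p := by
  -- The representative of f is chosen at each point separately. By `key` the value does not depend
  -- on it, but smoothness in p still has to be proved.
  choose c hc using fun (f : DualFun 𝓘(ℝ, E) F V) p => exists_diff_gen_eq f p
  have key : ∀ f p d, diff (gen d) p = diff f p → T (c f p) p = T d p := by
    intro f p d hd
    have h1 : T (c f p - d) p = 0 := hT p _ (by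
      rw [map_sub]
      exact (diff_sub _ _ p).trans (sub_eq_zero.2 ((hc f p).trans hd.symm)))
    rw [map_sub] at h1
    exact sub_eq_zero.1 h1
  have hsmooth : ∀ f, ContMDiff (𝓘(ℝ, E).prod 𝓘(ℝ, F →L[ℝ] ℝ)) 𝓘(ℝ, ℝ) ∞
      (fun p => T (c f p) p) := by
    intro f p
    -- Near p one finite family of generators with smooth coefficients represents f at every point,
    -- so the new function is locally a combination of the smooth functions `T (d i)`.
    obtain ⟨n, d, hd⟩ := exists_diff_eq_sum (E := E) p
    obtain ⟨k, hk, hkd⟩ := hd f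
    have h1 : ContMDiffAt (𝓘(ℝ, E).prod 𝓘(ℝ, F →L[ℝ] ℝ)) 𝓘(ℝ, ℝ) ∞
        (fun q => ∑ i, k i q * T (d i) q) p :=
      contMDiffAt_finsetSum fun i _ => (hk i).mul ((T (d i)).contMDiff p)
    refine h1.congr_of_eventuallyEq ?_
    filter_upwards [hkd] with q hq
    rw [key f q (∑ i, k i q • d i)]
    · rw [map_sum, ← ContMDiffMap.coeFnAddMonoidHom_apply, map_sum, Finset.sum_apply]
      refine Finset.sum_congr rfl fun i _ => ?_
      rw [map_smul]
      rfl
    · rw [hq]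
      change (diffₗ q ∘ₗ gen) _ = _
      rw [map_sum]
      exact Finset.sum_congr rfl fun i _ => map_smul _ _ _
  let δ : DualFun 𝓘(ℝ, E) F V →ₗ[ℝ] DualFun 𝓘(ℝ, E) F V :=
    { toFun := fun f => ⟨fun p => T (c f p) p, hsmooth f⟩
      map_add' := fun f g => ContMDiffMap.ext fun p => by
        refine (key (f + g) p (c f p + c g p) ?_).trans ?_
        · rw [map_add, diff_add, hc, hc, diff_add]
        · rw [map_add]
          rfl
      map_smul' := fun r f => ContMDiffMap.ext fun p => by
        refine (key (r • f) p (r • c f p) ?_).trans ?_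
        · rw [map_smul, diff_smul, hc, diff_smul]
        · rw [map_smul]
          rfl }
  refine ⟨δ, fun f g => ContMDiffMap.ext fun p => ?_, key⟩
  -- The product rule for differentials names the representative of f g at p.
  refine (key (f * g) p (f p • c g p + g p • c f p) ?_).trans ?_
  · rw [map_add, map_smul, map_smul, diff_add, diff_smul, diff_smul, hc, hc, diff_mul]
  · rw [map_add, map_smul, map_smul, mul_comm (δ f)]
    rfl

/-- The chain rule, in the form that exploits a vanishing differential along fibre lines and along
local sections of V*. -/
theorem mfderiv_comp_gen_eq_zero {E' H' N : Type*} [NormedAddCommGroup E'] [NormedSpace ℝ E']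
    [TopologicalSpace H'] {I' : ModelWithCorners ℝ E' H'} [TopologicalSpace N] [ChartedSpace H' N]
    {c : GenPair E F V} {γ : N → VDualTotal F V} {y : N} (h : diff (gen c) (γ y) = 0)
    (hγ : ContMDiffAt I' (𝓘(ℝ, E).prod 𝓘(ℝ, F →L[ℝ] ℝ)) ∞ γ y) :
    mfderiv I' 𝓘(ℝ, ℝ) (gen c ∘ γ) y = 0 := by
  rw [mfderiv_comp y (mdifferentiableAt_dualFun _ _) (hγ.mdifferentiableAt (by simp))]
  refine ContinuousLinearMap.ext fun v => ?_
  exact congrArg (fun T : E × (F →L[ℝ] ℝ) →L[ℝ] ℝ => T _) h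

/-- If the differential of `ι_X + h` vanishes at `λ`, then `X` vanishes at the base point of `λ`. -/
theorem apply_eq_zero_of_diff_gen {c : GenPair E F V} {p : VDualTotal F V}
    (h : diff (gen c) p = 0) : c.1 p.1 = 0 := by
  obtain ⟨x, l⟩ := p
  refine fibre_ext F fun m => ?_
  rw [map_zero]
  -- Along this line ι_X + h is an affine function of t with slope m(X x).
  let γ : ℝ → VDualTotal F V := fun t => ⟨x, l + t • m⟩
  have hγ0 : γ 0 = ⟨x, l⟩ := by simp [γ]
  have h1 := mfderiv_comp_gen_eq_zero (I' := 𝓘(ℝ, ℝ)) (γ := γ) (y := 0) (by rwa [hγ0])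
    (contMDiff_fibre_line (E := E) (F := F) x l m 0)
  rw [mfderiv_eq_fderiv] at h1
  have h2 : HasDerivAt (gen c ∘ γ) (m (c.1 x)) 0 := by
    have h3 : gen c ∘ γ = fun t : ℝ => (l (c.1 x) + t * m (c.1 x) : ℝ) + c.2 x := rfl
    rw [h3]
    simpa using (((hasDerivAt_id (0 : ℝ)).mul_const (m (c.1 x) : ℝ)).const_add
      (l (c.1 x) : ℝ)).add_const (c.2 x)
  have h4 := h2.hasFDerivAt.fderiv
  have h5 : fderiv ℝ (gen c ∘ γ) 0 1 = 0 := congrArg (fun T : ℝ →L[ℝ] ℝ => T 1) h1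
  rw [h4] at h5
  exact (one_mul (m (c.1 x) : ℝ)).symm.trans h5

/-- The derivative at `x` in the direction `v`. -/
def dirDerivₗ (x : M) (v : TangentSpace 𝓘(ℝ, E) x) : C^∞⟮𝓘(ℝ, E), M; 𝓘(ℝ, ℝ), ℝ⟯ →ₗ[ℝ] ℝ where
  toFun f := dirDeriv f x v
  map_add' f g := congrArg (fun T : E →L[ℝ] ℝ => T v)
    (mfderiv_add (f.contMDiff.mdifferentiable (by simp) x)
      (g.contMDiff.mdifferentiable (by simp) x))
  map_smul' r f := congrArg (fun T : E →L[ℝ] ℝ => T v)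
    (const_smul_mfderiv (f.contMDiff.mdifferentiable (by simp) x) r)

theorem dirDerivₗ_apply (x : M) (v : TangentSpace 𝓘(ℝ, E) x)
    (f : C^∞⟮𝓘(ℝ, E), M; 𝓘(ℝ, ℝ), ℝ⟯) : dirDerivₗ x v f = dirDeriv f x v := rfl

/-- Near a point, sections are combinations of frame sections with smooth coefficients. -/
theorem exists_section_decomp (X : Cₛ^∞⟮𝓘(ℝ, E); F, V⟯) (x : M) {ι : Type*} [Fintype ι]
    (b : Module.Basis ι ℝ F) :
    ∃ (f : ι → C^∞⟮𝓘(ℝ, E), M; 𝓘(ℝ, ℝ), ℝ⟯) (s : ι → Cₛ^∞⟮𝓘(ℝ, E); F, V⟯),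
      (∀ i, ∀ᶠ y in 𝓝 x, f i y = b.coord i (trivializationAt F V x ⟨y, X y⟩).2) ∧
      (∀ i, ∀ᶠ y in 𝓝 x, s i y = (trivializationAt F V x).symm y (b i)) ∧
      ∀ᶠ y in 𝓝 x, X y = (∑ i, smulSec (f i) (s i)) y := by
  have hU := (trivializationAt F V x).open_baseSet.mem_nhds (mem_baseSet_trivializationAt F V x)
  have h1 : ContMDiffOn 𝓘(ℝ, E) 𝓘(ℝ, F) ∞ (fun y => (trivializationAt F V x ⟨y, X y⟩).2)
      (trivializationAt F V x).baseSet := by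
    rw [← Trivialization.contMDiffOn_section_baseSet_iff]
    exact X.contMDiff.contMDiffOn
  choose f hf using fun i => exists_contMDiffMap_eventuallyEq (I := 𝓘(ℝ, E)) hU
    ((LinearMap.toContinuousLinearMap (b.coord i)).contMDiff.comp_contMDiffOn h1)
  choose s hs using fun i => exists_section_const (E := E) (V := V) x (b i)
  refine ⟨f, s, hf, hs, ?_⟩
  filter_upwards [Filter.eventually_all.2 hf, Filter.eventually_all.2 hs, hU] with y hfy hsy hy
  have h2 : (∑ i, smulSec (f i) (s i)) y = ∑ i, f i y • s i y := by
    rw [← ContMDiffSection.coeAddHom_apply, map_sum, Finset.sum_apply]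
    rfl
  rw [h2]
  conv_lhs => rw [← Trivialization.symm_apply_apply_mk (trivializationAt F V x) hy (X y),
    ← b.sum_repr (trivializationAt F V x ⟨y, X y⟩).2]
  rw [← Trivialization.symmL_apply (R := ℝ) _ hy, map_sum]
  refine Finset.sum_congr rfl fun i _ => ?_
  rw [map_smul, Trivialization.symmL_apply _ hy, hfy, hsy]
  rfl

/-- Derivative operators on sections are local. -/
theorem derivative_congr {x : M} {z : TangentSpace 𝓘(ℝ, E) x}
    {D : Cₛ^∞⟮𝓘(ℝ, E); F, V⟯ →ₗ[ℝ] V x}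
    (hD : ∀ f X, D (smulSec f X) = f x • D X + dirDeriv f x z • X x)
    {X Y : Cₛ^∞⟮𝓘(ℝ, E); F, V⟯} (h : ∀ᶠ y in 𝓝 x, X y = Y y) : D X = D Y := by
  obtain ⟨χ, h1, hχ⟩ := exists_cutoff (I := 𝓘(ℝ, E)) h
  have h2 : X - Y = smulSec (1 - χ) (X - Y) := by
    refine ContMDiffSection.ext fun y => ?_
    change X y - Y y = (1 - χ y) • (X y - Y y)
    by_cases hy : y ∈ tsupport χ
    · rw [hχ hy, sub_self, smul_zero]
    · rw [image_eq_zero_of_notMem_tsupport hy, sub_zero, one_smul]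
  have h3 := hD (1 - χ) (X - Y)
  have h4 : (1 - χ) x = 0 := by
    change 1 - χ x = 0
    rw [h1.self_of_nhds, sub_self]
  have h5 : (X - Y) x = 0 := sub_eq_zero.2 h.self_of_nhds
  rw [← h2, h4, h5, zero_smul, smul_zero, add_zero, map_sub] at h3
  exact sub_eq_zero.1 h3

/-- A derivative operator with symbol `z`, together with the derivative in the direction `z`, is
well-defined on differentials of functions `ι_X + h`. -/
theorem derivative_add_dirDeriv_eq_zero {p : VDualTotal F V} {z : TangentSpace 𝓘(ℝ, E) p.1}
    {D : Cₛ^∞⟮𝓘(ℝ, E); F, V⟯ →ₗ[ℝ] V p.1}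
    (hD : ∀ f X, D (smulSec f X) = f p.1 • D X + dirDeriv f p.1 z • X p.1)
    {c : GenPair E F V} (h : diff (gen c) p = 0) : p.2 (D c.1) + dirDeriv c.2 p.1 z = 0 := by
  obtain ⟨x, l⟩ := p
  have hX : c.1 x = 0 := apply_eq_zero_of_diff_gen h
  have hx := mem_baseSet_trivializationAt F V x
  let b := Module.finBasis ℝ F
  obtain ⟨f, s, hf, hs, hX'⟩ := exists_section_decomp c.1 x b
  have hf0 : ∀ i, f i x = 0 := fun i => by
    have h0 : (trivializationAt F V x ⟨x, 0⟩).2 = 0 :=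
      ((trivializationAt F V x).linear ℝ hx).map_zero
    rw [(hf i).self_of_nhds, hX, h0, map_zero]
  set β := (dualTriv F V x ⟨x, l⟩).2 with hβ
  have hs0 : ∀ i, l (s i x) = β (b i) := fun i => by
    rw [(hs i).self_of_nhds, hβ, dualTriv_apply hx]
  -- The coefficients of X in the local frame vanish at x, so only the symbol terms of D survive.
  have h1 : l (D c.1) = ∑ i, β (b i) * dirDeriv (f i) x z := by
    rw [derivative_congr hD hX', map_sum, map_sum]
    refine Finset.sum_congr rfl fun i _ => ?_
    rw [hD]
    simp only
    rw [hf0, zero_smul, zero_add, map_smul, hs0, mul_comm]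
    rfl
  -- Along the local section of V* with constant coordinates β, the function ι_X + h pulls back to Σ
  -- β_i f_i + h near x. Its derivative in the direction z is the sum to be shown zero.
  let γ : M → VDualTotal F V := fun y => ⟨y, (dualTriv F V x).symm y β⟩
  have hγx : γ x = ⟨x, l⟩ := by
    refine congrArg (TotalSpace.mk x) ?_
    exact (dualTriv F V x).symm_apply_apply_mk (mem_baseSet_dualTriv hx) l
  have h2 := mfderiv_comp_gen_eq_zero (I' := 𝓘(ℝ, E)) (γ := γ) (y := x) (by rwa [hγx])
    ((contMDiffOn_dualTriv_symm_const x β).contMDiffAt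
      ((dualTriv F V x).open_baseSet.mem_nhds (mem_baseSet_dualTriv hx)))
  let k : C^∞⟮𝓘(ℝ, E), M; 𝓘(ℝ, ℝ), ℝ⟯ := ∑ i, β (b i) • f i + c.2
  have h3 : gen c ∘ γ =ᶠ[𝓝 x] k := by
    filter_upwards [Filter.eventually_all.2 hf,
      (trivializationAt F V x).open_baseSet.mem_nhds hx] with y hfy hy
    have h4 : k y = ∑ i, β (b i) * f i y + c.2 y := by
      change (∑ i, β (b i) • f i) y + c.2 y = _
      rw [← ContMDiffMap.coeFnAddMonoidHom_apply, map_sum, Finset.sum_apply]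
      rfl
    rw [h4, Function.comp_apply, gen_apply, dualTriv_symm_apply hy]
    conv_lhs => rw [← b.sum_repr (trivializationAt F V x ⟨y, c.1 y⟩).2]
    rw [map_sum]
    congr 1
    refine Finset.sum_congr rfl fun i _ => ?_
    rw [map_smul, hfy, smul_eq_mul, mul_comm]
    rfl
  rw [h3.mfderiv_eq] at h2
  have h5 : dirDerivₗ x z k = 0 := congrArg (fun T : E →L[ℝ] ℝ => T z) h2
  rw [map_add, map_sum] at h5
  change l (D c.1) + dirDeriv c.2 x z = 0
  rw [h1]
  refine Eq.trans ?_ h5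
  congr 1
  exact Finset.sum_congr rfl fun i _ => (map_smul (dirDerivₗ x z) (β (b i)) (f i)).symm

/-- Derivatives along smooth vector fields are smooth. -/
theorem contMDiff_dirDeriv {v : ∀ x : M, TangentSpace 𝓘(ℝ, E) x}
    (hv : ContMDiff 𝓘(ℝ, E) 𝓘(ℝ, E).tangent ∞ (fun x => (⟨x, v x⟩ : TangentBundle 𝓘(ℝ, E) M)))
    (f : C^∞⟮𝓘(ℝ, E), M; 𝓘(ℝ, ℝ), ℝ⟯) :
    ContMDiff 𝓘(ℝ, E) 𝓘(ℝ, ℝ) ∞ (fun x => dirDeriv f x (v x)) := by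
  have h := (f.contMDiff.contMDiff_tangentMap (m := ∞) (by simp)).comp hv
  intro x
  have h2 := h x
  rw [contMDiffAt_totalSpace] at h2
  refine h2.2.congr_of_eventuallyEq (Filter.Eventually.of_forall fun y => ?_)
  simp [tangentMap, dirDeriv]
  rfl

end Hat

/-! ### Derivations and biderivations of C^∞(V*) -/

section Poisson

set_option linter.unusedSectionVars false
set_option synthInstance.maxHeartbeats 200000

variable {E : Type*} [NormedAddCommGroup E] [NormedSpace ℝ E] [FiniteDimensional ℝ E]
  {M : Type*} [TopologicalSpace M] [ChartedSpace E M] [IsManifold 𝓘(ℝ, E) ∞ M] [T2Space M]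
  {F : Type*} [NormedAddCommGroup F] [NormedSpace ℝ F] [FiniteDimensional ℝ F]
  {V : M → Type*} [∀ x, AddCommGroup (V x)] [∀ x, Module ℝ (V x)]
  [TopologicalSpace (TotalSpace F V)] [∀ x, TopologicalSpace (V x)] [FiberBundle F V]
  [VectorBundle ℝ F V] [ContMDiffVectorBundle ∞ F V 𝓘(ℝ, E)]

theorem IsDer.add {D D' : DualFun 𝓘(ℝ, E) F V →ₗ[ℝ] DualFun 𝓘(ℝ, E) F V} (h : IsDer D)
    (h' : IsDer D') : IsDer (D + D') := fun f g => by
  rw [LinearMap.add_apply, LinearMap.add_apply, LinearMap.add_apply, h, h']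
  ring

theorem IsDer.neg {D : DualFun 𝓘(ℝ, E) F V →ₗ[ℝ] DualFun 𝓘(ℝ, E) F V} (h : IsDer D) :
    IsDer (-D) := fun f g => by
  rw [LinearMap.neg_apply, LinearMap.neg_apply, LinearMap.neg_apply, h]
  ring

theorem IsDer.commutator {D D' : DualFun 𝓘(ℝ, E) F V →ₗ[ℝ] DualFun 𝓘(ℝ, E) F V} (h : IsDer D)
    (h' : IsDer D') : IsDer (D ∘ₗ D' - D' ∘ₗ D) := fun f g => by
  simp only [LinearMap.sub_apply, LinearMap.comp_apply, h f g, h' f g, map_add, h _ _, h' _ _]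
  ring

/-- The evaluation of sections at a point. -/
def evalSec (x : M) : Cₛ^∞⟮𝓘(ℝ, E); F, V⟯ →ₗ[ℝ] V x where
  toFun X := X x
  map_add' _ _ := rfl
  map_smul' _ _ := rfl

/-- A derivative operator on the sections of `V` whose symbol is a vector field defines a derivation
of `C^∞(V*)`. -/
theorem exists_isDer_of_derivative (D : Cₛ^∞⟮𝓘(ℝ, E); F, V⟯ →ₗ[ℝ] Cₛ^∞⟮𝓘(ℝ, E); F, V⟯)
    {v : ∀ x : M, TangentSpace 𝓘(ℝ, E) x}
    (hv : ContMDiff 𝓘(ℝ, E) 𝓘(ℝ, E).tangent ∞ (fun x => (⟨x, v x⟩ : TangentBundle 𝓘(ℝ, E) M)))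
    (hD : ∀ f X x, D (smulSec f X) x = f x • D X x + dirDeriv f x (v x) • X x) :
    ∃ δ : DualFun 𝓘(ℝ, E) F V →ₗ[ℝ] DualFun 𝓘(ℝ, E) F V, IsDer δ ∧
      ∀ X, δ (iota X) = iota (D X) := by
  -- The Leibniz rule on ι_{fX} forces basic functions to be differentiated along the symbol, so ι_X
  -- + h must go to ι_{DX} + v(h).
  let Z : C^∞⟮𝓘(ℝ, E), M; 𝓘(ℝ, ℝ), ℝ⟯ →ₗ[ℝ] C^∞⟮𝓘(ℝ, E), M; 𝓘(ℝ, ℝ), ℝ⟯ :=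
    { toFun := fun f => ⟨_, contMDiff_dirDeriv hv f⟩
      map_add' := fun f g => ContMDiffMap.ext fun x => map_add (dirDerivₗ x (v x)) f g
      map_smul' := fun r f => ContMDiffMap.ext fun x => map_smul (dirDerivₗ x (v x)) r f }
  obtain ⟨δ, hδ, h⟩ := exists_derivation (gen ∘ₗ D.prodMap Z) fun p c hc =>
    derivative_add_dirDeriv_eq_zero (D := evalSec p.1 ∘ₗ D) (fun f X => hD f X p.1) hc
  refine ⟨δ, hδ, fun X => ContMDiffMap.ext fun p => ?_⟩
  rw [h (iota X) p (X, 0) (by rw [gen_iota]), LinearMap.comp_apply, LinearMap.prodMap_apply,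
    map_zero, gen_iota]

/-- A bracket on the sections of `V` with an anchor defines a skew-symmetric biderivation
of `C^∞(V*)`. -/
theorem exists_biderivation
    (br : Cₛ^∞⟮𝓘(ℝ, E); F, V⟯ →ₗ[ℝ] Cₛ^∞⟮𝓘(ℝ, E); F, V⟯ →ₗ[ℝ] Cₛ^∞⟮𝓘(ℝ, E); F, V⟯)
    (act : Cₛ^∞⟮𝓘(ℝ, E); F, V⟯ →ₗ[ℝ] C^∞⟮𝓘(ℝ, E), M; 𝓘(ℝ, ℝ), ℝ⟯ →ₗ[ℝ]
      C^∞⟮𝓘(ℝ, E), M; 𝓘(ℝ, ℝ), ℝ⟯)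
    (γ : ∀ x : M, V x →ₗ[ℝ] TangentSpace 𝓘(ℝ, E) x)
    (hact : ∀ X f x, act X f x = dirDeriv f x (γ x (X x)))
    (hskew : ∀ X Y, br X Y = -br Y X)
    (hbr : ∀ X f Y x, br X (smulSec f Y) x = f x • br X Y x + act X f x • Y x) :
    ∃ pb : DualFun 𝓘(ℝ, E) F V →ₗ[ℝ] DualFun 𝓘(ℝ, E) F V →ₗ[ℝ] DualFun 𝓘(ℝ, E) F V,
      (∀ f, IsDer (pb f)) ∧ (∀ f g, pb f g = -pb g f) ∧
      ∀ X Y, pb (iota X) (iota Y) = iota (br X Y) := by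
  -- The rules of a linear Poisson structure: {ι_X, ι_Y} = ι_{[X, Y]}, {ι_X, h} is the anchor of X
  -- applied to h, and basic functions commute.
  let cbr : GenPair E F V →ₗ[ℝ] GenPair E F V →ₗ[ℝ] GenPair E F V :=
    LinearMap.mk₂ ℝ (fun c d => (br c.1 d.1, act c.1 d.2 - act d.1 c.2))
      (fun c c' d => Prod.ext (by simp) (by simp; abel))
      (fun r c d => Prod.ext (by simp) (by simp [smul_sub]))
      (fun c d d' => Prod.ext (by simp) (by simp; abel))
      (fun r c d => Prod.ext (by simp) (by simp [smul_sub]))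
  have cbr_apply : ∀ c d, cbr c d = (br c.1 d.1, act c.1 d.2 - act d.1 c.2) := fun _ _ => rfl
  have cbr_skew : ∀ c d, cbr c d = -cbr d c := fun c d => by
    rw [cbr_apply, cbr_apply, hskew c.1]
    exact Prod.ext rfl (neg_sub _ _).symm
  -- A vanishing differential makes the section in c vanish at the base point, which kills one
  -- anchor term. The other two terms cancel by `derivative_add_dirDeriv_eq_zero` for the operator
  -- [Y, ·], Y being the section in d.
  have hwd : ∀ p c d, diff (gen c) p = 0 → gen (cbr c d) p = 0 := by
    intro p c d hc
    have h1 := derivative_add_dirDeriv_eq_zero (D := evalSec p.1 ∘ₗ br d.1)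
      (z := γ p.1 (d.1 p.1)) (fun f X => by
        rw [← hact]
        exact hbr d.1 f X p.1) hc
    have h2 : act c.1 d.2 p.1 = 0 := by
      rw [hact, apply_eq_zero_of_diff_gen hc, map_zero]
      exact map_zero _
    rw [cbr_skew, map_neg]
    change -(p.2 (br d.1 c.1 p.1) + (act d.1 c.2 p.1 - act c.1 d.2 p.1)) = (0 : ℝ)
    rw [h2, sub_zero, hact, neg_eq_zero]
    exact h1
  -- One slot is extended at a time: first to all functions f against a generator d, then, with f
  -- fixed, from generators to all functions in the other slot.
  choose δ hδ h using fun d => exists_derivation (gen ∘ₗ cbr.flip d) fun p c hc => hwd p c d hc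
  have hlin : ∀ f p c, diff (gen c) p = diff f p → ∀ d, δ d f p = gen (cbr c d) p :=
    fun f p c hc d => h d f p c hc
  let T : DualFun 𝓘(ℝ, E) F V → GenPair E F V →ₗ[ℝ] DualFun 𝓘(ℝ, E) F V := fun f =>
    { toFun := fun d => δ d f
      map_add' := fun d d' => ContMDiffMap.ext fun p => by
        obtain ⟨c, hc⟩ := exists_diff_gen_eq f p
        rw [hlin f p c hc, map_add, map_add]
        change _ = δ d f p + δ d' f p
        rw [hlin f p c hc, hlin f p c hc]
        rfl
      map_smul' := fun r d => ContMDiffMap.ext fun p => by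
        obtain ⟨c, hc⟩ := exists_diff_gen_eq f p
        rw [hlin f p c hc, map_smul, map_smul]
        change _ = r • δ d f p
        rw [hlin f p c hc]
        rfl }
  choose pb hpb hpb' using fun f => exists_derivation (T f) fun p d hd => by
    obtain ⟨c, hc⟩ := exists_diff_gen_eq f p
    refine (hlin f p c hc d).trans ?_
    rw [cbr_skew, map_neg]
    change -gen (cbr d c) p = (0 : ℝ)
    rw [hwd p d c hd, neg_zero]
  have key : ∀ f g p c d, diff (gen c) p = diff f p → diff (gen d) p = diff g p →
      pb f g p = gen (cbr c d) p := fun f g p c d hc hd =>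
    (hpb' f g p d hd).trans (hlin f p c hc d)
  have pb_skew : ∀ f g, pb f g = -pb g f := fun f g => ContMDiffMap.ext fun p => by
    obtain ⟨c, hc⟩ := exists_diff_gen_eq f p
    obtain ⟨d, hd⟩ := exists_diff_gen_eq g p
    change pb f g p = -pb g f p
    rw [key f g p c d hc hd, key g f p d c hd hc, cbr_skew, map_neg]
    rfl
  refine ⟨LinearMap.mk₂ ℝ (fun f g => pb f g) (fun f f' g => ?_) (fun r f g => ?_)
    (fun f g g' => map_add _ _ _) (fun r f g => map_smul _ _ _), hpb, pb_skew, fun X Y => ?_⟩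
  · rw [pb_skew, map_add, pb_skew f, pb_skew f']
    abel
  · rw [pb_skew, map_smul, pb_skew f, smul_neg]
  · refine ContMDiffMap.ext fun p => ?_
    refine (key _ _ p (X, 0) (Y, 0) (by rw [gen_iota]) (by rw [gen_iota])).trans ?_
    rw [cbr_apply]
    simp only [map_zero, sub_zero, gen_iota]

variable [Nontrivial F]

/-- The Jacobi identity for a skew-symmetric biderivation of `C^∞(V*)` can be verified on the
functions `ι_X`. -/
theorem biderivation_jacobi
    {pb : DualFun 𝓘(ℝ, E) F V →ₗ[ℝ] DualFun 𝓘(ℝ, E) F V →ₗ[ℝ] DualFun 𝓘(ℝ, E) F V}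
    (hder : ∀ f, IsDer (pb f)) (hskew : ∀ f g, pb f g = -pb g f)
    (h : ∀ X Y Z : Cₛ^∞⟮𝓘(ℝ, E); F, V⟯, pb (iota X) (pb (iota Y) (iota Z)) +
      pb (iota Y) (pb (iota Z) (iota X)) + pb (iota Z) (pb (iota X) (iota Y)) = 0)
    (f g k : DualFun 𝓘(ℝ, E) F V) :
    pb f (pb g k) + pb g (pb k f) + pb k (pb f g) = 0 := by
  have key : ∀ f g, (∀ X : Cₛ^∞⟮𝓘(ℝ, E); F, V⟯,
      pb f (pb g (iota X)) + pb g (pb (iota X) f) + pb (iota X) (pb f g) = 0) →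
      ∀ k, pb f (pb g k) + pb g (pb k f) + pb k (pb f g) = 0 := by
    intro f g hfg
    -- As a function of its last argument the Jacobi expression is a derivation, so it vanishes if
    -- it does so on the ι_X.
    have h1 : ∀ k, (pb f ∘ₗ pb g - pb g ∘ₗ pb f - pb (pb f g)) k =
        pb f (pb g k) + pb g (pb k f) + pb k (pb f g) := fun k => by
      rw [hskew k f, hskew k (pb f g), map_neg]
      simp only [LinearMap.sub_apply, LinearMap.comp_apply]
      abel
    have h2 := (((hder f).commutator (hder g)).sub (hder (pb f g))).eq_zero fun X => by
      rw [h1, hfg]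
    intro k
    rw [← h1, h2]
    rfl
  have rot : ∀ f g k, pb f (pb g k) + pb g (pb k f) + pb k (pb f g) = 0 →
      pb k (pb f g) + pb f (pb g k) + pb g (pb k f) = 0 := fun f g k h => by
    rw [← h]
    abel
  -- The expression is cyclic, so the three arguments can be brought into the last slot in turn and
  -- replaced by functions ι_X.
  refine key f g (fun X => ?_) k
  refine rot _ _ _ (rot _ _ _ ?_)
  refine key (iota X) f (fun Y => ?_) g
  refine rot _ _ _ (rot _ _ _ ?_)
  exact key (iota Y) (iota X) (fun Z => h Y X Z) f

/-- A derivation of `C^∞(V*)` is compatible with a skew-symmetric biderivation if it is so on the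
functions `ι_X`. -/
theorem derivation_biderivation
    {pb : DualFun 𝓘(ℝ, E) F V →ₗ[ℝ] DualFun 𝓘(ℝ, E) F V →ₗ[ℝ] DualFun 𝓘(ℝ, E) F V}
    {D : DualFun 𝓘(ℝ, E) F V →ₗ[ℝ] DualFun 𝓘(ℝ, E) F V} (hD : IsDer D)
    (hder : ∀ f, IsDer (pb f)) (hskew : ∀ f g, pb f g = -pb g f)
    (h : ∀ X Y : Cₛ^∞⟮𝓘(ℝ, E); F, V⟯, D (pb (iota X) (iota Y)) =
      pb (D (iota X)) (iota Y) + pb (iota X) (D (iota Y)))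
    (f g : DualFun 𝓘(ℝ, E) F V) : D (pb f g) = pb (D f) g + pb f (D g) := by
  have key : ∀ f, (∀ X : Cₛ^∞⟮𝓘(ℝ, E); F, V⟯,
      D (pb f (iota X)) = pb (D f) (iota X) + pb f (D (iota X))) →
      ∀ g, D (pb f g) = pb (D f) g + pb f (D g) := by
    intro f hf
    -- The claim says that the derivations [D, {f, ·}] and {D f, ·} agree, which is tested on the
    -- ι_X. The first argument is then reduced in the same way by skew-symmetry.
    have h1 := (hD.commutator (hder f)).ext (hder (D f)) fun X => by
      rw [LinearMap.sub_apply, LinearMap.comp_apply, LinearMap.comp_apply, hf,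
        add_sub_cancel_right]
    intro g
    rw [← h1, LinearMap.sub_apply, LinearMap.comp_apply, LinearMap.comp_apply, sub_add_cancel]
  refine key f (fun X => ?_) g
  rw [hskew f, map_neg, key (iota X) (h X) f, hskew (D f), hskew f (D (iota X))]
  abel

/-! ### From Lie affgebroid brackets to aff-Poisson brackets, and uniqueness -/

variable {A : M → Type*} [∀ x, AddTorsor (V x) (A x)]
  [TopologicalSpace (TotalSpace F A)] [∀ x, TopologicalSpace (A x)] [FiberBundle F A]
  [AffineBundle F V A] [SmoothAffineBundle F V A 𝓘(ℝ, E)]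

theorem IsAffPoisson.isDer_vpart
    {P : RhoSection 𝓘(ℝ, E) F V A → RhoSection 𝓘(ℝ, E) F V A → DualFun 𝓘(ℝ, E) F V}
    (hP : IsAffPoisson P) (σ : RhoSection 𝓘(ℝ, E) F V A) :
    IsDer (hP.isAffineLieBracket.vpartₗ σ) := hP.leibniz σ

/-- The bilinear part is the difference of the linear parts at two sections, hence a difference of
derivations. -/
theorem IsAffPoisson.isDer_linBr
    {P : RhoSection 𝓘(ℝ, E) F V A → RhoSection 𝓘(ℝ, E) F V A → DualFun 𝓘(ℝ, E) F V}
    (hP : IsAffPoisson P) (σ : RhoSection 𝓘(ℝ, E) F V A) (f : DualFun 𝓘(ℝ, E) F V) :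
    IsDer (hP.isAffineLieBracket.linBrₗ σ f) :=
  (hP.isDer_vpart (f +ᵥ σ)).sub (hP.isDer_vpart σ)

theorem iota_vadd_vanishingSection (X : Cₛ^∞⟮𝓘(ℝ, E); F, V⟯) (a : Cₛ^∞⟮𝓘(ℝ, E); F, A⟯) :
    (iota X +ᵥ vanishingSection a : RhoSection 𝓘(ℝ, E) F V A) = vanishingSection (-X +ᵥ a) := by
  rw [vanishingSection_vadd, iota_neg, neg_neg]

variable [SecondCountableTopology M]

/-- An aff-Poisson bracket is determined by its values on linear sections. -/
theorem IsAffPoisson.ext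
    {P P' : RhoSection 𝓘(ℝ, E) F V A → RhoSection 𝓘(ℝ, E) F V A → DualFun 𝓘(ℝ, E) F V}
    (hP : IsAffPoisson P) (hP' : IsAffPoisson P')
    (h : ∀ a b : Cₛ^∞⟮𝓘(ℝ, E); F, A⟯, P (vanishingSection a) (vanishingSection b) =
      P' (vanishingSection a) (vanishingSection b)) : P = P' := by
  -- Translation by ι_X preserves the class of vanishing sections, so on the ι_X the linear parts
  -- are computed from brackets that agree by hypothesis.
  have h1 : ∀ a : Cₛ^∞⟮𝓘(ℝ, E); F, A⟯, hP.isAffineLieBracket.vpartₗ (vanishingSection a) =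
      hP'.isAffineLieBracket.vpartₗ (vanishingSection a) := fun a =>
    (hP.isDer_vpart _).ext (hP'.isDer_vpart _) fun X => by
      rw [hP.isAffineLieBracket.vpartₗ_apply, hP'.isAffineLieBracket.vpartₗ_apply, vpart, vpart,
        iota_vadd_vanishingSection, h, h]
  have h1' : ∀ (a : Cₛ^∞⟮𝓘(ℝ, E); F, A⟯) f, vpart P (vanishingSection a) f =
      vpart P' (vanishingSection a) f := fun a f => LinearMap.congr_fun (h1 a) f
  obtain ⟨a₀⟩ := nonempty_section E F A V
  have h2 : ∀ f, hP.isAffineLieBracket.linBrₗ (vanishingSection a₀) f =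
      -- Skew-symmetry moves ι_X to the first slot, where it is absorbed into a vanishing section;
      -- `h1'` then applies with f arbitrary.
      hP'.isAffineLieBracket.linBrₗ (vanishingSection a₀) f := fun f =>
    (hP.isDer_linBr _ f).ext (hP'.isDer_linBr _ f) fun X => by
      rw [hP.isAffineLieBracket.linBrₗ_apply, hP'.isAffineLieBracket.linBrₗ_apply,
        hP.isAffineLieBracket.linBr_skew, hP'.isAffineLieBracket.linBr_skew, linBr, linBr,
        iota_vadd_vanishingSection, h1', h1']
  funext σ τ
  obtain ⟨f, rfl⟩ := exists_vadd_rhoSection σ (vanishingSection a₀)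
  obtain ⟨g, rfl⟩ := exists_vadd_rhoSection τ (vanishingSection a₀)
  rw [hP.isAffineLieBracket.apply_vadd_vadd, hP'.isAffineLieBracket.apply_vadd_vadd, h1', h1']
  congr 1
  exact LinearMap.congr_fun (h2 f) g

theorem vadd_rhoSection_right_cancel {f g : DualFun 𝓘(ℝ, E) F V}
    {σ : RhoSection 𝓘(ℝ, E) F V A} (h : f +ᵥ σ = g +ᵥ σ) : f = g := by
  refine ContMDiffMap.ext fun p => ?_
  obtain ⟨b⟩ : Nonempty (A p.1) := inferInstance
  have h1 : (f +ᵥ σ).toFun p b = (g +ᵥ σ).toFun p b := by rw [h]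
  rw [vadd_rhoSection_apply, vadd_rhoSection_apply] at h1
  exact add_left_cancel h1

/-- A Lie affgebroid bracket defines an aff-Poisson bracket. -/
theorem exists_affPoisson
    {B : Cₛ^∞⟮𝓘(ℝ, E); F, A⟯ → Cₛ^∞⟮𝓘(ℝ, E); F, A⟯ → Cₛ^∞⟮𝓘(ℝ, E); F, V⟯}
    (hB : IsLieAffgebroidBracket B) :
    ∃ P : RhoSection 𝓘(ℝ, E) F V A → RhoSection 𝓘(ℝ, E) F V A → DualFun 𝓘(ℝ, E) F V,
      IsAffPoisson P ∧ ∀ a b : Cₛ^∞⟮𝓘(ℝ, E); F, A⟯,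
        P (vanishingSection a) (vanishingSection b) = iota (B a b) := by
  obtain ⟨hb, γ, hγ⟩ := hB
  obtain ⟨a₀⟩ := nonempty_section E F A V
  have hv : ∀ a : Cₛ^∞⟮𝓘(ℝ, E); F, A⟯, ContMDiff 𝓘(ℝ, E) 𝓘(ℝ, E).tangent ∞
      (fun x => (⟨x, γ.toFun x (a x)⟩ : TangentBundle 𝓘(ℝ, E) M)) := fun a =>
    γ.smooth.comp a.contMDiff
  have hγv : ∀ (X : Cₛ^∞⟮𝓘(ℝ, E); F, V⟯) (x : M) (f : C^∞⟮𝓘(ℝ, E), M; 𝓘(ℝ, ℝ), ℝ⟯),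
      dirDeriv f x (γ.toFun x ((X +ᵥ a₀) x)) =
        dirDeriv f x ((γ.toFun x).linear (X x)) + dirDeriv f x (γ.toFun x (a₀ x)) := by
    intro X x f
    have h1 : γ.toFun x ((X +ᵥ a₀) x) = (γ.toFun x).linear (X x) + γ.toFun x (a₀ x) :=
      (γ.toFun x).map_vadd (a₀ x) (X x)
    rw [h1]
    exact map_add (mfderiv 𝓘(ℝ, E) 𝓘(ℝ, ℝ) f x) _ _
  -- Smoothness is given for γ, not for its linear part; the latter is obtained as a difference of γ
  -- along two sections.
  have hsm : ∀ (X : Cₛ^∞⟮𝓘(ℝ, E); F, V⟯) (f : C^∞⟮𝓘(ℝ, E), M; 𝓘(ℝ, ℝ), ℝ⟯),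
      ContMDiff 𝓘(ℝ, E) 𝓘(ℝ, ℝ) ∞ (fun x => dirDeriv f x ((γ.toFun x).linear (X x))) := by
    intro X f
    have h1 := (contMDiff_dirDeriv (hv (X +ᵥ a₀)) f).sub (contMDiff_dirDeriv (hv a₀) f)
    refine h1.congr fun x => ?_
    rw [hγv, add_sub_cancel_right]
  let act : Cₛ^∞⟮𝓘(ℝ, E); F, V⟯ →ₗ[ℝ] C^∞⟮𝓘(ℝ, E), M; 𝓘(ℝ, ℝ), ℝ⟯ →ₗ[ℝ]
      C^∞⟮𝓘(ℝ, E), M; 𝓘(ℝ, ℝ), ℝ⟯ :=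
    LinearMap.mk₂ ℝ (fun X f => ⟨_, hsm X f⟩)
      (fun X Y f => ContMDiffMap.ext fun x => by
        change dirDeriv f x ((γ.toFun x).linear (X x + Y x)) = _
        rw [map_add]
        exact map_add (mfderiv 𝓘(ℝ, E) 𝓘(ℝ, ℝ) f x) _ _)
      (fun r X f => ContMDiffMap.ext fun x => by
        change dirDeriv f x ((γ.toFun x).linear (r • X x)) = _
        rw [map_smul]
        exact map_smul (mfderiv 𝓘(ℝ, E) 𝓘(ℝ, ℝ) f x) _ _)
      (fun X f g => ContMDiffMap.ext fun x => map_add (dirDerivₗ x _) f g)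
      (fun r X f => ContMDiffMap.ext fun x => map_smul (dirDerivₗ x _) r f)
  obtain ⟨δ, hδ, hδι⟩ := exists_isDer_of_derivative (hb.vpartₗ a₀) (hv a₀) (hγ a₀)
  obtain ⟨pb, hder, hskew, hpbι⟩ := exists_biderivation (hb.linBrₗ a₀) act
    (fun x => (γ.toFun x).linear) (fun _ _ _ => rfl) (hb.linBr_skew a₀) fun X f Y x => by
      change vpart B (X +ᵥ a₀) (smulSec f Y) x - vpart B a₀ (smulSec f Y) x =
        f x • (vpart B (X +ᵥ a₀) Y x - vpart B a₀ Y x) +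
          dirDeriv f x ((γ.toFun x).linear (X x)) • Y x
      rw [hγ, hγ, hγv, add_smul, smul_sub]
      abel
  have hjac := biderivation_jacobi hder hskew fun X Y Z => by
    simp only [hpbι, ← iota_add, hb.linBrₗ_apply, hb.linBr_jacobi]
    exact map_zero iotaₗ
  have hcomp := derivation_biderivation hδ.neg hder hskew fun X Y => by
    simp only [LinearMap.neg_apply, hδι, hpbι, map_neg, ← iota_add, ← iota_neg]
    congr 1
    rw [hb.linBrₗ_apply, hb.vpartₗ_apply, hb.vpart_linBr, neg_add]
    rfl
  choose κ hκ using fun σ : RhoSection 𝓘(ℝ, E) F V A =>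
    exists_vadd_rhoSection σ (vanishingSection a₀)
  have hκ' : ∀ f σ, κ (f +ᵥ σ) = f + κ σ := fun f σ =>
    vadd_rhoSection_right_cancel (σ := vanishingSection a₀) (by rw [← hκ, add_vadd, ← hκ])
  have hκ0 : ∀ X : Cₛ^∞⟮𝓘(ℝ, E); F, V⟯, κ (vanishingSection (X +ᵥ a₀)) = -iota X := fun X =>
    vadd_rhoSection_right_cancel (σ := vanishingSection a₀) (by
      rw [← hκ, vanishingSection_vadd])
  -- The section vanishing on X + a₀ has displacement -ι_X. The linear part must therefore be -δ,
  -- while the two signs cancel in the bilinear part.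
  refine ⟨affBr κ (-δ) pb, ⟨isAffineLieBracket_affBr hκ' hskew hcomp hjac, fun σ => ?_⟩, ?_⟩
  · have h1 := hδ.neg.add (hder (κ σ))
    intro f g
    simp only [vpart_affBr hκ']
    exact h1 f g
  · intro a b
    obtain ⟨X, rfl⟩ := exists_vadd_section (V := V) a a₀
    obtain ⟨Y, rfl⟩ := exists_vadd_section (V := V) b a₀
    rw [hb.apply_vadd_vadd, affBr, hκ0, hκ0, iota_add, iota_sub]
    simp only [map_neg, LinearMap.neg_apply, neg_neg, hδι, hpbι]
    rfl

end Poisson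

/-! ### Tangent vectors as point derivations -/

section TangentVectors

set_option linter.unusedSectionVars false

variable {E : Type*} [NormedAddCommGroup E] [NormedSpace ℝ E] [FiniteDimensional ℝ E]
  {M : Type*} [TopologicalSpace M] [ChartedSpace E M] [IsManifold 𝓘(ℝ, E) ∞ M] [T2Space M]

/-- Coordinate functions near `x`, extended to the whole manifold. -/
theorem exists_coordinates {ι : Type*} [Fintype ι] (b : Module.Basis ι ℝ E) (x : M) :
    ∃ Y : ι → C^∞⟮𝓘(ℝ, E), M; 𝓘(ℝ, ℝ), ℝ⟯,
      ∀ i, ∀ᶠ y in 𝓝 x, Y i y = b.coord i (extChartAt 𝓘(ℝ, E) x y) := by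
  have hc : ContMDiffOn 𝓘(ℝ, E) 𝓘(ℝ, E) ∞ (extChartAt 𝓘(ℝ, E) x)
      (extChartAt 𝓘(ℝ, E) x).source := by
    rw [extChartAt_source]
    exact contMDiffOn_extChartAt
  choose Y hY using fun i => exists_contMDiffMap_eventuallyEq (I := 𝓘(ℝ, E))
    (extChartAt_source_mem_nhds (I := 𝓘(ℝ, E)) x)
    ((LinearMap.toContinuousLinearMap (b.coord i)).contMDiff.comp_contMDiffOn hc)
  exact ⟨Y, hY⟩

/-- The components of a tangent vector are the derivatives of the coordinate functions. -/
theorem eventually_dirDeriv_coordinate {ι : Type*} [Fintype ι] {b : Module.Basis ι ℝ E} {x : M}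
    {Y : ι → C^∞⟮𝓘(ℝ, E), M; 𝓘(ℝ, ℝ), ℝ⟯}
    (hY : ∀ i, ∀ᶠ y in 𝓝 x, Y i y = b.coord i (extChartAt 𝓘(ℝ, E) x y)) :
    ∀ᶠ y in 𝓝 x, ∀ i (v : TangentSpace 𝓘(ℝ, E) y),
      dirDeriv (Y i) y v = b.coord i (mfderiv 𝓘(ℝ, E) 𝓘(ℝ, E) (extChartAt 𝓘(ℝ, E) x) y v) := by
  filter_upwards [eventually_eventually_nhds.2 (Filter.eventually_all.2 hY),
    (chartAt E x).open_source.mem_nhds (mem_chart_source E x)] with y hy hys i v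
  have h1 : Y i =ᶠ[𝓝 y] (LinearMap.toContinuousLinearMap (b.coord i)) ∘ extChartAt 𝓘(ℝ, E) x :=
    hy.mono fun z hz => hz i
  have h2 := mfderiv_comp y (LinearMap.toContinuousLinearMap (b.coord i)).mdifferentiableAt
    (mdifferentiableAt_extChartAt (I := 𝓘(ℝ, E)) hys)
  rw [← h1.mfderiv_eq, ContinuousLinearMap.mfderiv_eq] at h2
  exact congrArg (fun T : E →L[ℝ] ℝ => T v) h2

/-- The derivatives of the coordinate functions are the components of the vector under the
differential of the chart, which is invertible. -/
theorem tangent_ext {x : M} {v w : TangentSpace 𝓘(ℝ, E) x}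
    (h : ∀ f : C^∞⟮𝓘(ℝ, E), M; 𝓘(ℝ, ℝ), ℝ⟯, dirDeriv f x v = dirDeriv f x w) : v = w := by
  let b := Module.finBasis ℝ E
  obtain ⟨Y, hY⟩ := exists_coordinates b x
  have h1 := (eventually_dirDeriv_coordinate hY).self_of_nhds
  have hinv := isInvertible_mfderiv_extChartAt (I := 𝓘(ℝ, E))
    (mem_extChartAt_source (I := 𝓘(ℝ, E)) x)
  refine hinv.injective (b.ext_elem fun i => ?_)
  exact (h1 i v).symm.trans ((h (Y i)).trans (h1 i w))

/-- Point derivations are tangent vectors. -/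
theorem exists_tangent_of_pointDerivation {x : M} {D : C^∞⟮𝓘(ℝ, E), M; 𝓘(ℝ, ℝ), ℝ⟯ →ₗ[ℝ] ℝ}
    (hD : ∀ f g, D (f * g) = f x * D g + g x * D f) :
    ∃ v : TangentSpace 𝓘(ℝ, E) x, ∀ f, D f = dirDeriv f x v := by
  let b := Module.finBasis ℝ E
  obtain ⟨Y, hY⟩ := exists_coordinates b x
  have h1 := (eventually_dirDeriv_coordinate hY).self_of_nhds
  have hinv := isInvertible_mfderiv_extChartAt (I := 𝓘(ℝ, E))
    (mem_extChartAt_source (I := 𝓘(ℝ, E)) x)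
  -- The vector whose components are the values of D on the coordinate functions.
  obtain ⟨v, hv⟩ := hinv.surjective (∑ i, D (Y i) • b i : E)
  have hYv : ∀ i, dirDeriv (Y i) x v = D (Y i) := fun i => by
    refine (h1 i v).trans ?_
    refine (congrArg (b.coord i) hv).trans ?_
    rw [map_sum, Finset.sum_eq_single i]
    · simp
    · intro j _ hj
      simp [hj]
    · simp
  refine ⟨v, fun f => ?_⟩
  obtain ⟨c, -, hc⟩ := exists_mfderiv_eq_sum b x f
  have h2 : mfderiv 𝓘(ℝ, E) 𝓘(ℝ, ℝ) f x = ∑ i, c i x • mfderiv 𝓘(ℝ, E) 𝓘(ℝ, ℝ) (Y i) x := by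
    rw [hc.self_of_nhds]
    refine Finset.sum_congr rfl fun i _ => ?_
    congr 1
    exact (Filter.EventuallyEq.mfderiv_eq (hY i)).symm
  have h3 : ∀ w, dirDeriv f x w = dirDeriv (∑ i, c i x • Y i) x w := fun w => by
    rw [← dirDerivₗ_apply x w (∑ i, _), map_sum]
    refine (congrArg (fun T : E →L[ℝ] ℝ => T w) h2).trans ?_
    refine (sum_apply (F := E →L[ℝ] ℝ) Finset.univ _ w).trans ?_
    refine Finset.sum_congr rfl fun i _ => ?_
    rw [map_smul]
    rfl
  -- Subtracting the linear combination of coordinates with the same differential at x leaves a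
  -- function that D kills.
  have h4 : D (f - ∑ i, c i x • Y i) = 0 := pointDerivation_eq_zero hD (by
    refine ContinuousLinearMap.ext fun w => ?_
    change dirDerivₗ x w (f - ∑ i, c i x • Y i) = 0
    rw [map_sub, dirDerivₗ_apply, dirDerivₗ_apply, h3, sub_self])
  rw [map_sub, sub_eq_zero] at h4
  rw [h3, h4, ← dirDerivₗ_apply, map_sum, map_sum]
  refine Finset.sum_congr rfl fun i _ => ?_
  rw [map_smul, map_smul, dirDerivₗ_apply, hYv]

/-- A map to the tangent bundle is smooth if the derivatives of functions in its direction are. -/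
theorem contMDiffAt_tangent_of_dirDeriv {E' H' N : Type*} [NormedAddCommGroup E']
    [NormedSpace ℝ E'] [TopologicalSpace H'] {I' : ModelWithCorners ℝ E' H'} [TopologicalSpace N]
    [ChartedSpace H' N] {v : N → TangentBundle 𝓘(ℝ, E) M} {q : N}
    (hproj : ContMDiffAt I' 𝓘(ℝ, E) ∞ (fun p => (v p).1) q)
    (h : ∀ f : C^∞⟮𝓘(ℝ, E), M; 𝓘(ℝ, ℝ), ℝ⟯,
      ContMDiffAt I' 𝓘(ℝ, ℝ) ∞ (fun p => dirDeriv f (v p).1 (v p).2) q) :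
    ContMDiffAt I' 𝓘(ℝ, E).tangent ∞ v q := by
  refine contMDiffAt_totalSpace.2 ⟨hproj, ?_⟩
  let b := Module.finBasis ℝ E
  obtain ⟨Y, hY⟩ := exists_coordinates b (v q).1
  have h1 : ContMDiffAt I' 𝓘(ℝ, E) ∞ (fun p => ∑ i, dirDeriv (Y i) (v p).1 (v p).2 • b i) q :=
    contMDiffAt_finsetSum fun i _ => (h (Y i)).smul contMDiffAt_const
  refine h1.congr_of_eventuallyEq ?_
  filter_upwards [hproj.continuousAt.eventually (eventually_dirDeriv_coordinate hY),
    hproj.continuousAt.preimage_mem_nhds ((chartAt E (v q).1).open_source.mem_nhds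
      (mem_chart_source E (v q).1))] with p hp hps
  have hps' : (v p).1 ∈ (chartAt E (v q).1).source := hps
  have h2 : (trivializationAt E (TangentSpace 𝓘(ℝ, E)) (v q).1 (v p)).2 =
      mfderiv 𝓘(ℝ, E) 𝓘(ℝ, E) (extChartAt 𝓘(ℝ, E) (v q).1) (v p).1 (v p).2 := by
    rw [← TangentBundle.continuousLinearMapAt_trivializationAt hps']
    exact (Trivialization.continuousLinearMapAt_apply_of_mem ℝ _ (by simpa using hps') _).symm
  rw [h2]
  simp only [hp]
  exact (b.sum_repr _).symm

end TangentVectors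

/-! ### Transport of affine Lie brackets along anti-affine maps -/

section Transport

variable {W S W' S' : Type*} [AddCommGroup W] [Module ℝ W] [AddAction W S]
  [AddCommGroup W'] [Module ℝ W'] [AddAction W' S'] {B : S → S → W} {P : S' → S' → W'}
  {k : W →ₗ[ℝ] W'} {σ : S → S'}

/-- Only the displacement w is reversed by σ, hence a single sign. The same sign appears in all
three terms of the Jacobi identity, which is why that identity transfers. -/
theorem map_vpart (hP : IsAffineLieBracket P) (hσ : ∀ w s, σ (w +ᵥ s) = -k w +ᵥ σ s)
    (h : ∀ s t, P (σ s) (σ t) = k (B s t)) (s : S) (w : W) :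
    k (vpart B s w) = -vpart P (σ s) (k w) := by
  rw [vpart, map_sub, ← h, ← h, hσ, hP.apply_vadd, hP.vpart_neg, add_sub_cancel_right]

/-- Restriction of an affine Lie bracket along an injective anti-affine map. -/
theorem isAffineLieBracket_of_injective (hP : IsAffineLieBracket P) (hk : Function.Injective k)
    (hσ : ∀ w s, σ (w +ᵥ s) = -k w +ᵥ σ s) (h : ∀ s t, P (σ s) (σ t) = k (B s t)) :
    IsAffineLieBracket B := by
  have hskew : ∀ s t, B s t = -B t s := fun s t => hk (by rw [map_neg, ← h, ← h, hP.skew])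
  have hright : ∀ s, IsAffine W (B s) := fun s =>
    ⟨{ toFun := vpart B s
       map_add' := fun w w' => hk (by
        rw [map_add]
        simp only [map_vpart hP hσ h, map_add, hP.vpart_add, neg_add])
       map_smul' := fun r w => hk (by
        rw [RingHom.id_apply, map_smul]
        simp only [map_vpart hP hσ h, map_smul, hP.vpart_smul, smul_neg]) },
      fun w t => hk (by
        rw [map_add]
        change _ = k (vpart B s w) + _
        rw [map_vpart hP hσ h, ← h, ← h, hσ, hP.apply_vadd, hP.vpart_neg])⟩
  refine ⟨fun t => ?_, hright, hskew, fun s t u => hk ?_⟩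
  · obtain ⟨L, hL⟩ := hright t
    exact ⟨-L, fun w s => by
      change B (w +ᵥ s) t = (-L) w + B s t
      rw [hskew, hL, hskew s, LinearMap.neg_apply, neg_add]⟩
  · rw [map_add, map_add, map_zero]
    simp only [map_vpart hP hσ h, ← h]
    rw [← neg_add, ← neg_add, hP.jacobi, neg_zero]

end Transport

/-! ### Basic functions and construction of the anchor -/

section FibrewiseLinear

set_option linter.unusedSectionVars false
set_option synthInstance.maxHeartbeats 200000

variable {E : Type*} [NormedAddCommGroup E] [NormedSpace ℝ E] [FiniteDimensional ℝ E]
  {M : Type*} [TopologicalSpace M] [ChartedSpace E M] [IsManifold 𝓘(ℝ, E) ∞ M] [T2Space M]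
  {F : Type*} [NormedAddCommGroup F] [NormedSpace ℝ F] [FiniteDimensional ℝ F]
  {V : M → Type*} [∀ x, AddCommGroup (V x)] [∀ x, Module ℝ (V x)]
  [TopologicalSpace (TotalSpace F V)] [∀ x, TopologicalSpace (V x)] [FiberBundle F V]
  [VectorBundle ℝ F V] [ContMDiffVectorBundle ∞ F V 𝓘(ℝ, E)]

theorem basic_injective : Function.Injective
    (basic F V : C^∞⟮𝓘(ℝ, E), M; 𝓘(ℝ, ℝ), ℝ⟯ → DualFun 𝓘(ℝ, E) F V) := fun _ _ h =>
  ContMDiffMap.ext fun x => congrArg (fun f => f (⟨x, 0⟩ : VDualTotal F V)) h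

/-- Both ι_X and g ι_X are homogeneous of degree one on each fibre, so g is constant along every
punctured line through 0 and, by continuity, equal there to its value at 0. -/
theorem exists_basic {g : DualFun 𝓘(ℝ, E) F V}
    (h : ∀ X : Cₛ^∞⟮𝓘(ℝ, E); F, V⟯, IsLinearFun (g * iota X)) :
    ∃ k : C^∞⟮𝓘(ℝ, E), M; 𝓘(ℝ, ℝ), ℝ⟯, g = basic F V k := by
  have hz : ContMDiff 𝓘(ℝ, E) (𝓘(ℝ, E).prod 𝓘(ℝ, F →L[ℝ] ℝ)) ∞
      (fun x => (⟨x, 0⟩ : VDualTotal F V)) :=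
    contMDiff_zeroSection ℝ (fun x : M => V x →L[ℝ] Bundle.Trivial M ℝ x)
  refine ⟨⟨_, g.contMDiff.comp hz⟩, ContMDiffMap.ext fun ⟨x, l⟩ => ?_⟩
  change g ⟨x, l⟩ = g ⟨x, 0⟩
  by_cases hl : l = 0
  · rw [hl]
  obtain ⟨X, hX⟩ := exists_section_apply_ne_zero (E := E) (F := F) hl
  have hc := (contMDiff_fibre_line (E := E) (F := F) x 0 l).continuous
  have h1 : (fun t : ℝ => g ⟨x, 0 + t • l⟩) = fun _ : ℝ => g ⟨x, l⟩ := by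
    refine Continuous.ext_on (dense_compl_singleton (0 : ℝ)) (g.contMDiff.continuous.comp hc)
      continuous_const fun t ht => ?_
    have ht' : t ≠ 0 := ht
    have h2 : g ⟨x, t • l⟩ * (t * l (X x) : ℝ) = t * (g ⟨x, l⟩ * l (X x)) :=
      (h X x).map_smul t l
    have h3 : (g ⟨x, t • l⟩ - g ⟨x, l⟩) * (t * l (X x) : ℝ) = 0 := by linear_combination h2
    simp only [zero_add]
    exact sub_eq_zero.1 ((mul_eq_zero.1 h3).resolve_right (mul_ne_zero ht' hX))
  have h2 := congrFun h1 0
  simp only [zero_smul, add_zero] at h2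
  exact h2.symm

/-- A derivation that maps fibrewise linear functions to fibrewise linear functions maps basic
functions to basic functions. -/
theorem IsDer.exists_basic {D : DualFun 𝓘(ℝ, E) F V →ₗ[ℝ] DualFun 𝓘(ℝ, E) F V} (hD : IsDer D)
    {T : Cₛ^∞⟮𝓘(ℝ, E); F, V⟯ → Cₛ^∞⟮𝓘(ℝ, E); F, V⟯} (hT : ∀ X, D (iota X) = iota (T X))
    (f : C^∞⟮𝓘(ℝ, E), M; 𝓘(ℝ, ℝ), ℝ⟯) :
    ∃ k : C^∞⟮𝓘(ℝ, E), M; 𝓘(ℝ, ℝ), ℝ⟯, D (basic F V f) = basic F V k := by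
  refine AffBundle.exists_basic fun X => ?_
  -- The Leibniz rule on f ι_X = ι_{fX} exhibits D(f) ι_X as a difference of fibrewise linear
  -- functions.
  have h : D (basic F V f) * iota X = iota (T (smulSec f X) - smulSec f (T X)) := by
    rw [iota_sub, ← hT, iota_smulSec, iota_smulSec, hD, hT, add_sub_cancel_left]
  rw [h]
  exact isLinearFun_iota _

/-- A function on `V*` whose products with the functions `ι_X` are basic vanishes. -/
theorem eq_zero_of_mul_iota_eq_basic [Nontrivial F] {g : DualFun 𝓘(ℝ, E) F V}
    (h : ∀ X : Cₛ^∞⟮𝓘(ℝ, E); F, V⟯, ∃ k : C^∞⟮𝓘(ℝ, E), M; 𝓘(ℝ, ℝ), ℝ⟯,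
      g * iota X = basic F V k) : g = 0 := by
  refine eq_zero_of_mul_iota fun X => ?_
  obtain ⟨k, hk⟩ := h X
  refine ContMDiffMap.ext fun p => ?_
  -- ι_X vanishes on the zero section, and a basic function is determined by its values there.
  have h1 : g ⟨p.1, 0⟩ * (0 : ℝ) = k p.1 := congrArg (fun f => f (⟨p.1, 0⟩ : VDualTotal F V)) hk
  rw [hk, basic_apply, ← h1, mul_zero]
  rfl

/-- The value at `x` of a `C^∞(M)`-linear map on sections depends only on the value of the section
at `x`. -/
theorem tensorial_eq_zero {T : Cₛ^∞⟮𝓘(ℝ, E); F, V⟯ →ₗ[ℝ] C^∞⟮𝓘(ℝ, E), M; 𝓘(ℝ, ℝ), ℝ⟯}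
    (hT : ∀ k X, T (smulSec k X) = k * T X) {X : Cₛ^∞⟮𝓘(ℝ, E); F, V⟯} {x : M} (hX : X x = 0) :
    T X x = 0 := by
  -- Near x, X is a combination of frame sections with coefficients vanishing at x. A cutoff makes
  -- this an identity of global sections, to which C^∞(M)-linearity applies.
  obtain ⟨f, s, hf, -, hfs⟩ := exists_section_decomp X x (Module.finBasis ℝ F)
  obtain ⟨χ, h1, hχ⟩ := exists_cutoff (I := 𝓘(ℝ, E)) hfs
  have h2 : smulSec χ X = smulSec χ (∑ i, smulSec (f i) (s i)) := by
    refine ContMDiffSection.ext fun y => ?_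
    change χ y • X y = χ y • (∑ i, smulSec (f i) (s i)) y
    by_cases hy : y ∈ tsupport χ
    · have h3 : X y = (∑ i, smulSec (f i) (s i)) y := hχ hy
      rw [h3]
    · rw [image_eq_zero_of_notMem_tsupport hy, zero_smul, zero_smul]
  have h3 : χ x * T X x = χ x * T (∑ i, smulSec (f i) (s i)) x :=
    congrArg (fun g => g x) ((hT χ X).symm.trans ((congrArg T h2).trans (hT χ _)))
  rw [h1.self_of_nhds, one_mul, one_mul] at h3
  rw [h3, map_sum, ← ContMDiffMap.coeFnAddMonoidHom_apply, map_sum, Finset.sum_apply]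
  refine Finset.sum_eq_zero fun i _ => ?_
  have h0 : (trivializationAt F V x ⟨x, 0⟩).2 = 0 :=
    ((trivializationAt F V x).linear ℝ (mem_baseSet_trivializationAt F V x)).map_zero
  rw [hT]
  change f i x * _ = 0
  rw [(hf i).self_of_nhds, hX, h0, map_zero, zero_mul]

/-- A `C^∞(M)`-linear action of sections by derivations of `C^∞(M)` is given by a linear
morphism to the tangent bundle. -/
theorem exists_linear_anchor
    {act : Cₛ^∞⟮𝓘(ℝ, E); F, V⟯ →ₗ[ℝ] C^∞⟮𝓘(ℝ, E), M; 𝓘(ℝ, ℝ), ℝ⟯ →ₗ[ℝ]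
      C^∞⟮𝓘(ℝ, E), M; 𝓘(ℝ, ℝ), ℝ⟯}
    (hsmul : ∀ k X f, act (smulSec k X) f = k * act X f)
    (hder : ∀ X f g, act X (f * g) = f * act X g + act X f * g) :
    ∃ θ : ∀ x : M, V x →ₗ[ℝ] TangentSpace 𝓘(ℝ, E) x,
      ∀ X f x, act X f x = dirDeriv f x (θ x (X x)) := by
  have hloc : ∀ {X Y : Cₛ^∞⟮𝓘(ℝ, E); F, V⟯} {x : M}, X x = Y x → ∀ f, act X f x = act Y f x := by
    intro X Y x h f
    have h1 := tensorial_eq_zero (T := act.flip f) (fun k X => hsmul k X f) (X := X - Y) (x := x)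
      (sub_eq_zero.2 h)
    rw [map_sub] at h1
    exact sub_eq_zero.1 h1
  have hvec : ∀ (x : M) (v : V x), ∃ z : TangentSpace 𝓘(ℝ, E) x,
      ∀ X : Cₛ^∞⟮𝓘(ℝ, E); F, V⟯, X x = v → ∀ f, act X f x = dirDeriv f x z := by
    intro x v
    obtain ⟨X, rfl⟩ := exists_section_apply_eq (E := E) (F := F) v
    let D : C^∞⟮𝓘(ℝ, E), M; 𝓘(ℝ, ℝ), ℝ⟯ →ₗ[ℝ] ℝ :=
      { toFun := fun f => act X f x
        map_add' := fun f g => by rw [map_add]; rfl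
        map_smul' := fun r f => by rw [map_smul]; rfl }
    obtain ⟨z, hz⟩ := exists_tangent_of_pointDerivation (D := D) fun f g => by
      change act X (f * g) x = f x * act X g x + g x * act X f x
      rw [hder, mul_comm (g x)]
      rfl
    exact ⟨z, fun Y hY f => (hloc hY f).trans (hz f)⟩
  choose θ hθ using hvec
  refine ⟨fun x =>
    { toFun := θ x
      map_add' := fun v w => tangent_ext fun f => ?_
      map_smul' := fun r v => tangent_ext fun f => ?_ }, fun X f x => hθ x (X x) X rfl f⟩
  · obtain ⟨X, rfl⟩ := exists_section_apply_eq (E := E) (F := F) v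
    obtain ⟨Y, rfl⟩ := exists_section_apply_eq (E := E) (F := F) w
    refine (hθ x _ (X + Y) rfl f).symm.trans ?_
    rw [map_add]
    refine Eq.trans ?_ (map_add (mfderiv 𝓘(ℝ, E) 𝓘(ℝ, ℝ) f x) _ _).symm
    exact congrArg₂ (· + ·) (hθ x _ X rfl f) (hθ x _ Y rfl f)
  · obtain ⟨X, rfl⟩ := exists_section_apply_eq (E := E) (F := F) v
    refine (hθ x _ (r • X) rfl f).symm.trans ?_
    rw [map_smul]
    refine Eq.trans ?_ (map_smul (mfderiv 𝓘(ℝ, E) 𝓘(ℝ, ℝ) f x) _ _).symm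
    exact congrArg (r • ·) (hθ x _ X rfl f)

variable {A : M → Type*} [∀ x, AddTorsor (V x) (A x)]
  [TopologicalSpace (TotalSpace F A)] [∀ x, TopologicalSpace (A x)] [FiberBundle F A]
  [AffineBundle F V A] [SmoothAffineBundle F V A 𝓘(ℝ, E)]

/-- The anchor map with given linear part `act` and value `Z₀` on the section `a₀`. -/
theorem exists_anchorMap (a₀ : Cₛ^∞⟮𝓘(ℝ, E); F, A⟯)
    {Z₀ : C^∞⟮𝓘(ℝ, E), M; 𝓘(ℝ, ℝ), ℝ⟯ →ₗ[ℝ] C^∞⟮𝓘(ℝ, E), M; 𝓘(ℝ, ℝ), ℝ⟯}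
    (hZ₀ : ∀ f g, Z₀ (f * g) = f * Z₀ g + Z₀ f * g)
    {act : Cₛ^∞⟮𝓘(ℝ, E); F, V⟯ →ₗ[ℝ] C^∞⟮𝓘(ℝ, E), M; 𝓘(ℝ, ℝ), ℝ⟯ →ₗ[ℝ]
      C^∞⟮𝓘(ℝ, E), M; 𝓘(ℝ, ℝ), ℝ⟯}
    (hsmul : ∀ k X f, act (smulSec k X) f = k * act X f)
    (hder : ∀ X f g, act X (f * g) = f * act X g + act X f * g) :
    ∃ γ : AnchorMap 𝓘(ℝ, E) F V A, ∀ (X : Cₛ^∞⟮𝓘(ℝ, E); F, V⟯)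
      (f : C^∞⟮𝓘(ℝ, E), M; 𝓘(ℝ, ℝ), ℝ⟯) (x : M),
      dirDeriv f x (γ.toFun x ((X +ᵥ a₀) x)) = act X f x + Z₀ f x := by
  obtain ⟨θ, hθ⟩ := exists_linear_anchor hsmul hder
  have hvec : ∀ x : M, ∃ z : TangentSpace 𝓘(ℝ, E) x, ∀ f, Z₀ f x = dirDeriv f x z := by
    intro x
    let D : C^∞⟮𝓘(ℝ, E), M; 𝓘(ℝ, ℝ), ℝ⟯ →ₗ[ℝ] ℝ :=
      { toFun := fun f => Z₀ f x
        map_add' := fun f g => by rw [map_add]; rfl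
        map_smul' := fun r f => by rw [map_smul]; rfl }
    obtain ⟨z, hz⟩ := exists_tangent_of_pointDerivation (D := D) fun f g => by
      change Z₀ (f * g) x = f x * Z₀ g x + g x * Z₀ f x
      rw [hZ₀, mul_comm (g x)]
      rfl
    exact ⟨z, hz⟩
  choose v hv using hvec
  let τ : ∀ x, A x →ᵃ[ℝ] TangentSpace 𝓘(ℝ, E) x := fun x =>
    { toFun := fun α => θ x (α -ᵥ a₀ x) + v x
      linear := θ x
      map_vadd' := fun α w => by
        rw [vadd_vsub_assoc, map_add, vadd_eq_add, add_assoc] }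
  have hτ : ∀ f x (α : A x), dirDeriv f x (τ x α) = dirDeriv f x (θ x (α -ᵥ a₀ x)) + Z₀ f x :=
    fun f x α => by
      rw [hv]
      exact map_add (mfderiv 𝓘(ℝ, E) 𝓘(ℝ, ℝ) f x) _ _
  refine ⟨⟨τ, fun q => ?_⟩, fun X f x => ?_⟩
  · have hproj : ContMDiffAt (𝓘(ℝ, E).prod 𝓘(ℝ, F)) 𝓘(ℝ, E) ∞
        (fun p : TotalSpace F A => p.1) q := contMDiff_proj A q
    refine contMDiffAt_tangent_of_dirDeriv hproj fun f => ?_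
    let b := Module.finBasis ℝ F
    choose s hs using fun i => exists_section_const (E := E) (V := V) q.1 (b i)
    obtain ⟨h, hh, hsub⟩ := exists_vsub_coord E F V A q.1
    have hU : (trivializationAt F A q.1).baseSet ∩ (trivializationAt F V q.1).baseSet ∈ 𝓝 q.1 :=
      ((trivializationAt F A q.1).open_baseSet.inter
        (trivializationAt F V q.1).open_baseSet).mem_nhds
        ⟨mem_baseSet_trivializationAt F A q.1, mem_baseSet_trivializationAt F V q.1⟩
    have ha : ContMDiffAt 𝓘(ℝ, E) 𝓘(ℝ, F) ∞
        (fun y => (trivializationAt F A q.1 ⟨y, a₀ y⟩).2) q.1 :=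
      (contMDiffAt_section q.1).1 (a₀.contMDiff q.1)
    have hid : ContMDiffAt (𝓘(ℝ, E).prod 𝓘(ℝ, F)) 𝓘(ℝ, F) ∞
        (fun p : TotalSpace F A => (trivializationAt F A q.1 p).2) q :=
      (contMDiffAt_totalSpace.1 contMDiffAt_id).2
    have hu : ContMDiffAt (𝓘(ℝ, E).prod 𝓘(ℝ, F)) 𝓘(ℝ, F) ∞
        (fun p : TotalSpace F A => h p.1 ((trivializationAt F A q.1 p).2 -
          (trivializationAt F A q.1 ⟨p.1, a₀ p.1⟩).2)) q :=
      ((hh.contMDiffAt hU).comp q hproj).clm_apply (hid.sub (ha.comp q hproj))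
    -- The derivative of f along τ(α) is Z₀ f plus the combination of the functions `act (s i) f`
    -- whose coefficients are the frame coordinates of α - a₀; these depend smoothly on α.
    have hsum : ContMDiffAt (𝓘(ℝ, E).prod 𝓘(ℝ, F)) 𝓘(ℝ, ℝ) ∞
        (fun p : TotalSpace F A => ∑ i, b.coord i (h p.1 ((trivializationAt F A q.1 p).2 -
          (trivializationAt F A q.1 ⟨p.1, a₀ p.1⟩).2)) * act (s i) f p.1 + Z₀ f p.1) q := by
      refine ContMDiffAt.add (contMDiffAt_finsetSum fun i _ => ?_)
        (((Z₀ f).contMDiff q.1).comp q hproj)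
      exact ((LinearMap.toContinuousLinearMap (b.coord i)).contMDiff.contMDiffAt.comp q hu).mul
        (((act (s i) f).contMDiff q.1).comp q hproj)
    refine hsum.congr_of_eventuallyEq ?_
    filter_upwards [hproj.continuousAt.preimage_mem_nhds hU,
      hproj.continuousAt.eventually (Filter.eventually_all.2 hs)] with p hp hsp
    rw [hτ]
    congr 1
    rw [← hsub p.1 hp p.2 (a₀ p.1)]
    set w := p.2 -ᵥ a₀ p.1
    have hw : w = ∑ i, b.coord i (trivializationAt F V q.1 ⟨p.1, w⟩).2 • s i p.1 := by
      conv_lhs => rw [← Trivialization.symm_apply_apply_mk (trivializationAt F V q.1) hp.2 w,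
        ← b.sum_repr (trivializationAt F V q.1 ⟨p.1, w⟩).2]
      rw [← Trivialization.symmL_apply (R := ℝ) _ hp.2, map_sum]
      refine Finset.sum_congr rfl fun i _ => ?_
      rw [map_smul, Trivialization.symmL_apply _ hp.2, hsp]
      rfl
    conv_lhs => rw [hw, map_sum]
    refine (map_sum (mfderiv 𝓘(ℝ, E) 𝓘(ℝ, ℝ) f p.1) _ _).trans ?_
    refine Finset.sum_congr rfl fun i _ => ?_
    rw [map_smul, hθ]
    exact map_smul (mfderiv 𝓘(ℝ, E) 𝓘(ℝ, ℝ) f p.1) _ _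
  · change dirDeriv f x (τ x (X x +ᵥ a₀ x)) = _
    rw [hτ, vadd_vsub, hθ]

/-! ### From linear aff-Poisson brackets to Lie affgebroid brackets -/

variable [Nontrivial F] [SecondCountableTopology M]

/-- A linear aff-Poisson bracket defines a Lie affgebroid bracket. -/
theorem exists_lieAffgebroidBracket
    {P : RhoSection 𝓘(ℝ, E) F V A → RhoSection 𝓘(ℝ, E) F V A → DualFun 𝓘(ℝ, E) F V}
    (hP : IsLinearAffPoisson P) :
    ∃ B : Cₛ^∞⟮𝓘(ℝ, E); F, A⟯ → Cₛ^∞⟮𝓘(ℝ, E); F, A⟯ → Cₛ^∞⟮𝓘(ℝ, E); F, V⟯,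
      IsLieAffgebroidBracket B ∧ ∀ a b : Cₛ^∞⟮𝓘(ℝ, E); F, A⟯,
        P (vanishingSection a) (vanishingSection b) = iota (B a b) := by
  obtain ⟨hP, hlin⟩ := hP
  have hp := hP.isAffineLieBracket
  choose B hB using fun a b : Cₛ^∞⟮𝓘(ℝ, E); F, A⟯ =>
    (hlin _ _ (isLinear_vanishingSection a) (isLinear_vanishingSection b)).exists_iota
  have hb : IsAffineLieBracket B :=
    isAffineLieBracket_of_injective (k := iotaₗ) hp iota_injective vanishingSection_vadd hB
  have hι : ∀ a X, -vpart P (vanishingSection a) (iota X) = iota (vpart B a X) := fun a X =>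
    (map_vpart (k := iotaₗ) hp vanishingSection_vadd hB a X).symm
  refine ⟨B, ⟨hb, ?_⟩, hB⟩
  -- The derivation -{σ_a, ·}ᵛ takes ι_X to ι of [a, X]ᵛ, so it preserves basic functions. The
  -- resulting `Z a f` is to become γ(a)(f).
  choose Z hZ using fun (a : Cₛ^∞⟮𝓘(ℝ, E); F, A⟯) f =>
    (hP.isDer_vpart (vanishingSection a)).neg.exists_basic (hι a) f
  have hZ' : ∀ a f, basic F V (Z a f) = -vpart P (vanishingSection a) (basic F V f) :=
    fun a f => (hZ a f).symm
  have basic_add : ∀ f g : C^∞⟮𝓘(ℝ, E), M; 𝓘(ℝ, ℝ), ℝ⟯,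
      basic F V (f + g) = basic F V f + basic F V g := fun _ _ => rfl
  have basic_sub : ∀ f g : C^∞⟮𝓘(ℝ, E), M; 𝓘(ℝ, ℝ), ℝ⟯,
      basic F V (f - g) = basic F V f - basic F V g := fun _ _ => rfl
  have basic_smul : ∀ (r : ℝ) (f : C^∞⟮𝓘(ℝ, E), M; 𝓘(ℝ, ℝ), ℝ⟯),
      basic F V (r • f) = r • basic F V f := fun _ _ => rfl
  have basic_mul : ∀ f g : C^∞⟮𝓘(ℝ, E), M; 𝓘(ℝ, ℝ), ℝ⟯,
      basic F V (f * g) = basic F V f * basic F V g := fun _ _ => rfl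
  have hleib : ∀ a f X, vpart B a (smulSec f X) = smulSec f (vpart B a X) + smulSec (Z a f) X := by
    intro a f X
    refine iota_injective ?_
    rw [iota_add, iota_smulSec, iota_smulSec, ← hι, ← hι, iota_smulSec, hZ', hP.leibniz]
    ring
  obtain ⟨a₀⟩ := nonempty_section E F A V
  let Z₀ : C^∞⟮𝓘(ℝ, E), M; 𝓘(ℝ, ℝ), ℝ⟯ →ₗ[ℝ] C^∞⟮𝓘(ℝ, E), M; 𝓘(ℝ, ℝ), ℝ⟯ :=
    { toFun := Z a₀
      map_add' := fun f g => basic_injective (F := F) (V := V) (by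
        rw [basic_add, hZ', hZ', hZ', basic_add, hp.vpart_add, neg_add])
      map_smul' := fun r f => basic_injective (F := F) (V := V) (by
        rw [RingHom.id_apply, basic_smul, hZ', hZ', basic_smul, hp.vpart_smul, smul_neg]) }
  -- The dependence of the symbol on the section is the bilinear part of the Poisson bracket on ι_X
  -- and f, so bilinearity and the Leibniz rule are inherited from there.
  have hact : ∀ X f, basic F V (Z (X +ᵥ a₀) f - Z a₀ f) =
      hp.linBrₗ (vanishingSection a₀) (iota X) (basic F V f) := by
    intro X f
    rw [basic_sub, hZ', hZ', vanishingSection_vadd, vpart_vadd, ← hp.linBrₗ_apply, map_neg,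
      LinearMap.neg_apply]
    abel
  let act : Cₛ^∞⟮𝓘(ℝ, E); F, V⟯ →ₗ[ℝ] C^∞⟮𝓘(ℝ, E), M; 𝓘(ℝ, ℝ), ℝ⟯ →ₗ[ℝ]
      C^∞⟮𝓘(ℝ, E), M; 𝓘(ℝ, ℝ), ℝ⟯ :=
    LinearMap.mk₂ ℝ (fun X f => Z (X +ᵥ a₀) f - Z a₀ f)
      (fun X Y f => basic_injective (F := F) (V := V) (by
        rw [basic_add, hact, hact, hact, iota_add, map_add, LinearMap.add_apply]))
      (fun r X f => basic_injective (F := F) (V := V) (by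
        rw [basic_smul, hact, hact, iota_smul, map_smul, LinearMap.smul_apply]))
      (fun X f g => basic_injective (F := F) (V := V) (by
        rw [basic_add, hact, hact, hact, basic_add, map_add]))
      (fun r X f => basic_injective (F := F) (V := V) (by
        rw [basic_smul, hact, hact, basic_smul, map_smul]))
  have hact' : ∀ X f, basic F V (act X f) =
      hp.linBrₗ (vanishingSection a₀) (iota X) (basic F V f) := hact
  have hskew : ∀ f g, hp.linBrₗ (vanishingSection a₀) f g = -hp.linBrₗ (vanishingSection a₀) g f :=
    hp.linBr_skew _
  have hmul : ∀ f g k, hp.linBrₗ (vanishingSection a₀) (f * g) k =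
      f * hp.linBrₗ (vanishingSection a₀) g k + hp.linBrₗ (vanishingSection a₀) f k * g := by
    intro f g k
    rw [hskew, hP.isDer_linBr _ k, hskew g, hskew f]
    ring
  -- The failure of `act` to be C^∞(M)-linear in X is {k, f} ι_X, by the Leibniz rule for {k ι_X,
  -- f}. It is basic for every X, which forces {k, f} = 0.
  have hbasic : ∀ k f, hp.linBrₗ (vanishingSection a₀) (basic F V k) (basic F V f) = 0 := by
    intro k f
    refine eq_zero_of_mul_iota_eq_basic fun X => ⟨act (smulSec k X) f - k * act X f, ?_⟩
    rw [basic_sub, basic_mul, hact', hact', iota_smulSec, hmul, add_sub_cancel_left]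
  obtain ⟨γ, hγ⟩ := exists_anchorMap a₀ (Z₀ := Z₀) (act := act)
    (fun f g => basic_injective (F := F) (V := V) (by
      change basic F V (Z a₀ (f * g)) = basic F V (f * Z a₀ g + Z a₀ f * g)
      rw [basic_add, basic_mul, basic_mul, hZ', hZ', hZ', basic_mul, hP.leibniz]
      ring))
    (fun k X f => basic_injective (F := F) (V := V) (by
      rw [basic_mul, hact', hact', iota_smulSec, hmul, hbasic, zero_mul, add_zero]))
    (fun X f g => basic_injective (F := F) (V := V) (by
      rw [basic_add, basic_mul, basic_mul, hact', hact', hact', basic_mul]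
      exact hP.isDer_linBr _ _ _ _))
  refine ⟨γ, fun a f X x => ?_⟩
  obtain ⟨Y, rfl⟩ := exists_vadd_section (V := V) a a₀
  have h1 : act Y f x + Z₀ f x = Z (Y +ᵥ a₀) f x := sub_add_cancel _ _
  rw [hγ, h1, hleib]
  rfl

end FibrewiseLinear

end AffBundle

end

/-! ### The one-to-one correspondence -/

theorem theorem19
    {E : Type*} [NormedAddCommGroup E] [NormedSpace ℝ E] [FiniteDimensional ℝ E]
    {M : Type*} [TopologicalSpace M] [ChartedSpace E M] [IsManifold 𝓘(ℝ, E) ∞ M]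
    [T2Space M] [SecondCountableTopology M]
    {F : Type*} [NormedAddCommGroup F] [NormedSpace ℝ F] [FiniteDimensional ℝ F] [Nontrivial F]
    {V : M → Type*} [∀ x, AddCommGroup (V x)] [∀ x, Module ℝ (V x)]
    [TopologicalSpace (TotalSpace F V)] [∀ x, TopologicalSpace (V x)] [FiberBundle F V]
    [VectorBundle ℝ F V] [ContMDiffVectorBundle ∞ F V 𝓘(ℝ, E)]
    {A : M → Type*} [∀ x, AddTorsor (V x) (A x)]
    [TopologicalSpace (TotalSpace F A)] [∀ x, TopologicalSpace (A x)] [FiberBundle F A]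
    [AffBundle.AffineBundle F V A] [AffBundle.SmoothAffineBundle F V A 𝓘(ℝ, E)] :
    ∃ a : AffBundle.LinSec 𝓘(ℝ, E) F V A ≃ Cₛ^∞⟮𝓘(ℝ, E); F, A⟯,
      (∀ (σ : AffBundle.LinSec 𝓘(ℝ, E) F V A) (x : M) (φ : AffBundle.AffDual F A x),
        φ (a σ x) • AffBundle.oneA F A x = φ - σ.1.toFun ⟨x, AffBundle.rho φ⟩) ∧
      (∀ B : Cₛ^∞⟮𝓘(ℝ, E); F, A⟯ → Cₛ^∞⟮𝓘(ℝ, E); F, A⟯ → Cₛ^∞⟮𝓘(ℝ, E); F, V⟯,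
        AffBundle.IsLieAffgebroidBracket B →
        ∃! P : AffBundle.RhoSection 𝓘(ℝ, E) F V A → AffBundle.RhoSection 𝓘(ℝ, E) F V A →
            AffBundle.DualFun 𝓘(ℝ, E) F V,
          AffBundle.IsLinearAffPoisson P ∧
          ∀ (σ₁ σ₂ : AffBundle.LinSec 𝓘(ℝ, E) F V A) (p : AffBundle.VDualTotal F V),
            P σ₁ σ₂ p = p.2 (B (a σ₁) (a σ₂) p.1)) ∧
      (∀ P : AffBundle.RhoSection 𝓘(ℝ, E) F V A → AffBundle.RhoSection 𝓘(ℝ, E) F V A →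
          AffBundle.DualFun 𝓘(ℝ, E) F V,
        AffBundle.IsLinearAffPoisson P →
        ∃! B : Cₛ^∞⟮𝓘(ℝ, E); F, A⟯ → Cₛ^∞⟮𝓘(ℝ, E); F, A⟯ → Cₛ^∞⟮𝓘(ℝ, E); F, V⟯,
          AffBundle.IsLieAffgebroidBracket B ∧
          ∀ (σ₁ σ₂ : AffBundle.LinSec 𝓘(ℝ, E) F V A) (p : AffBundle.VDualTotal F V),
            P σ₁ σ₂ p = p.2 (B (a σ₁) (a σ₂) p.1)) := by
  have hpt : ∀ {f : AffBundle.DualFun 𝓘(ℝ, E) F V} {X : Cₛ^∞⟮𝓘(ℝ, E); F, V⟯},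
      (∀ p : AffBundle.VDualTotal F V, f p = p.2 (X p.1)) → f = AffBundle.iota X := fun h =>
    ContMDiffMap.ext h
  refine ⟨AffBundle.linSecEquiv E F V A, AffBundle.linSecEquiv_spec, fun B hB => ?_, fun P hP => ?_⟩
  · obtain ⟨P, hP, hPB⟩ := AffBundle.exists_affPoisson hB
    refine ⟨P, ⟨⟨hP, fun σ₁ σ₂ h₁ h₂ => ?_⟩, fun σ₁ σ₂ p => ?_⟩, fun P' hP' => ?_⟩
    · obtain ⟨a, rfl⟩ := AffBundle.exists_eq_vanishingSection h₁
      obtain ⟨b, rfl⟩ := AffBundle.exists_eq_vanishingSection h₂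
      rw [hPB]
      exact AffBundle.isLinearFun_iota _
    · rw [← AffBundle.vanishingSection_linSecEquiv σ₁, ← AffBundle.vanishingSection_linSecEquiv σ₂,
        hPB]
      rfl
    -- Every pair of vanishing sections comes from linear sections, on which the compatibility
    -- condition fixes both brackets.
    · refine hP'.1.isAffPoisson.ext hP fun a b => ?_
      have h := hpt (hP'.2 ((AffBundle.linSecEquiv E F V A).symm a)
        ((AffBundle.linSecEquiv E F V A).symm b))
      rw [Equiv.apply_symm_apply, Equiv.apply_symm_apply] at h
      exact h.trans (hPB a b).symm
  · obtain ⟨B, hB, hPB⟩ := AffBundle.exists_lieAffgebroidBracket hP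
    refine ⟨B, ⟨hB, fun σ₁ σ₂ p => ?_⟩, fun B' hB' => ?_⟩
    · rw [← AffBundle.vanishingSection_linSecEquiv σ₁, ← AffBundle.vanishingSection_linSecEquiv σ₂,
        hPB]
      rfl
    · funext a b
      refine AffBundle.iota_injective ?_
      have h := hpt (hB'.2 ((AffBundle.linSecEquiv E F V A).symm a)
        ((AffBundle.linSecEquiv E F V A).symm b))
      rw [Equiv.apply_symm_apply, Equiv.apply_symm_apply] at h
      exact h.symm.trans (hPB a b)
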